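/- \textbf{Setting.} Fix dimensions $m$ and $n\ge 1$. For every SNR $\rho$ let $\mu_\rho$ be a probability law on $\mathbb R^{m\times n}$, and consider the channel $y=Hx+w$, where $H\sim\mu_\rho$, $w\sim\mathcal N(0,I_m)$, $x$ is uniformly distributed on a finite codebook, and $H,w,x$ are independent. Write $f(\rho)\doteq\rho^{a}$ if $\lim_{\rho\to\infty}\log f(\rho)/\log\rho=a$, and $f(\rho)\,\dot\le\,\rho^a$ if $\limsup_{\rho\to\infty}\log f(\rho)/\log\rho\le a$. The channel is \emph{power limited} if $\mathbb E\|H\|_F^2\,\dot\le\,\rho$. A \emph{lattice design} consists of a lattice $\Lambda=G\mathbb Z^n$, $G\in\mathbb R^{n\times n}$ invertible, and a compact convex set $\mathcal R\subset\mathbb R^n$ with $0$ in its interior; its codebook at multiplexing gain $r\ge0$ is $\mathcal X_r=\phi_r\Lambda\cap\mathcal R$, $\phi_r=\rho^{-rT/n}$, where $T\ge1$ is a fixed integer. A decoder has diversity gain $d$ at $r$ if $P(\hat x\ne x)\doteq\rho^{-d}$ for $x$ uniform on $\mathcal X_r$ (declaring an error counts as $\hat x\neq x$); $d_{\mathrm{ML}}(r)$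 is the diversity gain of the maximum likelihood decoder $\hat x_{\mathrm{ML}}\in\arg\min_{\hat x\in\mathcal X_r}\|y-H\hat x\|^2$, provided the limit exists. Complexity is the number of operations of a program over finitely many real registers, in which each arithmetic operation, each rounding to a nearest integer, each comparison and each loading of an integer constant counts as one floating point operation. \emph{The LLL-aided linear decoder} with positive definite regularization matrix $W$: take $B$ with $B^{\mathsf T}B=H^{\mathsf T}H+W$ and $F=B^{-\mathsf T}H^{\mathsf T}$, a unimodular $U$ such that the columns of $BGU$ are LLL-reduced (parameter $3/4$), round the coordinates of $Fy$ in the basis $\phi_rBGU$ to an integer vector $z$, and return $\hat x=\phi_rGUz$. \textbf{Theorem 3.} There is a program, depending only on $m$ and $n$, that on input $(G,W,\phi,H,y)$, with $G$ invertible, $W$ positive definite and $\phi>0$, always halts and returns the output of the LLL-aided linear decoder (with $\phi$ in place of $\phi_r$), such that the following holds. For every real $D$ there is a constant $c>0$, depending only on $m$, $n$, $D$, such that for every lattice design, every $T$, every positive definite $W$ and every power limited channel, and for every $r\ge0$ at which $d_{\mathrm{ML}}$ is finite and (right) continuous ($d_{\mathrm{ML}}$ existing and being finite on some $[r,r+\varepsilon)$,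 $\varepsilon>0$) with $d_{\mathrm{ML}}(r)\le D$, the decoder that runs this program on $(G,W,\phi_r,H,y)$ with a time-out after $c\log\rho$ operations, declaring an error if the program has not halted by then, is DMT optimal at $r$: $$P(\hat x\neq x)\doteq\rho^{-d_{\mathrm{ML}}(r)}.$$ In particular, over any range of $r$ on which $d_{\mathrm{ML}}$ is continuous and finite, DMT optimal decoding of any lattice design is possible with worst-case complexity $O(\log\rho)$. -/

import Mathlib

open MeasureTheory ProbabilityTheory Filter Topology
open scoped ENNReal

noncomputable section

namespace LatticeDMT

/-! ### Exponential order in the SNR -/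

/-- The exponent `log f(ρ) / log ρ`, in the extended reals (so that `log 0 = -∞`). -/
def expOrder (f : ℝ → ℝ≥0∞) (ρ : ℝ) : EReal :=
  ENNReal.log (f ρ) / ((Real.log ρ : ℝ) : EReal)

/-- `f(ρ) ≐ ρ ^ x`. -/
def DotEq (f : ℝ → ℝ≥0∞) (x : ℝ) : Prop :=
  Tendsto (expOrder f) atTop (𝓝 (x : EReal))

/-- `f(ρ) ⩽˙ ρ ^ x`. -/
def DotLE (f : ℝ → ℝ≥0∞) (x : ℝ) : Prop :=
  limsup (expOrder f) atTop ≤ (x : EReal)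

/-! ### Lattice designs -/

/-- A lattice design in `ℝⁿ`: a lattice `G ℤⁿ`, given by a full rank generator matrix, and a
compact convex shaping region with `0` in its interior. -/
structure LatticeDesign (n : ℕ) where
  G : Matrix (Fin n) (Fin n) ℝ
  det_ne_zero : G.det ≠ 0
  R : Set (Fin n → ℝ)
  isCompact : IsCompact R
  convex : Convex ℝ R
  zero_mem : (0 : Fin n → ℝ) ∈ interior R

/-- The scaling `φ_r = ρ ^ (-rT/n)`. -/
def scaling (n T : ℕ) (ρ r : ℝ) : ℝ := ρ ^ (-(r * T / n))

/-- The codebook `(φ_r Λ) ∩ R`. -/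
def LatticeDesign.codebook {n : ℕ} (L : LatticeDesign n) (T : ℕ) (ρ r : ℝ) :
    Set (Fin n → ℝ) :=
  {x | x ∈ L.R ∧ ∃ z : Fin n → ℤ,
    x = scaling n T ρ r • L.G.mulVec (fun i => (z i : ℝ))}

/-! ### Channel, decoders and error probability -/

/-- The squared Euclidean norm. -/
def sqNorm {ι : Type*} [Fintype ι] (v : ι → ℝ) : ℝ := ∑ i, v i ^ 2

/-- What the receiver knows: the channel matrix `H` and the received vector `y`. -/
abbrev Observation (m n : ℕ) := (Fin m → Fin n → ℝ) × (Fin m → ℝ)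

/-- A decoder outputs a vector, or `none` if it declares an error. -/
abbrev Decoder (m n : ℕ) := Observation m n → Option (Fin n → ℝ)

/-- The law of the noise: `m` i.i.d. standard Gaussian random variables. -/
def noise (m : ℕ) : Measure (Fin m → ℝ) := Measure.pi fun _ => gaussianReal 0 1

/-- The probability `P(x̂ ≠ x)` for `y = H x + w`, where `x` is uniform on the (finite) codebook
`X`, `H` has law `μ`, `w` is standard Gaussian, and `x`, `H`, `w` are independent. -/
def errorProb {m n : ℕ} (X : Set (Fin n → ℝ)) (μ : Measure (Fin m → Fin n → ℝ))
    (dec : Decoder m n) : ℝ≥0∞ :=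
  (∑' x : X, (μ.prod (noise m))
    {p | dec (p.1, (Matrix.of p.1).mulVec x.1 + p.2) ≠ some x.1}) / (X.ncard : ℝ≥0∞)

/-- `f` is a maximum likelihood decoder for `X`: it always returns an element of `X` that
minimizes `‖y - H x‖²` (ties being broken in any measurable way). -/
def IsMLDecoder {m n : ℕ} (X : Set (Fin n → ℝ)) (f : Observation m n → (Fin n → ℝ)) : Prop :=
  Measurable f ∧ ∀ p : Observation m n, f p ∈ X ∧
    ∀ x ∈ X, sqNorm (p.2 - (Matrix.of p.1).mulVec (f p))
      ≤ sqNorm (p.2 - (Matrix.of p.1).mulVec x)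

/-- The decoders `dec ρ` (at SNR `ρ`) achieve the diversity gain `d` at multiplexing gain `r` over
the channel whose matrix has law `μ ρ` at SNR `ρ`. -/
def HasDiversity {m n : ℕ} (L : LatticeDesign n) (T : ℕ) (μ : ℝ → Measure (Fin m → Fin n → ℝ))
    (r : ℝ) (dec : ℝ → Decoder m n) (d : ℝ) : Prop :=
  DotEq (fun ρ => errorProb (L.codebook T ρ r) (μ ρ) (dec ρ)) (-d)

/-- `d_ML(r)` exists and is equal to the real number `d`. -/
def HasMLDiversity {m n : ℕ} (L : LatticeDesign n) (T : ℕ) (μ : ℝ → Measure (Fin m → Fin n → ℝ))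
    (r d : ℝ) : Prop :=
  ∃ f : ℝ → Observation m n → (Fin n → ℝ),
    (∀ ρ : ℝ, 0 < ρ → IsMLDecoder (L.codebook T ρ r) (f ρ)) ∧
    HasDiversity L T μ r (fun ρ p => some (f ρ p)) d

/-- Power limited channel: `E ‖H‖_F² ⩽˙ ρ`. -/
def PowerLimited {m n : ℕ} (μ : ℝ → Measure (Fin m → Fin n → ℝ)) : Prop :=
  DotLE (fun ρ => ∫⁻ H, ENNReal.ofReal (∑ i, ∑ j, H i j ^ 2) ∂(μ ρ)) 1

/-! ### LLL-aided linear decoding -/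

/-- The `j`-th column of a matrix, as a vector of Euclidean space. -/
def column {n : ℕ} (M : Matrix (Fin n) (Fin n) ℝ) (j : Fin n) : EuclideanSpace ℝ (Fin n) :=
  WithLp.toLp 2 (fun i => M i j)

/-- The Gram-Schmidt orthogonalization of the columns of `M`. -/
def gsVec {n : ℕ} (M : Matrix (Fin n) (Fin n) ℝ) (j : Fin n) : EuclideanSpace ℝ (Fin n) :=
  InnerProductSpace.gramSchmidt ℝ (column M) j

/-- The Gram-Schmidt coefficients of the columns of `M`. -/
def gsCoeff {n : ℕ} (M : Matrix (Fin n) (Fin n) ℝ) (i j : Fin n) : ℝ :=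
  inner ℝ (column M i) (gsVec M j) / ‖gsVec M j‖ ^ 2

/-- The columns of `M` form an LLL-reduced basis (with the usual parameter `3/4`). -/
def IsLLLReduced {n : ℕ} (M : Matrix (Fin n) (Fin n) ℝ) : Prop :=
  (∀ i j : Fin n, j < i → |gsCoeff M i j| ≤ 1 / 2) ∧
  (∀ i j : Fin n, (j : ℕ) + 1 = i →
    (3 / 4 - gsCoeff M i j ^ 2) * ‖gsVec M j‖ ^ 2 ≤ ‖gsVec M i‖ ^ 2)

/-- `x` is a decision of the LLL-aided linear implementation of the regularized lattice decoder
(equivalently, for `W = 1`, of the MMSE-GDFE lattice decoder) for the lattice `φ G ℤⁿ`: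
with a feedback filter `B`, `Bᵀ B = Hᵀ H + W`, and the forward filter `F = B⁻ᵀ Hᵀ`, the basis
`B G` is LLL-reduced to `B G U` with `U` unimodular, the coordinates of `F y` in the basis
`φ B G U` are rounded to the nearest integers `z`, and `x = φ G U z`. -/
def IsLLLLinearDecision {m n : ℕ} (G W : Matrix (Fin n) (Fin n) ℝ) (φ : ℝ)
    (p : Observation m n) (x : Fin n → ℝ) : Prop :=
  ∃ (B : Matrix (Fin n) (Fin n) ℝ) (U : Matrix (Fin n) (Fin n) ℤ),
    B.transpose * B = (Matrix.of p.1).transpose * Matrix.of p.1 + W ∧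
    IsUnit U.det ∧
    IsLLLReduced (B * G * U.map (Int.cast : ℤ → ℝ)) ∧
    x = φ • (G * U.map (Int.cast : ℤ → ℝ)).mulVec (fun i =>
      ((round (((φ • (B * G * U.map (Int.cast : ℤ → ℝ)))⁻¹.mulVec
        ((B.transpose⁻¹ * (Matrix.of p.1).transpose).mulVec p.2)) i) : ℤ) : ℝ))

/-! ### A machine with real registers that counts floating point operations -/

/-- Names of the real registers: the generator matrix `G`, the regularization matrix `W`, the
scaling `φ`, the channel matrix `H`, the received vector `y`, the output, and work registers. -/
inductive Reg (m n : ℕ) : Type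
  | gen (i j : Fin n)
  | regu (i j : Fin n)
  | scale
  | chan (i : Fin m) (j : Fin n)
  | recv (i : Fin m)
  | out (i : Fin n)
  | work (k : ℕ)
  deriving DecidableEq

/-- Programs over real registers named by `V`. There are integer constants only and no indirect
addressing, so that a program touches a fixed finite set of registers. -/
inductive Program (V : Type) : Type
  | const (a : V) (z : ℤ)
  | add (a b c : V)
  | sub (a b c : V)
  | mul (a b c : V)
  | div (a b c : V)
  | rnd (a b : V)
  | seq (P Q : Program V)
  | ite (a b : V) (P Q : Program V)
  | loop (a b : V) (P : Program V)

/-- `Exec P s s' t`: started with register contents `s`, the program `P` halts with contents `s'`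
after exactly `t` operations. The four arithmetic operations, rounding to the nearest integer,
loading a constant and comparing two registers cost one operation each. `ite a b P Q` runs `P` if
`a ≤ b` and `Q` otherwise; `loop a b P` repeats `P` as long as `a ≤ b`. -/
inductive Exec {V : Type} [DecidableEq V] : Program V → (V → ℝ) → (V → ℝ) → ℕ → Prop
  | const (a : V) (z : ℤ) (s : V → ℝ) : Exec (.const a z) s (Function.update s a (z : ℝ)) 1
  | add (a b c : V) (s : V → ℝ) : Exec (.add a b c) s (Function.update s a (s b + s c)) 1
  | sub (a b c : V) (s : V → ℝ) : Exec (.sub a b c) s (Function.update s a (s b - s c)) 1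
  | mul (a b c : V) (s : V → ℝ) : Exec (.mul a b c) s (Function.update s a (s b * s c)) 1
  | div (a b c : V) (s : V → ℝ) : Exec (.div a b c) s (Function.update s a (s b / s c)) 1
  | rnd (a b : V) (s : V → ℝ) :
      Exec (.rnd a b) s (Function.update s a ((round (s b) : ℤ) : ℝ)) 1
  | seq {P Q : Program V} {s s' s'' : V → ℝ} {t t' : ℕ} :
      Exec P s s' t → Exec Q s' s'' t' → Exec (.seq P Q) s s'' (t + t')
  | ite_true {a b : V} {P Q : Program V} {s s' : V → ℝ} {t : ℕ} :
      s a ≤ s b → Exec P s s' t → Exec (.ite a b P Q) s s' (t + 1)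
  | ite_false {a b : V} {P Q : Program V} {s s' : V → ℝ} {t : ℕ} :
      ¬ s a ≤ s b → Exec Q s s' t → Exec (.ite a b P Q) s s' (t + 1)
  | loop_true {a b : V} {P : Program V} {s s' s'' : V → ℝ} {t t' : ℕ} :
      s a ≤ s b → Exec P s s' t → Exec (.loop a b P) s' s'' t' →
        Exec (.loop a b P) s s'' (t + t' + 1)
  | loop_false {a b : V} {P : Program V} {s : V → ℝ} :
      ¬ s a ≤ s b → Exec (.loop a b P) s s 1

/-- The machine is deterministic: final contents and operation count are unique. -/
theorem Exec.det {V : Type} [DecidableEq V] {P : Program V} {s s₁ s₂ : V → ℝ} {t₁ t₂ : ℕ}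
    (h₁ : Exec P s s₁ t₁) (h₂ : Exec P s s₂ t₂) : s₁ = s₂ ∧ t₁ = t₂ := by
  induction h₁ generalizing s₂ t₂ with
  | const | add | sub | mul | div | rnd => cases h₂; exact ⟨rfl, rfl⟩
  | seq _ _ ih ih' =>
    cases h₂ with
    | seq a b =>
      obtain ⟨rfl, rfl⟩ := ih a
      obtain ⟨rfl, rfl⟩ := ih' b
      exact ⟨rfl, rfl⟩
  | ite_true h _ ih =>
    cases h₂ with
    | ite_true _ a => obtain ⟨rfl, rfl⟩ := ih a; exact ⟨rfl, rfl⟩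
    | ite_false h' _ => exact absurd h h'
  | ite_false h _ ih =>
    cases h₂ with
    | ite_true h' _ => exact absurd h' h
    | ite_false _ a => obtain ⟨rfl, rfl⟩ := ih a; exact ⟨rfl, rfl⟩
  | loop_true h _ _ ih ih' =>
    cases h₂ with
    | loop_true _ a b =>
      obtain ⟨rfl, rfl⟩ := ih a
      obtain ⟨rfl, rfl⟩ := ih' b
      exact ⟨rfl, rfl⟩
    | loop_false h' => exact absurd h h'
  | loop_false h =>
    cases h₂ with
    | loop_true h' _ _ => exact absurd h' h
    | loop_false _ => exact ⟨rfl, rfl⟩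

/-- The initial register contents; output and work registers start at `0`. -/
def initial {m n : ℕ} (G W : Matrix (Fin n) (Fin n) ℝ) (φ : ℝ) (p : Observation m n) :
    Reg m n → ℝ
  | .gen i j => G i j
  | .regu i j => W i j
  | .scale => φ
  | .chan i j => p.1 i j
  | .recv i => p.2 i
  | .out _ => 0
  | .work _ => 0

/-- The program halts on the given input after exactly `t` operations, with output `x`. -/
def Outputs {m n : ℕ} (P : Program (Reg m n)) (G W : Matrix (Fin n) (Fin n) ℝ) (φ : ℝ)
    (p : Observation m n) (x : Fin n → ℝ) (t : ℕ) : Prop :=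
  ∃ s : Reg m n → ℝ, Exec P (initial G W φ p) s t ∧ ∀ i, s (.out i) = x i

open Classical in
/-- The decoder that runs the program for at most `N` operations, and returns its output if it
has halted by then; otherwise it times out, i.e. it stops and declares an error. -/
def timeoutDecoder {m n : ℕ} (P : Program (Reg m n)) (G W : Matrix (Fin n) (Fin n) ℝ) (φ : ℝ)
    (N : ℝ) : Decoder m n := fun p =>
  if h : ∃ x : Fin n → ℝ, ∃ t : ℕ, (t : ℝ) ≤ N ∧ Outputs P G W φ p x t then some h.choose
  else none

end LatticeDMT

end

noncomputable section

namespace LatticeDMT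

/-! ### Compiling straight-line computations -/

section Compile

variable {V : Type}

/-! Optimality. Whatever `H` is, the filtered error `F y - B x` has squared norm at most `‖w‖² + xᵀ
W x` (`sqNorm_filtered_noise_le`). Rounding in an LLL-reduced basis is correct once this is below a
fixed fraction, depending only on `n`, of the squared minimum distance of `φ_r B G ℤⁿ`
(`abs_coord_le_of_reduced`, `eq_of_isLLLLinearDecision`). The term `xᵀ W x` is bounded on the
shaping region, and `‖w‖` exceeds a given positive power of `ρ` with probability below any
prescribed power of `ρ`. Hence it suffices that the minimum distance be a larger positive power of
`ρ`.

To see when it is, compare with a slightly higher gain `r' > r`, for which `φ_r = φ_{r'} τ` with `τ`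
a positive power of `ρ`. Call it an outage if a nonzero vector of `φ_{r'} Λ` of norm at most `ε` is
received with norm at most `1`. Without outage the regularized squared distance at `r` is at least a
constant times `τ²`: short vectors are separated by `H`, long ones by `W` (`le_regularized_norm`).
In an outage even the ML decoder at gain `r'` fails with probability bounded below, because a fixed
fraction of its codewords have a neighbour received at distance at most `1`
(`LatticeDesign.exists_outage_le`). So the outage exponent is at least `d_ML(r')`, and right
continuity permits `r' → r`. The converse inequality is the optimality of the ML rule
(`errorProb_ml_le`).

Complexity. A filter `B` would require square roots, which the machine does not have. The LLL
algorithm and the final rounding therefore use only the Gram matrix `Gᵀ(HᵀH + W)G`. Each swap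
multiplies the LLL potential by at most `3/4`. The potential starts below `K ^ n²` and never falls
below `ε ^ n²`, because an integral unimodular basis has potential at least `1`
(`LLLInvariant.le_pow`); this gives `O(log (K / ε))` rounds. Here `ε` depends on `G` and `W` only,
while `K` is a constant times `1 + ‖H‖²`. The power constraint makes `‖H‖² ≥ ρ ^ a` as rare as `ρ ^
(2 - a)`, so with `a = |D| + 2` time-outs do not harm the diversity. Constants of the design enter
additively next to `log ρ`, which is why `c` depends on `m`, `n` and `D` alone. -/

/-- The functions of the registers in `S` that are obtained from registers and integer constants by
arithmetic operations, rounding and case distinctions. -/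
inductive Comp (S : Set V) : ((V → ℝ) → ℝ) → Prop
  | reg (v : V) (hv : v ∈ S) : Comp S fun s => s v
  | const (z : ℤ) : Comp S fun _ => (z : ℝ)
  | add {f g : (V → ℝ) → ℝ} : Comp S f → Comp S g → Comp S fun s => f s + g s
  | sub {f g : (V → ℝ) → ℝ} : Comp S f → Comp S g → Comp S fun s => f s - g s
  | mul {f g : (V → ℝ) → ℝ} : Comp S f → Comp S g → Comp S fun s => f s * g s
  | div {f g : (V → ℝ) → ℝ} : Comp S f → Comp S g → Comp S fun s => f s / g s
  | rnd {f : (V → ℝ) → ℝ} : Comp S f → Comp S fun s => ((round (f s) : ℤ) : ℝ)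
  | ite {f g h k : (V → ℝ) → ℝ} : Comp S f → Comp S g → Comp S h → Comp S k →
      Comp S fun s => if f s ≤ g s then h s else k s

/-- With `S` the complement of the temporaries, this allows a later subexpression to be evaluated
after earlier ones have written to temporaries. -/
theorem Comp.congr {S : Set V} {f : (V → ℝ) → ℝ} (hf : Comp S f) {s s' : V → ℝ}
    (h : ∀ v ∈ S, s' v = s v) : f s' = f s := by
  induction hf with
  | reg v hv => exact h v hv
  | const z => rfl
  | add _ _ h1 h2 | sub _ _ h1 h2 | mul _ _ h1 h2 | div _ _ h1 h2 => simp only [h1, h2]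
  | rnd _ h1 => simp only [h1]
  | ite _ _ _ _ h1 h2 h3 h4 => simp only [h1, h2, h3, h4]

variable [DecidableEq V]

/-- There is a program of bounded cost that puts the value of `f` into the temporary register
`tmp k`, keeping the registers outside `tmp` and the temporary registers before `tmp k`. -/
def EvalInto (tmp : ℕ → V) (f : (V → ℝ) → ℝ) (k : ℕ) : Prop :=
  ∃ (P : Program V) (c : ℕ), ∀ s : V → ℝ, ∃ t ≤ c, ∃ s', Exec P s s' t ∧ s' (tmp k) = f s ∧
    (∀ v, v ∉ Set.range tmp → s' v = s v) ∧ ∀ j < k, s' (tmp j) = s (tmp j)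

/-- Stack discipline: the second operand is evaluated at level `k + 1`, which protects the first
one, waiting at level `k`. -/
theorem EvalInto.binary {tmp : ℕ → V} (htmp : tmp.Injective) {f g : (V → ℝ) → ℝ}
    (hg : Comp (Set.range tmp)ᶜ g) (op : V → V → V → Program V) (o : ℝ → ℝ → ℝ)
    (hop : ∀ a b c (s : V → ℝ), Exec (op a b c) s (Function.update s a (o (s b) (s c))) 1)
    {k : ℕ} (h1 : EvalInto tmp f k) (h2 : EvalInto tmp g (k + 1)) :
    EvalInto tmp (fun s => o (f s) (g s)) k := by
  obtain ⟨P, c, hP⟩ := h1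
  obtain ⟨Q, d, hQ⟩ := h2
  refine ⟨.seq P (.seq Q (op (tmp k) (tmp k) (tmp (k + 1)))), c + (d + 1), fun s => ?_⟩
  obtain ⟨t, ht, s1, he, hv, hm, hj⟩ := hP s
  obtain ⟨t', ht', s2, he', hv', hm', hj'⟩ := hQ s1
  refine ⟨_, by omega, _, .seq he (.seq he' (hop _ _ _ _)), ?_, fun v hv => ?_, fun j hj2 => ?_⟩
  · rw [Function.update_self, hv', hj' k (by omega), hv, hg.congr hm]
  · rw [Function.update_of_ne (fun h => hv ⟨k, h.symm⟩), hm' v hv, hm v hv]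
  · rw [Function.update_of_ne (fun h => by have := htmp h; omega), hj' j (by omega), hj j hj2]

theorem Comp.evalInto {tmp : ℕ → V} (htmp : tmp.Injective) {f : (V → ℝ) → ℝ}
    (hf : Comp (Set.range tmp)ᶜ f) : ∀ k, EvalInto tmp f k := by
  induction hf with
  | reg v hv =>
    intro k
    -- There is no copy instruction, so a register is moved by adding zero to it.
    refine ⟨.seq (.const (tmp k) 0) (.add (tmp k) v (tmp k)), 2, fun s => ?_⟩
    have hvk : v ≠ tmp k := fun h => hv ⟨k, h.symm⟩
    refine ⟨_, le_rfl, _, .seq (.const _ _ _) (.add _ _ _ _), ?_, fun w hw => ?_, fun j hj => ?_⟩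
    · simp [Function.update_of_ne hvk]
    · have : w ≠ tmp k := fun h => hw ⟨k, h.symm⟩
      simp [Function.update_of_ne this]
    · have : tmp j ≠ tmp k := fun h => by have := htmp h; omega
      simp [Function.update_of_ne this]
  | const z =>
    intro k
    refine ⟨.const (tmp k) z, 1, fun s => ⟨_, le_rfl, _, .const _ _ _, by simp, fun w hw => ?_,
      fun j hj => ?_⟩⟩
    · exact Function.update_of_ne (fun h => hw ⟨k, h.symm⟩) _ _
    · exact Function.update_of_ne (fun h => by have := htmp h; omega) _ _
  | add _ hg h1 h2 => exact fun k => .binary htmp hg .add (· + ·) .add (h1 k) (h2 _)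
  | sub _ hg h1 h2 => exact fun k => .binary htmp hg .sub (· - ·) .sub (h1 k) (h2 _)
  | mul _ hg h1 h2 => exact fun k => .binary htmp hg .mul (· * ·) .mul (h1 k) (h2 _)
  | div _ hg h1 h2 => exact fun k => .binary htmp hg .div (· / ·) .div (h1 k) (h2 _)
  | rnd _ h1 =>
    intro k
    obtain ⟨P, c, hP⟩ := h1 k
    refine ⟨.seq P (.rnd (tmp k) (tmp k)), c + 1, fun s => ?_⟩
    obtain ⟨t, ht, s1, he, hv, hm, hj⟩ := hP s
    refine ⟨_, by omega, _, .seq he (.rnd _ _ _), by simp [hv], fun v hv => ?_, fun j hj2 => ?_⟩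
    · rw [Function.update_of_ne (fun h => hv ⟨k, h.symm⟩), hm v hv]
    · rw [Function.update_of_ne (fun h => by have := htmp h; omega), hj j hj2]
  | @ite f g h l hf hg hh hl h1 h2 h3 h4 =>
    intro k
    obtain ⟨P, c, hP⟩ := h1 k
    obtain ⟨Q, d, hQ⟩ := h2 (k + 1)
    obtain ⟨P', c', hP'⟩ := h3 k
    obtain ⟨Q', d', hQ'⟩ := h4 k
    refine ⟨.seq P (.seq Q (.ite (tmp k) (tmp (k + 1)) P' Q')), c + (d + (c' + d' + 1)),
      fun s => ?_⟩
    obtain ⟨t, ht, s1, he, hv, hm, hj⟩ := hP s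
    obtain ⟨t', ht', s2, he', hv', hm', hj'⟩ := hQ s1
    have hm2 : ∀ v, v ∉ Set.range tmp → s2 v = s v := fun v hv => by rw [hm' v hv, hm v hv]
    have hj2 : ∀ j < k, s2 (tmp j) = s (tmp j) := fun j hj2 => by
      rw [hj' j (by omega), hj j hj2]
    have e1 : s2 (tmp k) = f s := by rw [hj' k (by omega), hv]
    have e2 : s2 (tmp (k + 1)) = g s := by rw [hv', hg.congr hm]
    by_cases hle : f s ≤ g s
    · obtain ⟨t3, ht3, s3, he3, hv3, hm3, hj3⟩ := hP' s2
      refine ⟨_, ?_, _, .seq he (.seq he' (.ite_true (by rwa [e1, e2]) he3)), ?_, fun v hv => ?_,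
        fun j hj => ?_⟩
      · omega
      · rw [hv3, hh.congr hm2]; exact (if_pos hle).symm
      · rw [hm3 v hv, hm2 v hv]
      · rw [hj3 j hj, hj2 j hj]
    · obtain ⟨t3, ht3, s3, he3, hv3, hm3, hj3⟩ := hQ' s2
      refine ⟨_, ?_, _, .seq he (.seq he' (.ite_false (by rwa [e1, e2]) he3)), ?_, fun v hv => ?_,
        fun j hj => ?_⟩
      · omega
      · rw [hv3, hl.congr hm2]; exact (if_neg hle).symm
      · rw [hm3 v hv, hm2 v hv]
      · rw [hj3 j hj, hj2 j hj]

/-- All right-hand sides are evaluated before any target is overwritten: the value for the head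
waits in `tmp k` while the tail is processed from level `k + 1`, and is stored only afterwards. This
makes the assignment simultaneous. -/
theorem exists_update_program_aux {tmp : ℕ → V} (htmp : tmp.Injective)
    (F : (V → ℝ) → V → ℝ) (l : List V) (hl : ∀ v ∈ l, Comp (Set.range tmp)ᶜ fun s => F s v)
    (hmain : ∀ v ∈ l, v ∉ Set.range tmp) (k : ℕ) :
    ∃ (P : Program V) (c : ℕ), ∀ s : V → ℝ, ∃ t ≤ c, ∃ s', Exec P s s' t ∧
      (∀ v ∈ l, s' v = F s v) ∧ (∀ v, v ∉ Set.range tmp → v ∉ l → s' v = s v) ∧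
      ∀ j < k, s' (tmp j) = s (tmp j) := by
  induction l generalizing k with
  | nil =>
    -- The language has no empty program; clearing a temporary serves as one.
    refine ⟨.const (tmp k) 0, 1, fun s => ⟨_, le_rfl, _, .const _ _ _, by simp, fun w hw _ => ?_,
      fun j hj => ?_⟩⟩
    · exact Function.update_of_ne (fun h => hw ⟨k, h.symm⟩) _ _
    · exact Function.update_of_ne (fun h => by have := htmp h; omega) _ _
  | cons v l ih =>
    obtain ⟨P, c, hP⟩ := (hl v (by simp)).evalInto htmp k
    obtain ⟨Q, d, hQ⟩ := ih (fun v hv => hl v (by simp [hv])) (fun v hv => hmain v (by simp [hv]))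
      (k + 1)
    refine ⟨.seq P (.seq Q (.seq (.const (tmp (k + 1)) 0) (.add v (tmp k) (tmp (k + 1))))),
      c + (d + (1 + 1)), fun s => ?_⟩
    obtain ⟨t, ht, s1, he, hv, hm, hj⟩ := hP s
    obtain ⟨t', ht', s2, he', hv', hm', hj'⟩ := hQ s1
    have hk : tmp k ≠ tmp (k + 1) := fun h => by have := htmp h; omega
    refine ⟨_, ?_, _, .seq he (.seq he' (.seq (.const _ _ _) (.add _ _ _ _))), ?_, ?_, ?_⟩
    · omega
    · intro w hw
      by_cases hwv : w = v
      · subst hwv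
        simp [Function.update_of_ne hk, hj' k (by omega), hv]
      · have hwl : w ∈ l := by simpa [hwv] using hw
        have : w ≠ tmp (k + 1) := fun h => hmain w hw ⟨k + 1, h.symm⟩
        rw [Function.update_of_ne hwv, Function.update_of_ne this, hv' w hwl]
        exact (hl w hw).congr hm
    · intro w hw hwl
      have : w ≠ tmp (k + 1) := fun h => hw ⟨k + 1, h.symm⟩
      simp only [List.mem_cons, not_or] at hwl
      rw [Function.update_of_ne hwl.1, Function.update_of_ne this, hm' w hw hwl.2, hm w hw]
    · intro j hjk
      have h1 : tmp j ≠ v := fun h => hmain v (by simp) ⟨j, h⟩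
      have h2 : tmp j ≠ tmp (k + 1) := fun h => by have := htmp h; omega
      rw [Function.update_of_ne h1, Function.update_of_ne h2, hj' j (by omega), hj j hjk]

/-- Simultaneous assignment to finitely many registers outside `tmp`, at bounded cost. -/
theorem exists_update_program {tmp : ℕ → V} (htmp : tmp.Injective)
    (F : (V → ℝ) → V → ℝ) (l : List V) (hl : ∀ v ∈ l, Comp (Set.range tmp)ᶜ fun s => F s v)
    (hmain : ∀ v ∈ l, v ∉ Set.range tmp) :
    ∃ (P : Program V) (c : ℕ), ∀ s : V → ℝ, ∃ t ≤ c, ∃ s', Exec P s s' t ∧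
      (∀ v ∈ l, s' v = F s v) ∧ ∀ v, v ∉ Set.range tmp → v ∉ l → s' v = s v := by
  obtain ⟨P, c, h⟩ := exists_update_program_aux htmp F l hl hmain 0
  refine ⟨P, c, fun s => ?_⟩
  obtain ⟨t, ht, s', h1, h2, h3, -⟩ := h s
  exact ⟨t, ht, s', h1, h2, h3⟩

/-- A loop halts after at most `N` rounds if its body preserves an invariant `I k` of the number `k`
of rounds that excludes further rounds for `k ≥ N`. -/
theorem exec_loop {P : Program V} {a b : V} {c : ℕ} (I : ℕ → (V → ℝ) → Prop) {N : ℕ}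
    (hN : ∀ k s, I k s → s a ≤ s b → k < N)
    (hP : ∀ k s, I k s → s a ≤ s b → ∃ t ≤ c, ∃ s', Exec P s s' t ∧ I (k + 1) s')
    {s : V → ℝ} (hs : I 0 s) :
    ∃ t ≤ N * (c + 1) + 1, ∃ s', Exec (.loop a b P) s s' t ∧ ¬ s' a ≤ s' b ∧ ∃ k, I k s' := by
  -- Induction on the number `d` of rounds that may still be executed.
  suffices h : ∀ d k (s : V → ℝ), I k s → N ≤ k + d → ∃ t ≤ d * (c + 1) + 1, ∃ s',
      Exec (.loop a b P) s s' t ∧ ¬ s' a ≤ s' b ∧ ∃ k, I k s' from h N 0 s hs (by omega)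
  intro d
  induction d with
  | zero =>
    intro k s hI hk
    have : ¬ s a ≤ s b := fun h => by have := hN k s hI h; omega
    exact ⟨1, by omega, s, .loop_false this, this, k, hI⟩
  | succ d ih =>
    intro k s hI hk
    by_cases h : s a ≤ s b
    · obtain ⟨t, ht, s', he, hI'⟩ := hP k s hI h
      obtain ⟨t', ht', s'', he', h'⟩ := ih (k + 1) s' hI' (by omega)
      refine ⟨_, ?_, s'', .loop_true h he he', h'⟩
      rw [Nat.succ_mul]; omega
    · exact ⟨1, by omega, s, .loop_false h, h, k, hI⟩

end Compile

/-! ### Computable matrices -/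

section CompMatrix

variable {V : Type} {S : Set V}

theorem Comp.zero : Comp S fun _ => 0 := by simpa using Comp.const (S := S) 0

theorem Comp.one : Comp S fun _ => 1 := by simpa using Comp.const (S := S) 1

theorem Comp.inv {f : (V → ℝ) → ℝ} (hf : Comp S f) : Comp S fun s => (f s)⁻¹ := by
  simpa using Comp.one.div hf

theorem Comp.pow {f : (V → ℝ) → ℝ} (hf : Comp S f) (k : ℕ) : Comp S fun s => f s ^ k := by
  induction k with
  | zero => simpa using Comp.one
  | succ k ih => simpa only [pow_succ] using ih.mul hf

theorem Comp.sum {ι : Type*} (t : Finset ι) {f : ι → (V → ℝ) → ℝ} (hf : ∀ i ∈ t, Comp S (f i)) :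
    Comp S fun s => ∑ i ∈ t, f i s := by
  classical
  induction t using Finset.induction_on with
  | empty => simpa using Comp.zero
  | insert a t ha ih =>
    simp only [Finset.sum_insert ha]
    exact (hf a (by simp)).add (ih fun i hi => hf i (by simp [hi]))

theorem Comp.prod {ι : Type*} (t : Finset ι) {f : ι → (V → ℝ) → ℝ} (hf : ∀ i ∈ t, Comp S (f i)) :
    Comp S fun s => ∏ i ∈ t, f i s := by
  classical
  induction t using Finset.induction_on with
  | empty => simpa using Comp.one
  | insert a t ha ih =>
    simp only [Finset.prod_insert ha]
    exact (hf a (by simp)).mul (ih fun i hi => hf i (by simp [hi]))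

/-- Matrices all of whose entries are computable. -/
def CompMat (S : Set V) {α β : Type*} (f : (V → ℝ) → Matrix α β ℝ) : Prop :=
  ∀ i j, Comp S fun s => f s i j

/-- Vectors all of whose entries are computable. -/
def CompVec (S : Set V) {α : Type*} (f : (V → ℝ) → α → ℝ) : Prop := ∀ i, Comp S fun s => f s i

variable {α β γ : Type*}

theorem CompMat.mul [Fintype β] {f : (V → ℝ) → Matrix α β ℝ} {g : (V → ℝ) → Matrix β γ ℝ}
    (hf : CompMat S f) (hg : CompMat S g) : CompMat S fun s => f s * g s := fun i j => by
  simpa only [Matrix.mul_apply] using Comp.sum _ fun k _ => (hf i k).mul (hg k j)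

theorem CompMat.add {f g : (V → ℝ) → Matrix α β ℝ}
    (hf : CompMat S f) (hg : CompMat S g) : CompMat S fun s => f s + g s :=
  fun i j => (hf i j).add (hg i j)

theorem CompMat.transpose {f : (V → ℝ) → Matrix α β ℝ} (hf : CompMat S f) :
    CompMat S fun s => (f s).transpose := fun i j => hf j i

theorem CompMat.mulVec [Fintype β] {f : (V → ℝ) → Matrix α β ℝ} {g : (V → ℝ) → β → ℝ}
    (hf : CompMat S f) (hg : CompVec S g) : CompVec S fun s => (f s).mulVec (g s) := fun i => by
  simpa only [Matrix.mulVec, dotProduct] using Comp.sum _ fun k _ => (hf i k).mul (hg k)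

theorem CompMat.det [Fintype α] [DecidableEq α] {f : (V → ℝ) → Matrix α α ℝ}
    (hf : CompMat S f) : Comp S fun s => (f s).det := by
  simp only [Matrix.det_apply']
  refine Comp.sum _ fun σ _ => Comp.mul ?_ (Comp.prod _ fun i _ => hf _ _)
  exact_mod_cast Comp.const (S := S) (Equiv.Perm.sign σ : ℤ)

/-- Cramer's rule. It needs no invertibility, since for determinant zero both the matrix inverse and
the machine's division give `0`. -/
theorem CompMat.inv [Fintype α] [DecidableEq α] {f : (V → ℝ) → Matrix α α ℝ}
    (hf : CompMat S f) : CompMat S fun s => (f s)⁻¹ := fun i j => by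
  simp only [Matrix.inv_def, Ring.inverse_eq_inv', Matrix.smul_apply, smul_eq_mul,
    Matrix.adjugate_apply]
  refine hf.det.inv.mul (CompMat.det fun a b => ?_)
  by_cases h : a = j
  · subst h
    by_cases h2 : b = i
    · subst h2; simpa using Comp.one
    · simpa [Pi.single_apply, h2] using Comp.zero
  · simpa [Matrix.updateRow_apply, h] using hf a b

end CompMatrix

/-! ### Gram-Schmidt orthogonalization -/

section GramSchmidt

open InnerProductSpace Submodule
open scoped RealInnerProductSpace

variable {n : ℕ} {E F : Type*} [NormedAddCommGroup E] [InnerProductSpace ℝ E]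
  [NormedAddCommGroup F] [InnerProductSpace ℝ F]

theorem inner_eq_zero_of_mem_span {ι : Type*} {c : ι → E} {s : Set ι} {v w : E}
    (h : ∀ k ∈ s, ⟪v, c k⟫ = 0) (hw : w ∈ span ℝ (c '' s)) : ⟪v, w⟫ = 0 := by
  induction hw using span_induction with
  | mem x hx => obtain ⟨k, hk, rfl⟩ := hx; exact h k hk
  | zero => simp
  | add x y _ _ hx hy => rw [inner_add_right, hx, hy, add_zero]
  | smul a x _ hx => rw [inner_smul_right, hx, mul_zero]

theorem sub_gramSchmidt_mem_span (b : Fin n → E) (i : Fin n) :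
    b i - gramSchmidt ℝ b i ∈ span ℝ (gramSchmidt ℝ b '' Set.Iio i) := by
  rw [sub_eq_iff_eq_add'.2 (gramSchmidt_def'' ℝ b i)]
  exact sum_mem fun k hk => smul_mem _ _ (subset_span ⟨k, Finset.mem_Iio.1 hk, rfl⟩)

/-- The Gram-Schmidt orthogonalization is characterized by orthogonality and triangularity. -/
theorem gramSchmidt_eq {b c : Fin n → E} (horth : ∀ i j, j < i → ⟪c i, c j⟫ = 0)
    (hspan : ∀ i, b i - c i ∈ span ℝ (c '' Set.Iio i)) : gramSchmidt ℝ b = c := by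
  funext i
  induction i using WellFoundedLT.induction with
  | ind i ih =>
    have himg : gramSchmidt ℝ b '' Set.Iio i = c '' Set.Iio i :=
      Set.image_congr fun k hk => ih k hk
    have h1 : gramSchmidt ℝ b i - c i ∈ span ℝ (c '' Set.Iio i) := by
      have := sub_gramSchmidt_mem_span b i
      rw [himg] at this
      simpa using sub_mem (hspan i) this
    have h2 : ⟪gramSchmidt ℝ b i - c i, gramSchmidt ℝ b i - c i⟫ = 0 := by
      refine inner_eq_zero_of_mem_span (fun k hk => ?_) h1
      rw [inner_sub_left, horth i k hk, ← ih k hk, gramSchmidt_orthogonal ℝ b (ne_of_gt hk),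
        sub_zero]
    exact sub_eq_zero.1 (inner_self_eq_zero.1 h2)

/-- Subtracting multiples of a vector from later ones keeps the Gram-Schmidt vectors. -/
theorem gramSchmidt_sub_smul (b : Fin n → E) (j : Fin n) (q : Fin n → ℝ)
    (hq : ∀ i, i ≤ j → q i = 0) :
    gramSchmidt ℝ (fun i => b i - q i • b j) = gramSchmidt ℝ b := by
  refine gramSchmidt_eq (fun i k hk => gramSchmidt_orthogonal ℝ b (ne_of_gt hk)) fun i => ?_
  rw [sub_right_comm]
  refine sub_mem (sub_gramSchmidt_mem_span b i) ?_
  rcases le_or_gt i j with h | h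
  · simp [hq i h]
  · exact smul_mem _ _ (span_mono (Set.image_mono (Set.Iic_subset_Iio.2 h))
      (mem_span_gramSchmidt ℝ b le_rfl))

theorem inner_gramSchmidt_self (b : Fin n → E) (i : Fin n) :
    ⟪b i, gramSchmidt ℝ b i⟫ = ‖gramSchmidt ℝ b i‖ ^ 2 := by
  have h := inner_eq_zero_of_mem_span (v := gramSchmidt ℝ b i)
    (fun k hk => gramSchmidt_orthogonal ℝ b (ne_of_gt hk)) (sub_gramSchmidt_mem_span b i)
  rw [inner_sub_right, sub_eq_zero, real_inner_self_eq_norm_sq] at h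
  rw [real_inner_comm, h]

theorem inner_gramSchmidt_of_lt (b : Fin n → E) {i j : Fin n} (h : i < j) :
    ⟪b i, gramSchmidt ℝ b j⟫ = 0 := by
  rw [real_inner_comm]
  exact gramSchmidt_inv_triangular ℝ b h

theorem norm_gramSchmidt_le (b : Fin n → E) (i : Fin n) : ‖gramSchmidt ℝ b i‖ ≤ ‖b i‖ := by
  have h := real_inner_le_norm (b i) (gramSchmidt ℝ b i)
  rw [inner_gramSchmidt_self, sq] at h
  rcases (norm_nonneg (gramSchmidt ℝ b i)).eq_or_lt with h0 | h0
  · rw [← h0]; exact norm_nonneg _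
  · exact le_of_mul_le_mul_right h h0

/-- A linear map that expands by at least `ε` expands the Gram-Schmidt vectors by at least `ε`. -/
theorem mul_norm_gramSchmidt_le (A : E →ₗ[ℝ] F) {ε : ℝ} (hε : 0 ≤ ε)
    (hA : ∀ v, ε * ‖v‖ ^ 2 ≤ ‖A v‖ ^ 2) (b : Fin n → E) (i : Fin n) :
    ε * ‖gramSchmidt ℝ b i‖ ^ 2 ≤ ‖gramSchmidt ℝ (fun k => A (b k)) i‖ ^ 2 := by
  -- The Gram-Schmidt vector of the image is `A (b i - s)` with `s` in the span of the earlier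
  -- vectors, and `b i - s` is no shorter than the component of `b i` orthogonal to that span.
  have h1 := sub_gramSchmidt_mem_span (fun k => A (b k)) i
  rw [span_gramSchmidt_Iio, ← Function.comp_def, Set.image_comp, ← map_span] at h1
  obtain ⟨s, hs, hs'⟩ := h1
  have h2 : gramSchmidt ℝ (fun k => A (b k)) i = A (b i - s) := by
    rw [map_sub, hs']; simp [Function.comp_def]
  rw [h2]
  refine le_trans ?_ (hA _)
  refine mul_le_mul_of_nonneg_left ?_ hε
  rw [← span_gramSchmidt_Iio] at hs
  have h3 : ⟪gramSchmidt ℝ b i, b i - s⟫ = ‖gramSchmidt ℝ b i‖ ^ 2 := by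
    rw [inner_sub_right, real_inner_comm, inner_gramSchmidt_self,
      inner_eq_zero_of_mem_span (fun k hk => gramSchmidt_orthogonal ℝ b (ne_of_gt hk)) hs, sub_zero]
  have h4 := real_inner_le_norm (gramSchmidt ℝ b i) (b i - s)
  rw [h3, sq] at h4
  refine pow_le_pow_left₀ (norm_nonneg _) ?_ 2
  rcases (norm_nonneg (gramSchmidt ℝ b i)).eq_or_lt with h0 | h0
  · rw [← h0]; exact norm_nonneg _
  · exact le_of_mul_le_mul_left h4 h0

/-- Coefficients of the Gram-Schmidt orthogonalization. -/
def gsMu (b : Fin n → E) (i j : Fin n) : ℝ :=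
  ⟪b i, gramSchmidt ℝ b j⟫ / ‖gramSchmidt ℝ b j‖ ^ 2

theorem gramSchmidt_expansion (b : Fin n → E) (i : Fin n) :
    b i = gramSchmidt ℝ b i + ∑ k ∈ Finset.Iio i, gsMu b i k • gramSchmidt ℝ b k := by
  conv_lhs => rw [gramSchmidt_def'' ℝ b i]
  simp only [gsMu, RCLike.ofReal_real_eq_id, id, real_inner_comm]

/-- The leading Gram matrix factors as `Rᵀ D R` with `R` unitriangular and `D` the diagonal of
squared Gram-Schmidt norms. This is what makes integrality visible in the potential. -/
theorem prod_norm_gramSchmidt_eq_det (b : Fin n → E) (hb : LinearIndependent ℝ b) (l : Fin n) :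
    ∏ k ∈ Finset.Iic l, ‖gramSchmidt ℝ b k‖ ^ 2 =
      (Matrix.of fun i j : Finset.Iic l => ⟪b i, b j⟫).det := by
  have hne : ∀ k, ‖gramSchmidt ℝ b k‖ ^ 2 ≠ 0 := fun k => by
    have := gramSchmidt_ne_zero (𝕜 := ℝ) k hb
    positivity
  set R : Matrix (Finset.Iic l) (Finset.Iic l) ℝ := Matrix.of fun k a => gsMu b a k with hR
  have htri : R.IsUpperTriangular := fun i j hij => by
    have : (j : Fin n) < i := hij
    simp [hR, gsMu, inner_gramSchmidt_of_lt b this]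
  have hdet : R.det = 1 := by
    rw [Matrix.det_of_isUpperTriangular htri]
    refine Finset.prod_eq_one fun k _ => ?_
    simp [hR, gsMu, inner_gramSchmidt_self, div_self (hne k)]
  have hexp : ∀ a : Finset.Iic l, b a = ∑ k : Finset.Iic l, R k a • gramSchmidt ℝ b k := by
    intro a
    change b a = ∑ k : Finset.Iic l, gsMu b a k • gramSchmidt ℝ b k
    rw [Finset.sum_coe_sort (Finset.Iic l) fun k => gsMu b a k • gramSchmidt ℝ b k]
    have ha : (a : Fin n) ≤ l := Finset.mem_Iic.1 a.2
    have hsub : Finset.Iic (a : Fin n) ⊆ Finset.Iic l := Finset.Iic_subset_Iic.2 ha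
    rw [← Finset.sum_subset hsub fun k _ hk => ?_, ← Finset.Iio_insert (a : Fin n),
      Finset.sum_insert (by simp), gsMu, inner_gramSchmidt_self, div_self (hne a), one_smul]
    · exact gramSchmidt_expansion b a
    · rw [Finset.mem_Iic, not_le] at hk
      rw [gsMu, inner_gramSchmidt_of_lt b hk, zero_div, zero_smul]
  have hG : (Matrix.of fun i j : Finset.Iic l => ⟪b i, b j⟫) =
      R.transpose * Matrix.diagonal (fun k : Finset.Iic l => ‖gramSchmidt ℝ b k‖ ^ 2) * R := by
    ext i j
    rw [Matrix.of_apply, hexp i, hexp j, Matrix.mul_apply, sum_inner]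
    refine Finset.sum_congr rfl fun k _ => ?_
    rw [inner_sum, Finset.sum_eq_single k]
    · rw [inner_smul_left, inner_smul_right, real_inner_self_eq_norm_sq, Matrix.mul_diagonal,
        Matrix.transpose_apply]
      simp only [conj_trivial]; ring
    · intro k' _ hk'
      rw [inner_smul_left, inner_smul_right,
        gramSchmidt_orthogonal ℝ b (fun h => hk' (Subtype.ext h.symm))]
      simp
    · simp
  rw [hG, Matrix.det_mul, Matrix.det_mul, Matrix.det_transpose, hdet, Matrix.det_diagonal,
    Finset.prod_coe_sort (Finset.Iic l) fun k => ‖gramSchmidt ℝ b k‖ ^ 2]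
  ring

/-- The potential function of the LLL algorithm. -/
def potential (b : Fin n → E) : ℝ := ∏ l, ∏ k ∈ Finset.Iic l, ‖gramSchmidt ℝ b k‖ ^ 2

/-- The potential of a family with integral inner products is at least one. -/
theorem one_le_potential {b : Fin n → E} (hb : LinearIndependent ℝ b)
    (hint : ∀ i j, ∃ z : ℤ, ⟪b i, b j⟫ = z) : 1 ≤ potential b := by
  choose Z hZ using hint
  rw [← Finset.prod_const_one (s := (Finset.univ : Finset (Fin n))), potential]
  refine Finset.prod_le_prod (fun _ _ => zero_le_one) fun l _ => ?_
  have hpos : 0 < ∏ k ∈ Finset.Iic l, ‖gramSchmidt ℝ b k‖ ^ 2 := Finset.prod_pos fun k _ => by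
    have := gramSchmidt_ne_zero (𝕜 := ℝ) k hb
    positivity
  rw [prod_norm_gramSchmidt_eq_det b hb] at hpos ⊢
  have : (Matrix.of fun i j : Finset.Iic l => ⟪b i, b j⟫) =
      (Matrix.of fun i j : Finset.Iic l => Z i j).map (Int.castRingHom ℝ) := by
    ext i j; simp [hZ]
  rw [this, ← RingHom.mapMatrix_apply, ← RingHom.map_det] at hpos ⊢
  simp only [eq_intCast] at hpos ⊢
  exact_mod_cast Int.add_one_le_of_lt (Int.cast_pos.1 hpos)

theorem potential_le {b : Fin n → E} {K : ℝ} (hK : 1 ≤ K) (h : ∀ i, ‖b i‖ ^ 2 ≤ K) :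
    potential b ≤ K ^ (n ^ 2) := by
  have h1 : ∀ l : Fin n, ∏ k ∈ Finset.Iic l, ‖gramSchmidt ℝ b k‖ ^ 2 ≤ K ^ n := fun l => by
    refine (Finset.prod_le_prod (g := fun _ => K) (fun k _ => by positivity)
      fun k _ => ?_).trans ?_
    · exact (pow_le_pow_left₀ (norm_nonneg _) (norm_gramSchmidt_le b k) 2).trans (h k)
    · rw [Finset.prod_const]
      exact pow_le_pow_right₀ hK ((Finset.card_le_univ _).trans_eq (Fintype.card_fin n))
  refine (Finset.prod_le_prod (fun l _ => Finset.prod_nonneg fun k _ => by positivity)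
    fun l _ => h1 l).trans_eq ?_
  rw [Finset.prod_const, Finset.card_univ, Fintype.card_fin, ← pow_mul, sq]

/-- Each of the `n` partial products has at most `n` factors, each of which loses at most a factor
`ε`; as `ε ≤ 1`, the exponent can be rounded up to `n²`. -/
theorem pow_mul_potential_le (A : E →ₗ[ℝ] F) {ε : ℝ} (hε : 0 ≤ ε) (hε1 : ε ≤ 1)
    (hA : ∀ v, ε * ‖v‖ ^ 2 ≤ ‖A v‖ ^ 2) (b : Fin n → E) :
    ε ^ (n ^ 2) * potential b ≤ potential fun k => A (b k) := by
  have h1 : ∀ l : Fin n, ε ^ n * ∏ k ∈ Finset.Iic l, ‖gramSchmidt ℝ b k‖ ^ 2 ≤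
      ∏ k ∈ Finset.Iic l, ‖gramSchmidt ℝ (fun k => A (b k)) k‖ ^ 2 := fun l => by
    have hp : 0 ≤ ∏ k ∈ Finset.Iic l, ‖gramSchmidt ℝ b k‖ ^ 2 :=
      Finset.prod_nonneg fun k _ => by positivity
    calc ε ^ n * ∏ k ∈ Finset.Iic l, ‖gramSchmidt ℝ b k‖ ^ 2
        ≤ ε ^ (Finset.Iic l).card * ∏ k ∈ Finset.Iic l, ‖gramSchmidt ℝ b k‖ ^ 2 :=
          mul_le_mul_of_nonneg_right (pow_le_pow_of_le_one hε hε1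
            ((Finset.card_le_univ _).trans_eq (Fintype.card_fin n))) hp
      _ = ∏ k ∈ Finset.Iic l, ε * ‖gramSchmidt ℝ b k‖ ^ 2 := by
          rw [Finset.prod_mul_distrib, Finset.prod_const]
      _ ≤ _ := Finset.prod_le_prod (fun k _ => by positivity)
          fun k _ => mul_norm_gramSchmidt_le A hε hA b k
  calc ε ^ (n ^ 2) * potential b
      = ∏ l : Fin n, ε ^ n * ∏ k ∈ Finset.Iic l, ‖gramSchmidt ℝ b k‖ ^ 2 := by
        rw [Finset.prod_mul_distrib, Finset.prod_const, Finset.card_univ, Fintype.card_fin,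
          ← pow_mul, sq, potential]
    _ ≤ _ := Finset.prod_le_prod (fun l _ => mul_nonneg (by positivity)
        (Finset.prod_nonneg fun k _ => by positivity)) fun l _ => h1 l

end GramSchmidt

/-! ### Swaps, size reduction and coordinates in reduced bases -/

section Reduction

open InnerProductSpace Submodule
open scoped RealInnerProductSpace

variable {n : ℕ} {E : Type*} [NormedAddCommGroup E] [InnerProductSpace ℝ E]

/-! ### Swapping two consecutive vectors -/

section Swap

variable (b : Fin n → E) (i j : Fin n)

/-- The Gram-Schmidt vectors after the vectors `j` and `i = j + 1` have been swapped. -/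
def swapGS : Fin n → E :=
  Function.update (Function.update (gramSchmidt ℝ b) j
    (gramSchmidt ℝ b i + gsMu b i j • gramSchmidt ℝ b j)) i
    (gramSchmidt ℝ b j - (gsMu b i j * ‖gramSchmidt ℝ b j‖ ^ 2 /
      ‖gramSchmidt ℝ b i + gsMu b i j • gramSchmidt ℝ b j‖ ^ 2) •
        (gramSchmidt ℝ b i + gsMu b i j • gramSchmidt ℝ b j))

variable {b i j}

theorem swapGS_left (h : j < i) :
    swapGS b i j j = gramSchmidt ℝ b i + gsMu b i j • gramSchmidt ℝ b j := by
  rw [swapGS, Function.update_of_ne (ne_of_lt h), Function.update_self]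

theorem swapGS_right (h : j < i) :
    swapGS b i j i = gramSchmidt ℝ b j - (gsMu b i j * ‖gramSchmidt ℝ b j‖ ^ 2 /
      ‖swapGS b i j j‖ ^ 2) • swapGS b i j j := by
  rw [swapGS_left h, swapGS, Function.update_self]

theorem swapGS_of_ne {k : Fin n} (hi : k ≠ i) (hj : k ≠ j) :
    swapGS b i j k = gramSchmidt ℝ b k := by
  rw [swapGS, Function.update_of_ne hi, Function.update_of_ne hj]

theorem norm_swapGS_left (h : j < i) : ‖swapGS b i j j‖ ^ 2 =
    ‖gramSchmidt ℝ b i‖ ^ 2 + gsMu b i j ^ 2 * ‖gramSchmidt ℝ b j‖ ^ 2 := by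
  rw [swapGS_left h, ← real_inner_self_eq_norm_sq, inner_add_left, inner_add_right, inner_add_right,
    inner_smul_left, inner_smul_right, inner_smul_left, inner_smul_right,
    gramSchmidt_orthogonal ℝ b (ne_of_gt h), gramSchmidt_orthogonal ℝ b (ne_of_lt h),
    real_inner_self_eq_norm_sq, real_inner_self_eq_norm_sq]
  simp only [conj_trivial]; ring

theorem inner_swapGS_left (h : j < i) : ⟪gramSchmidt ℝ b j, swapGS b i j j⟫ =
    gsMu b i j * ‖gramSchmidt ℝ b j‖ ^ 2 := by
  rw [swapGS_left h, inner_add_right, inner_smul_right,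
    gramSchmidt_orthogonal ℝ b (ne_of_lt h), real_inner_self_eq_norm_sq, zero_add]

theorem inner_swapGS (h : j < i) : ⟪swapGS b i j i, swapGS b i j j⟫ = 0 := by
  rw [swapGS_right h, inner_sub_left, inner_smul_left, inner_swapGS_left h,
    real_inner_self_eq_norm_sq]
  -- If the new `j`-th vector vanishes, the coefficient is a division by zero, but then the
  -- numerator vanishes as well.
  rcases eq_or_ne (‖swapGS b i j j‖ ^ 2) 0 with h0 | h0
  · have h1 : swapGS b i j j = 0 := by simpa using h0
    have := inner_swapGS_left (b := b) h
    rw [h1, inner_zero_right] at this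
    simp [← this]
  · rw [conj_trivial, div_mul_cancel₀ _ h0, sub_self]

/-- The area of the parallelogram spanned by the two projected vectors does not depend on their
order. Hence a swap changes only the `j`-th partial product in the potential. -/
theorem norm_swapGS_mul (h : j < i) (h0 : swapGS b i j j ≠ 0) :
    ‖swapGS b i j j‖ ^ 2 * ‖swapGS b i j i‖ ^ 2 =
      ‖gramSchmidt ℝ b j‖ ^ 2 * ‖gramSchmidt ℝ b i‖ ^ 2 := by
  have hu : ‖swapGS b i j j‖ ^ 2 ≠ 0 := by positivity
  have h1 : ‖swapGS b i j i‖ ^ 2 = ‖gramSchmidt ℝ b j‖ ^ 2 -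
      (gsMu b i j * ‖gramSchmidt ℝ b j‖ ^ 2) ^ 2 / ‖swapGS b i j j‖ ^ 2 := by
    rw [← real_inner_self_eq_norm_sq (swapGS b i j i)]
    nth_rewrite 2 [swapGS_right h]
    rw [inner_sub_right, inner_smul_right, inner_swapGS h, swapGS_right h, inner_sub_left,
      inner_smul_left, real_inner_comm (gramSchmidt ℝ b j) (swapGS b i j j), inner_swapGS_left h,
      real_inner_self_eq_norm_sq]
    simp only [conj_trivial]; field_simp; ring
  have h2 := norm_swapGS_left (b := b) h
  rw [h1, mul_sub, mul_div_cancel₀ _ hu, h2]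
  ring

/-- The candidate vectors are checked against the characterization `gramSchmidt_eq`: the two new
vectors are orthogonal to each other, and span the same plane as the old ones, so nothing changes at
the other indices. -/
theorem gramSchmidt_swap (hij : (j : ℕ) + 1 = i) :
    gramSchmidt ℝ (fun k => b (Equiv.swap j i k)) = swapGS b i j := by
  have h : j < i := Fin.lt_def.2 (by omega)
  have hperp : ∀ k, k ≠ i → k ≠ j → ∀ a ∈ ({i, j} : Set (Fin n)),
      ⟪gramSchmidt ℝ b k, swapGS b i j a⟫ = 0 := by
    intro k hki hkj
    have e : ⟪gramSchmidt ℝ b k, swapGS b i j j⟫ = 0 := by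
      rw [swapGS_left h, inner_add_right, inner_smul_right, gramSchmidt_orthogonal ℝ b hki,
        gramSchmidt_orthogonal ℝ b hkj, mul_zero, add_zero]
    rintro a (rfl | rfl)
    · rw [swapGS_right h, inner_sub_right, inner_smul_right, e, gramSchmidt_orthogonal ℝ b hkj,
        mul_zero, sub_zero]
    · exact e
  have horth : ∀ k l, l < k → ⟪swapGS b i j k, swapGS b i j l⟫ = 0 := by
    intro k l hlk
    by_cases hk : k ∈ ({i, j} : Set (Fin n))
    · by_cases hl : l ∈ ({i, j} : Set (Fin n))
      · have hk' : k = i := by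
          rcases hk with rfl | rfl
          · rfl
          · rcases hl with rfl | rfl
            · exact absurd hlk (not_lt.2 h.le)
            · exact absurd hlk (lt_irrefl _)
        have hl' : l = j := by
          rcases hl with rfl | rfl
          · exact absurd hlk (by simp [hk'])
          · rfl
        rw [hk', hl', inner_swapGS h]
      · simp only [Set.mem_insert_iff, Set.mem_singleton_iff, not_or] at hl
        rw [swapGS_of_ne hl.1 hl.2, real_inner_comm, hperp l hl.1 hl.2 k hk]
    · simp only [Set.mem_insert_iff, Set.mem_singleton_iff, not_or] at hk
      rw [swapGS_of_ne hk.1 hk.2]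
      by_cases hl : l ∈ ({i, j} : Set (Fin n))
      · exact hperp k hk.1 hk.2 l hl
      · simp only [Set.mem_insert_iff, Set.mem_singleton_iff, not_or] at hl
        rw [swapGS_of_ne hl.1 hl.2, gramSchmidt_orthogonal ℝ b (ne_of_gt hlk)]
  have himg : ∀ l, l ≤ j → swapGS b i j '' Set.Iio l = gramSchmidt ℝ b '' Set.Iio l := by
    refine fun l hl => Set.image_congr fun k hk => swapGS_of_ne ?_ ?_
    · exact ne_of_lt ((lt_of_lt_of_le hk hl).trans h)
    · exact ne_of_lt (lt_of_lt_of_le hk hl)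
  refine gramSchmidt_eq horth fun l => ?_
  rcases lt_trichotomy l j with hl | rfl | hl
  · rw [himg l hl.le, Equiv.swap_apply_of_ne_of_ne (ne_of_lt hl) (ne_of_lt (hl.trans h)),
      swapGS_of_ne (ne_of_lt (hl.trans h)) (ne_of_lt hl)]
    exact sub_gramSchmidt_mem_span b l
  · rw [himg l le_rfl, Equiv.swap_apply_left, swapGS_left h]
    have hIio : Finset.Iio i = insert l (Finset.Iio l) := by
      ext k; simp only [Finset.mem_Iio, Finset.mem_insert, Fin.lt_def, Fin.ext_iff]; omega
    have := gramSchmidt_expansion b i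
    rw [hIio, Finset.sum_insert (by simp), ← add_assoc] at this
    rw [sub_eq_iff_eq_add'.2 this]
    exact sum_mem fun k hk => smul_mem _ _ (subset_span ⟨k, Finset.mem_Iio.1 hk, rfl⟩)
  · rcases (show i ≤ l by rw [Fin.le_def]; rw [Fin.lt_def] at hl; omega).eq_or_lt with rfl | hil
    · rw [Equiv.swap_apply_right, swapGS_right h, ← sub_add]
      refine add_mem ?_ (smul_mem _ _ (subset_span ⟨j, h, rfl⟩))
      have h1 := sub_gramSchmidt_mem_span b j
      rw [← himg j le_rfl] at h1
      exact span_mono (Set.image_mono (Set.Iio_subset_Iio h.le)) h1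
    · rw [Equiv.swap_apply_of_ne_of_ne (ne_of_gt hl) (ne_of_gt hil),
        swapGS_of_ne (ne_of_gt hil) (ne_of_gt hl)]
      refine (span_le.2 ?_ : span ℝ (gramSchmidt ℝ b '' Set.Iio l) ≤ _)
        (sub_gramSchmidt_mem_span b l)
      have hj : gramSchmidt ℝ b j ∈ span ℝ (swapGS b i j '' Set.Iio l) := by
        rw [sub_eq_iff_eq_add.1 (swapGS_right (b := b) h).symm]
        exact add_mem (subset_span ⟨i, hil, rfl⟩) (smul_mem _ _ (subset_span ⟨j, hl, rfl⟩))
      rintro _ ⟨k, hk, rfl⟩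
      by_cases hkj : k = j
      · rwa [hkj]
      by_cases hki : k = i
      · rw [hki, ← sub_eq_iff_eq_add.2 (swapGS_left (b := b) h)]
        exact sub_mem (subset_span ⟨j, hl, rfl⟩) (smul_mem _ _ hj)
      · exact subset_span ⟨k, hk, swapGS_of_ne hki hkj⟩

/-- Swapping two vectors that violate the Lovász condition decreases the potential. -/
theorem potential_swap_le (hb : LinearIndependent ℝ b) (hij : (j : ℕ) + 1 = i)
    (hviol : ‖gramSchmidt ℝ b i‖ ^ 2 < (3 / 4 - gsMu b i j ^ 2) * ‖gramSchmidt ℝ b j‖ ^ 2) :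
    potential (fun k => b (Equiv.swap j i k)) ≤ 3 / 4 * potential b := by
  have h : j < i := Fin.lt_def.2 (by omega)
  have hl' : LinearIndependent ℝ (fun k => b (Equiv.swap j i k)) :=
    hb.comp _ (Equiv.swap j i).injective
  have hu : swapGS b i j j ≠ 0 := by
    rw [← gramSchmidt_swap hij]; exact gramSchmidt_ne_zero (𝕜 := ℝ) j hl'
  have hlt : ∀ l < j, ∏ k ∈ Finset.Iic l, ‖swapGS b i j k‖ ^ 2 =
      ∏ k ∈ Finset.Iic l, ‖gramSchmidt ℝ b k‖ ^ 2 := fun l hl =>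
    Finset.prod_congr rfl fun k hk => by
      have := (Finset.mem_Iic.1 hk).trans_lt hl
      rw [swapGS_of_ne (ne_of_lt (this.trans h)) (ne_of_lt this)]
  have hgt : ∀ l, i ≤ l → ∏ k ∈ Finset.Iic l, ‖swapGS b i j k‖ ^ 2 =
      ∏ k ∈ Finset.Iic l, ‖gramSchmidt ℝ b k‖ ^ 2 := fun l hl => by
    have h1 : j ∈ Finset.Iic l := Finset.mem_Iic.2 (h.le.trans hl)
    have h2 : i ∈ (Finset.Iic l).erase j := Finset.mem_erase.2 ⟨ne_of_gt h, Finset.mem_Iic.2 hl⟩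
    rw [← Finset.mul_prod_erase _ _ h1, ← Finset.mul_prod_erase _ _ h2,
      ← Finset.mul_prod_erase _ (fun k => ‖gramSchmidt ℝ b k‖ ^ 2) h1,
      ← Finset.mul_prod_erase _ (fun k => ‖gramSchmidt ℝ b k‖ ^ 2) h2, ← mul_assoc, ← mul_assoc,
      norm_swapGS_mul h hu]
    congr 1
    refine Finset.prod_congr rfl fun k hk => ?_
    rw [Finset.mem_erase, Finset.mem_erase] at hk
    rw [swapGS_of_ne hk.1 hk.2.1]
  have hnn : ∀ s : Finset (Fin n), 0 ≤ ∏ k ∈ s, ‖gramSchmidt ℝ b k‖ ^ 2 :=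
    fun s => Finset.prod_nonneg fun k _ => by positivity
  -- The only partial product that changes: `‖c j‖²` becomes `‖c i‖² + μ² ‖c j‖²`, which the
  -- violated condition bounds by `3/4 ‖c j‖²`.
  have hj : ∏ k ∈ Finset.Iic j, ‖swapGS b i j k‖ ^ 2 ≤
      3 / 4 * ∏ k ∈ Finset.Iic j, ‖gramSchmidt ℝ b k‖ ^ 2 := by
    rw [← Finset.Iio_insert, Finset.prod_insert (by simp), Finset.prod_insert (by simp), ← mul_assoc]
    have : ∏ k ∈ Finset.Iio j, ‖swapGS b i j k‖ ^ 2 =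
        ∏ k ∈ Finset.Iio j, ‖gramSchmidt ℝ b k‖ ^ 2 := Finset.prod_congr rfl fun k hk => by
      have := Finset.mem_Iio.1 hk
      rw [swapGS_of_ne (ne_of_lt (this.trans h)) (ne_of_lt this)]
    rw [this]
    refine mul_le_mul_of_nonneg_right ?_ (hnn _)
    rw [norm_swapGS_left h]
    linarith
  rw [potential, potential, gramSchmidt_swap hij, ← Finset.mul_prod_erase _ _ (Finset.mem_univ j),
    ← Finset.mul_prod_erase Finset.univ (fun l => ∏ k ∈ Finset.Iic l, ‖gramSchmidt ℝ b k‖ ^ 2)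
      (Finset.mem_univ j), ← mul_assoc]
  have hrest : ∏ l ∈ Finset.univ.erase j, ∏ k ∈ Finset.Iic l, ‖swapGS b i j k‖ ^ 2 =
      ∏ l ∈ Finset.univ.erase j, ∏ k ∈ Finset.Iic l, ‖gramSchmidt ℝ b k‖ ^ 2 := by
    refine Finset.prod_congr rfl fun l hl => ?_
    rcases lt_or_gt_of_ne (Finset.mem_erase.1 hl).1 with h1 | h1
    · exact hlt l h1
    · exact hgt l (by rw [Fin.le_def]; rw [Fin.lt_def] at h1; omega)
  rw [hrest]
  exact mul_le_mul_of_nonneg_right hj (Finset.prod_nonneg fun l _ => hnn _)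

end Swap

/-! ### Size reduction -/

/-- Reduce the coefficients with respect to the `j`-th Gram-Schmidt vector. -/
def sizeStep (j : Fin n) (b : Fin n → E) : Fin n → E := fun i =>
  b i - (if j < i then ((round (gsMu b i j) : ℤ) : ℝ) else 0) • b j

theorem gramSchmidt_sizeStep (j : Fin n) (b : Fin n → E) :
    gramSchmidt ℝ (sizeStep j b) = gramSchmidt ℝ b :=
  gramSchmidt_sub_smul b j _ fun _ hi => if_neg (not_lt.2 hi)

theorem gsMu_sizeStep (j : Fin n) (b : Fin n → E) (i k : Fin n) :
    gsMu (sizeStep j b) i k =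
      gsMu b i k - (if j < i then ((round (gsMu b i j) : ℤ) : ℝ) else 0) * gsMu b j k := by
  rw [gsMu, gramSchmidt_sizeStep, sizeStep, inner_sub_left, inner_smul_left, sub_div,
    mul_div_assoc, conj_trivial, ← gsMu, ← gsMu]

theorem gsMu_of_lt (b : Fin n → E) {i j : Fin n} (h : i < j) : gsMu b i j = 0 := by
  rw [gsMu, inner_gramSchmidt_of_lt b h, zero_div]

theorem gsMu_self {b : Fin n → E} (hb : LinearIndependent ℝ b) (i : Fin n) : gsMu b i i = 1 := by
  have := gramSchmidt_ne_zero (𝕜 := ℝ) i hb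
  rw [gsMu, inner_gramSchmidt_self, div_self (by positivity)]

/-- Size reduction with respect to the indices in a list. -/
def sizeReduce (l : List (Fin n)) (b : Fin n → E) : Fin n → E := l.foldl (fun b j => sizeStep j b) b

theorem gramSchmidt_sizeReduce (l : List (Fin n)) (b : Fin n → E) :
    gramSchmidt ℝ (sizeReduce l b) = gramSchmidt ℝ b := by
  induction l generalizing b with
  | nil => rfl
  | cons j l ih =>
    rw [sizeReduce, List.foldl_cons, ← sizeReduce, ih, gramSchmidt_sizeStep]

theorem potential_sizeReduce (l : List (Fin n)) (b : Fin n → E) :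
    potential (sizeReduce l b) = potential b := by
  rw [potential, gramSchmidt_sizeReduce, potential]

/-- The indices must be treated in decreasing order. Subtracting multiples of `b j` affects only
coefficients with respect to Gram-Schmidt vectors of index at most `j`, so those already reduced
stay reduced; this is the first claim. -/
theorem gsMu_sizeReduce {l : List (Fin n)} (hl : l.Pairwise (· > ·)) {b : Fin n → E}
    (hb : ∀ i, gramSchmidt ℝ b i ≠ 0) :
    (∀ i k, (∀ j ∈ l, j < k) → gsMu (sizeReduce l b) i k = gsMu b i k) ∧
    ∀ i, ∀ k ∈ l, k < i → |gsMu (sizeReduce l b) i k| ≤ 1 / 2 := by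
  induction l generalizing b with
  | nil => exact ⟨fun _ _ _ => rfl, by simp⟩
  | cons j l ih =>
    rw [List.pairwise_cons] at hl
    obtain ⟨h1, h2⟩ := ih hl.2 (b := sizeStep j b) (by rwa [gramSchmidt_sizeStep])
    have hcons : sizeReduce (j :: l) b = sizeReduce l (sizeStep j b) := rfl
    rw [hcons]
    refine ⟨fun i k hk => ?_, fun i k hk hki => ?_⟩
    · rw [h1 i k fun a ha => hk a (by simp [ha]), gsMu_sizeStep, gsMu_of_lt b (hk j (by simp)),
        mul_zero, sub_zero]
    · rcases List.mem_cons.1 hk with rfl | hk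
      · rw [h1 i k hl.1, gsMu_sizeStep, if_pos hki]
        have : gsMu b k k = 1 := by
          have := hb k
          rw [gsMu, inner_gramSchmidt_self, div_self (by positivity)]
        rw [this, mul_one]
        exact abs_sub_round _
      · exact h2 i k hk hki

/-! ### Coordinates in a reduced basis -/

/-- Back substitution. In a reduced basis the Gram-Schmidt norms decay at most geometrically, so
every normalized inner product of the vector with a Gram-Schmidt vector is at most `δ`. Solving for
the coordinates from the last one backwards at most doubles the bound each time. Each of the two
effects costs a factor `2 ^ n`. -/
theorem abs_coord_le_of_reduced {b : Fin n → E} (hb : LinearIndependent ℝ b)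
    (hsize : ∀ i j, j < i → |gsMu b i j| ≤ 1 / 2)
    (hlov : ∀ i j : Fin n, (j : ℕ) + 1 = i →
      (3 / 4 - gsMu b i j ^ 2) * ‖gramSchmidt ℝ b j‖ ^ 2 ≤ ‖gramSchmidt ℝ b i‖ ^ 2)
    (hn : 0 < n) (v : Fin n → ℝ) (j : Fin n) :
    |v j| * ‖b ⟨0, hn⟩‖ ≤ 4 ^ n * ‖∑ i, v i • b i‖ := by
  set e := ∑ i, v i • b i with he
  set c := gramSchmidt ℝ b with hc
  have hc0 : ∀ k, 0 < ‖c k‖ := fun k => norm_pos_iff.2 (gramSchmidt_ne_zero (𝕜 := ℝ) k hb)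
  have hb0 : b ⟨0, hn⟩ = c ⟨0, hn⟩ := by
    rw [gramSchmidt_expansion b ⟨0, hn⟩, Finset.sum_eq_zero, add_zero]
    intro k hk
    exact absurd (Finset.mem_Iio.1 hk) (by simp [Fin.lt_def])
  -- The conditions give `‖c k‖² ≤ 2 ‖c (k+1)‖²`; the cruder factor `2` for the norms avoids square
  -- roots.
  have hgs : ∀ k : Fin n, ‖c ⟨0, hn⟩‖ ≤ 2 ^ (k : ℕ) * ‖c k‖ := by
    rintro ⟨k, hk⟩
    induction k with
    | zero => simp
    | succ k ih =>
      refine (ih (by omega)).trans ?_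
      have h1 := hlov ⟨k + 1, hk⟩ ⟨k, by omega⟩ rfl
      have h2 : gsMu b ⟨k + 1, hk⟩ ⟨k, by omega⟩ ^ 2 ≤ 1 / 4 := by
        have := hsize ⟨k + 1, hk⟩ ⟨k, by omega⟩ (by simp [Fin.lt_def])
        rw [← sq_abs]
        nlinarith [abs_nonneg (gsMu b ⟨k + 1, hk⟩ ⟨k, by omega⟩)]
      have h3 : ‖c ⟨k, by omega⟩‖ ≤ 2 * ‖c ⟨k + 1, hk⟩‖ := by
        refine le_of_sq_le_sq ?_ (by positivity)
        nlinarith [sq_nonneg ‖c ⟨k, by omega⟩‖]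
      calc (2 : ℝ) ^ k * ‖c ⟨k, by omega⟩‖ ≤ 2 ^ k * (2 * ‖c ⟨k + 1, hk⟩‖) := by gcongr
        _ = _ := by simp only [pow_succ]; ring
  set δ : ℝ := 2 ^ n * ‖e‖ / ‖c ⟨0, hn⟩‖ with hδ
  have hδ0 : 0 ≤ δ := by positivity
  have hinner : ∀ k, ‖e‖ / ‖c k‖ ≤ δ := fun k => by
    rw [hδ, div_le_div_iff₀ (hc0 k) (hc0 _)]
    calc ‖e‖ * ‖c ⟨0, hn⟩‖ ≤ ‖e‖ * (2 ^ (k : ℕ) * ‖c k‖) := by gcongr; exact hgs k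
      _ ≤ ‖e‖ * (2 ^ n * ‖c k‖) := by
          gcongr
          · norm_num
          · exact k.2.le
      _ = _ := by ring
  have hrec : ∀ k, |v k| ≤ δ + ∑ i ∈ Finset.Ioi k, |v i| := by
    intro k
    have h1 : ⟪e, c k⟫ / ‖c k‖ ^ 2 = v k + ∑ i ∈ Finset.Ioi k, v i * gsMu b i k := by
      rw [he, sum_inner, Finset.sum_div]
      have : ∀ i, ⟪v i • b i, c k⟫ / ‖c k‖ ^ 2 = v i * gsMu b i k := fun i => by
        rw [inner_smul_left, gsMu, mul_div_assoc, conj_trivial]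
      simp only [this]
      rw [← Finset.sum_subset (Finset.subset_univ (Finset.Ici k)), ← Finset.Ioi_insert,
        Finset.sum_insert (by simp), gsMu_self hb, mul_one]
      intro i _ hi
      rw [gsMu_of_lt b (by simpa using hi), mul_zero]
    have h2 : |⟪e, c k⟫ / ‖c k‖ ^ 2| ≤ δ := by
      refine le_trans ?_ (hinner k)
      rw [abs_div, abs_of_nonneg (by positivity : 0 ≤ ‖c k‖ ^ 2), div_le_div_iff₀
        (pow_pos (hc0 k) 2) (hc0 k)]
      have := abs_real_inner_le_norm e (c k)
      nlinarith [hc0 k]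
    have h3 : |∑ i ∈ Finset.Ioi k, v i * gsMu b i k| ≤ ∑ i ∈ Finset.Ioi k, |v i| := by
      refine (Finset.abs_sum_le_sum_abs _ _).trans (Finset.sum_le_sum fun i hi => ?_)
      rw [abs_mul]
      have := hsize i k (Finset.mem_Ioi.1 hi)
      nlinarith [abs_nonneg (v i)]
    rw [eq_sub_of_add_eq h1.symm]
    exact (abs_sub _ _).trans (add_le_add h2 h3)
  -- The sum of the last `t` coordinates in absolute value; `hrec` doubles it and adds `δ` at each
  -- step.
  have hsum : ∀ t ≤ n, ∑ i ∈ Finset.univ.filter (fun i : Fin n => n ≤ (i : ℕ) + t), |v i| ≤ δ * (2 ^ t - 1) := by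
    intro t ht
    induction t with
    | zero =>
      rw [Finset.sum_eq_zero]
      · simp
      · intro i hi
        have := (Finset.mem_filter.1 hi).2
        have := i.2
        omega
    | succ t ih =>
      have hk : n - (t + 1) < n := by omega
      have h1 : (Finset.univ.filter fun i : Fin n => n ≤ (i : ℕ) + t) = Finset.Ioi ⟨n - (t + 1), hk⟩ := by
        ext i
        simp only [Finset.mem_filter, Finset.mem_univ, true_and, Finset.mem_Ioi, Fin.lt_def]
        omega
      have h2 : (Finset.univ.filter fun i : Fin n => n ≤ (i : ℕ) + (t + 1)) =
          insert ⟨n - (t + 1), hk⟩ (Finset.Ioi ⟨n - (t + 1), hk⟩) := by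
        ext i
        simp only [Finset.mem_filter, Finset.mem_univ, true_and, Finset.mem_Ioi, Fin.lt_def,
          Finset.mem_insert, Fin.ext_iff]
        omega
      rw [h2, Finset.sum_insert (by simp)]
      have h3 := ih (by omega)
      rw [h1] at h3
      have h4 := hrec ⟨n - (t + 1), hk⟩
      rw [pow_succ]
      linarith
  have hfin : |v j| ≤ δ * 2 ^ n := by
    have h1 := hsum n le_rfl
    have h2 : |v j| ≤ ∑ i ∈ Finset.univ.filter (fun i : Fin n => n ≤ (i : ℕ) + n), |v i| :=
      Finset.single_le_sum (f := fun i => |v i|) (fun i _ => abs_nonneg _) (by simp)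
    nlinarith
  rw [hb0]
  calc |v j| * ‖c ⟨0, hn⟩‖ ≤ δ * 2 ^ n * ‖c ⟨0, hn⟩‖ := by gcongr
    _ = 2 ^ n * 2 ^ n * ‖e‖ := by rw [hδ]; field_simp [(hc0 ⟨0, hn⟩).ne']
    _ = 4 ^ n * ‖e‖ := by rw [← mul_pow]; norm_num

end Reduction

section LLL

open InnerProductSpace
open scoped RealInnerProductSpace

variable {n : ℕ}

/-! ### The LLL algorithm on Gram matrices -/

/-- The inner product of the `i`-th vector with the `j`-th Gram-Schmidt vector, computed from the
Gram matrix. -/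
def ldl (A : Matrix (Fin n) (Fin n) ℝ) (j i : Fin n) : ℝ :=
  A i j - ∑ k : Finset.Iio j, ldl A k j / ldl A k k * ldl A k i
termination_by j
decreasing_by all_goals exact Fin.lt_def.1 (Finset.mem_Iio.1 k.2)

theorem ldl_eq (A : Matrix (Fin n) (Fin n) ℝ) (j i : Fin n) :
    ldl A j i = A i j - ∑ k ∈ Finset.Iio j, ldl A k j / ldl A k k * ldl A k i := by
  rw [ldl, Finset.sum_coe_sort (Finset.Iio j) fun k => ldl A k j / ldl A k k * ldl A k i]

/-- The recursion is the Gram-Schmidt expansion of `b j` paired with `b i`. It uses field operations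
on inner products only, so the machine can carry it out without knowing the vectors. -/
theorem ldl_gram {E : Type*} [NormedAddCommGroup E] [InnerProductSpace ℝ E] (b : Fin n → E)
    {A : Matrix (Fin n) (Fin n) ℝ} (hA : ∀ i j, A i j = ⟪b i, b j⟫) (j i : Fin n) :
    ldl A j i = ⟪b i, gramSchmidt ℝ b j⟫ := by
  induction j using WellFoundedLT.induction generalizing i with
  | ind j ih =>
    rw [ldl_eq, hA, eq_sub_of_add_eq (gramSchmidt_expansion b j).symm, inner_sub_right, inner_sum]
    congr 1
    refine Finset.sum_congr rfl fun k hk => ?_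
    have hk := Finset.mem_Iio.1 hk
    rw [ih k hk, ih k hk, ih k hk, inner_smul_right, gsMu, inner_gramSchmidt_self]

theorem Comp.ldl {V : Type} {S : Set V} {A : (V → ℝ) → Matrix (Fin n) (Fin n) ℝ}
    (hA : CompMat S A) (j i : Fin n) : Comp S fun s => ldl (A s) j i := by
  induction j using WellFoundedLT.induction generalizing i with
  | ind j ih =>
    simp only [ldl_eq _ j]
    refine (hA i j).sub (Comp.sum _ fun k hk => ?_)
    have hk := Finset.mem_Iio.1 hk
    exact ((ih k hk j).div (ih k hk k)).mul (ih k hk i)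

theorem gram_columns (M : Matrix (Fin n) (Fin n) ℝ) (i j : Fin n) :
    (M.transpose * M) i j = ⟪column M i, column M j⟫ := by
  simp [column, Matrix.mul_apply, PiLp.inner_apply, mul_comm]

/-- One column of a size reduction, for the basis with coordinates `U` in a basis with Gram
matrix `A`. -/
def matStep (A : Matrix (Fin n) (Fin n) ℝ) (j : Fin n) (U : Matrix (Fin n) (Fin n) ℝ) :
    Matrix (Fin n) (Fin n) ℝ := fun r i =>
  U r i - (if j < i then ((round (ldl (U.transpose * A * U) j i /
    ldl (U.transpose * A * U) j j) : ℤ) : ℝ) else 0) * U r j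

/-- Size reduction. -/
def matReduce (A : Matrix (Fin n) (Fin n) ℝ) (U : Matrix (Fin n) (Fin n) ℝ) :
    Matrix (Fin n) (Fin n) ℝ := (List.finRange n).reverse.foldl (fun U j => matStep A j U) U

/-- The Lovász condition for the vectors `i = p.1` and `j = p.2`. -/
def Lovasz (A U : Matrix (Fin n) (Fin n) ℝ) (p : Fin n × Fin n) : Prop :=
  (3 / 4 - (ldl (U.transpose * A * U) p.2 p.1 / ldl (U.transpose * A * U) p.2 p.2) ^ 2) *
    ldl (U.transpose * A * U) p.2 p.2 ≤ ldl (U.transpose * A * U) p.1 p.1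

open Classical in
/-- Swap the first pair of vectors in the list that violates the Lovász condition. -/
def swapFirst (A U : Matrix (Fin n) (Fin n) ℝ) :
    List (Fin n × Fin n) → Matrix (Fin n) (Fin n) ℝ
  | [] => U
  | p :: l => if Lovasz A U p then swapFirst A U l else U.submatrix id (Equiv.swap p.2 p.1)

/-- The pairs of consecutive indices. -/
def consecutive (n : ℕ) : Finset (Fin n × Fin n) :=
  Finset.univ.filter fun p => (p.2 : ℕ) + 1 = p.1

/-- One round of the LLL algorithm. -/
def lllRound (A U : Matrix (Fin n) (Fin n) ℝ) : Matrix (Fin n) (Fin n) ℝ :=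
  matReduce A (swapFirst A U (consecutive n).toList)

open Classical in
/-- The number of violations of the Lovász condition. -/
def violations (A U : Matrix (Fin n) (Fin n) ℝ) : ℝ :=
  ∑ p ∈ consecutive n, if Lovasz A U p then 0 else 1

section Computable

variable {V : Type} {S : Set V} {A U : (V → ℝ) → Matrix (Fin n) (Fin n) ℝ}

theorem CompMat.matStep (hA : CompMat S A) (hU : CompMat S U) (j : Fin n) :
    CompMat S fun s => matStep (A s) j (U s) := by
  intro r i
  have hG := (hU.transpose.mul hA).mul hU
  refine (hU r i).sub (Comp.mul ?_ (hU r j))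
  by_cases h : j < i
  · simpa only [if_pos h] using ((Comp.ldl hG j i).div (Comp.ldl hG j j)).rnd
  · simpa only [if_neg h] using Comp.zero

theorem CompMat.matReduce (hA : CompMat S A) (hU : CompMat S U) :
    CompMat S fun s => matReduce (A s) (U s) := by
  have : ∀ (l : List (Fin n)) (U : (V → ℝ) → Matrix (Fin n) (Fin n) ℝ), CompMat S U →
      CompMat S fun s => l.foldl (fun U j => LatticeDMT.matStep (A s) j U) (U s) := by
    intro l
    induction l with
    | nil => exact fun U hU => hU
    | cons j l ih => exact fun U hU => ih _ (hA.matStep hU j)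
  exact this _ U hU

open Classical in
theorem CompMat.ite_lovasz (hA : CompMat S A) (hU : CompMat S U) (p : Fin n × Fin n)
    {f g : (V → ℝ) → ℝ} (hf : Comp S f) (hg : Comp S g) :
    Comp S fun s => if Lovasz (A s) (U s) p then f s else g s := by
  have hG := (hU.transpose.mul hA).mul hU
  have h34 : Comp S fun _ => (3 / 4 : ℝ) := by
    simpa using (Comp.const (S := S) 3).div (Comp.const 4)
  have := Comp.ite ((h34.sub (((Comp.ldl hG p.2 p.1).div (Comp.ldl hG p.2 p.2)).pow 2)).mul
    (Comp.ldl hG p.2 p.2)) (Comp.ldl hG p.1 p.1) hf hg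
  convert this using 3
  exact Iff.rfl

theorem CompMat.swapFirst (hA : CompMat S A) (hU : CompMat S U) (l : List (Fin n × Fin n)) :
    CompMat S fun s => swapFirst (A s) (U s) l := by
  induction l with
  | nil => exact hU
  | cons p l ih =>
    intro r k
    have := hA.ite_lovasz hU p (ih r k) (hU r (Equiv.swap p.2 p.1 k))
    convert this using 2 with s
    by_cases h : Lovasz (A s) (U s) p <;> simp [LatticeDMT.swapFirst, h]

theorem CompMat.lllRound (hA : CompMat S A) (hU : CompMat S U) :
    CompMat S fun s => lllRound (A s) (U s) := hA.matReduce (hA.swapFirst hU _)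

theorem CompMat.violations (hA : CompMat S A) (hU : CompMat S U) :
    Comp S fun s => violations (A s) (U s) :=
  Comp.sum _ fun p _ => hA.ite_lovasz hU p Comp.zero Comp.one

end Computable

theorem violations_eq_zero {A U : Matrix (Fin n) (Fin n) ℝ} (h : ¬ 1 ≤ violations A U)
    {p : Fin n × Fin n} (hp : p ∈ consecutive n) : Lovasz A U p := by
  classical
  by_contra hL
  refine h (le_trans (by rw [if_neg hL]) (Finset.single_le_sum
    (f := fun p => if Lovasz A U p then (0 : ℝ) else 1) (fun q _ => ?_) hp))
  positivity

theorem exists_swapFirst_eq {A U : Matrix (Fin n) (Fin n) ℝ} {l : List (Fin n × Fin n)}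
    (h : ∃ p ∈ l, ¬ Lovasz A U p) :
    ∃ p ∈ l, ¬ Lovasz A U p ∧ swapFirst A U l = U.submatrix id (Equiv.swap p.2 p.1) := by
  induction l with
  | nil => simp at h
  | cons q l ih =>
    by_cases hq : Lovasz A U q
    · obtain ⟨p, hp, hL⟩ := h
      rcases List.mem_cons.1 hp with rfl | hp
      · exact absurd hq hL
      obtain ⟨p', hp', hL', he⟩ := ih ⟨p, hp, hL⟩
      exact ⟨p', by simp [hp'], hL', by rw [← he]; exact if_pos hq⟩
    · exact ⟨q, by simp, hq, if_neg hq⟩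

theorem exists_violation {A U : Matrix (Fin n) (Fin n) ℝ} (h : 1 ≤ violations A U) :
    ∃ p ∈ consecutive n, ¬ Lovasz A U p := by
  classical
  by_contra! hL
  rw [violations, Finset.sum_eq_zero fun p hp => if_pos (hL p hp)] at h
  norm_num at h

/-! ### Correctness -/

variable {M : Matrix (Fin n) (Fin n) ℝ}

theorem gram_mul (M U : Matrix (Fin n) (Fin n) ℝ) (i j : Fin n) :
    (U.transpose * (M.transpose * M) * U) i j = ⟪column (M * U) i, column (M * U) j⟫ := by
  rw [← gram_columns, Matrix.transpose_mul, Matrix.mul_assoc, Matrix.mul_assoc, Matrix.mul_assoc]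

theorem ldl_div_eq (M U : Matrix (Fin n) (Fin n) ℝ) (i j : Fin n) :
    ldl (U.transpose * (M.transpose * M) * U) j i / ldl (U.transpose * (M.transpose * M) * U) j j =
      gsMu (column (M * U)) i j := by
  rw [ldl_gram _ (gram_mul M U), ldl_gram _ (gram_mul M U), inner_gramSchmidt_self, gsMu]

theorem ldl_self_eq (M U : Matrix (Fin n) (Fin n) ℝ) (j : Fin n) :
    ldl (U.transpose * (M.transpose * M) * U) j j =
      ‖gramSchmidt ℝ (column (M * U)) j‖ ^ 2 := by
  rw [ldl_gram _ (gram_mul M U), inner_gramSchmidt_self]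

theorem column_matStep (M U : Matrix (Fin n) (Fin n) ℝ) (j : Fin n) :
    column (M * matStep (M.transpose * M) j U) = sizeStep j (column (M * U)) := by
  funext i
  ext r
  simp only [column, sizeStep, Matrix.mul_apply, matStep, ldl_div_eq, PiLp.sub_apply,
    PiLp.smul_apply, smul_eq_mul, mul_sub, Finset.sum_sub_distrib, Finset.mul_sum]
  congr 1
  refine Finset.sum_congr rfl fun k _ => by ring

theorem column_foldl_matStep (M : Matrix (Fin n) (Fin n) ℝ) (l : List (Fin n))
    (U : Matrix (Fin n) (Fin n) ℝ) :
    column (M * l.foldl (fun U j => matStep (M.transpose * M) j U) U) =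
      sizeReduce l (column (M * U)) := by
  induction l generalizing U with
  | nil => rfl
  | cons j l ih => rw [List.foldl_cons, ih, column_matStep]; rfl

/-- Matrices that are images of integral unimodular matrices. -/
def IsUnimodular (U : Matrix (Fin n) (Fin n) ℝ) : Prop :=
  ∃ Z : Matrix (Fin n) (Fin n) ℤ, IsUnit Z.det ∧ U = Z.map (Int.cast : ℤ → ℝ)

theorem IsUnimodular.one : IsUnimodular (1 : Matrix (Fin n) (Fin n) ℝ) :=
  ⟨1, by simp, by rw [Matrix.map_one] <;> simp⟩

theorem IsUnimodular.det_ne_zero {U : Matrix (Fin n) (Fin n) ℝ} (hU : IsUnimodular U) :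
    U.det ≠ 0 := by
  obtain ⟨Z, hZ, rfl⟩ := hU
  have : (Z.map (Int.cast : ℤ → ℝ)).det = ((Z.det : ℤ) : ℝ) := by
    have := RingHom.map_det (Int.castRingHom ℝ) Z
    simpa using this.symm
  rw [this]
  exact_mod_cast hZ.ne_zero

/-- Integer multiples of column `j` are added to other columns, which keeps entries integral and the
determinant unchanged. -/
theorem IsUnimodular.matStep {U : Matrix (Fin n) (Fin n) ℝ} (hU : IsUnimodular U)
    (A : Matrix (Fin n) (Fin n) ℝ) (j : Fin n) : IsUnimodular (matStep A j U) := by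
  obtain ⟨Z, hZ, rfl⟩ := hU
  set U := Z.map (Int.cast : ℤ → ℝ) with hU
  set q : Fin n → ℤ := fun i => if j < i then round (ldl (U.transpose * A * U) j i /
    ldl (U.transpose * A * U) j j) else 0 with hq
  refine ⟨Matrix.of fun r i => Z r i - q i * Z r j, ?_, ?_⟩
  · have : (Matrix.of fun r i => Z r i - q i * Z r j).det = Z.det := by
      rw [← Matrix.det_transpose, ← Matrix.det_transpose Z]
      refine Matrix.det_eq_of_forall_row_eq_smul_add_const (fun i => -q i) j ?_ fun i r => ?_
      · simp [hq]
      · simp only [Matrix.transpose_apply, Matrix.of_apply]; ring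
    rwa [this]
  · ext r i
    simp only [LatticeDMT.matStep, hq, Matrix.map_apply, Matrix.of_apply]
    split_ifs <;> simp [hU]

theorem IsUnimodular.matReduce {U : Matrix (Fin n) (Fin n) ℝ} (hU : IsUnimodular U)
    (A : Matrix (Fin n) (Fin n) ℝ) : IsUnimodular (matReduce A U) := by
  rw [LatticeDMT.matReduce]
  generalize (List.finRange n).reverse = l
  induction l generalizing U with
  | nil => exact hU
  | cons j l ih => exact ih (hU.matStep A j)

theorem IsUnimodular.swap {U : Matrix (Fin n) (Fin n) ℝ} (hU : IsUnimodular U) (i j : Fin n) :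
    IsUnimodular (U.submatrix id (Equiv.swap i j)) := by
  obtain ⟨Z, hZ, rfl⟩ := hU
  refine ⟨Z.submatrix id (Equiv.swap i j), ?_, rfl⟩
  rw [Matrix.det_permute']
  exact ((Equiv.Perm.sign (Equiv.swap i j)).isUnit.map (Int.castRingHom ℤ)).mul hZ

theorem linearIndependent_column {M : Matrix (Fin n) (Fin n) ℝ} (hM : M.det ≠ 0) :
    LinearIndependent ℝ (column M) := by
  have h := Matrix.linearIndependent_cols_of_det_ne_zero hM
  exact h.map' ((WithLp.linearEquiv 2 ℝ (Fin n → ℝ)).symm.toLinearMap) (LinearEquiv.ker _)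

theorem matReduce_size (hM : M.det ≠ 0) {U : Matrix (Fin n) (Fin n) ℝ} (hU : IsUnimodular U) :
    (∀ i j, j < i → |gsMu (column (M * matReduce (M.transpose * M) U)) i j| ≤ 1 / 2) ∧
    potential (column (M * matReduce (M.transpose * M) U)) = potential (column (M * U)) := by
  have hli : LinearIndependent ℝ (column (M * U)) :=
    linearIndependent_column (by rw [Matrix.det_mul]; exact mul_ne_zero hM hU.det_ne_zero)
  rw [matReduce, column_foldl_matStep]
  refine ⟨fun i j hij => ?_, potential_sizeReduce _ _⟩
  refine (gsMu_sizeReduce ?_ fun i => gramSchmidt_ne_zero (𝕜 := ℝ) i hli).2 i j (by simp) hij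
  -- The reversed enumeration supplies the decreasing order that size reduction needs.
  rw [List.pairwise_reverse]
  exact List.pairwise_lt_finRange n

/-- The invariant of the LLL algorithm after `k` rounds. -/
structure LLLInvariant (M : Matrix (Fin n) (Fin n) ℝ) (k : ℕ) (U : Matrix (Fin n) (Fin n) ℝ) :
    Prop where
  unimodular : IsUnimodular U
  size : ∀ i j, j < i → |gsMu (column (M * U)) i j| ≤ 1 / 2
  potential_le : potential (column (M * U)) ≤ (3 / 4) ^ k * potential (column M)

theorem LLLInvariant.init (hM : M.det ≠ 0) : LLLInvariant M 0 (matReduce (M.transpose * M) 1) where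
  unimodular := IsUnimodular.one.matReduce _
  size := (matReduce_size hM .one).1
  potential_le := by rw [(matReduce_size hM .one).2]; simp

theorem lovasz_iff (M U : Matrix (Fin n) (Fin n) ℝ) (p : Fin n × Fin n) :
    Lovasz (M.transpose * M) U p ↔
      (3 / 4 - gsMu (column (M * U)) p.1 p.2 ^ 2) * ‖gramSchmidt ℝ (column (M * U)) p.2‖ ^ 2 ≤
        ‖gramSchmidt ℝ (column (M * U)) p.1‖ ^ 2 := by
  rw [Lovasz, ldl_div_eq, ldl_self_eq, ldl_self_eq]

/-- The swap provides the factor `3/4`; the size reduction that follows leaves the Gram-Schmidt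
vectors, hence the potential, alone. -/
theorem LLLInvariant.step (hM : M.det ≠ 0) {k : ℕ} {U : Matrix (Fin n) (Fin n) ℝ}
    (h : LLLInvariant M k U) (hv : 1 ≤ violations (M.transpose * M) U) :
    LLLInvariant M (k + 1) (lllRound (M.transpose * M) U) := by
  obtain ⟨p, hp, hL, he⟩ := exists_swapFirst_eq (l := (consecutive n).toList)
    (by simpa using exists_violation hv)
  have hp' : (p.2 : ℕ) + 1 = p.1 := by simpa [consecutive] using hp
  have hU' := h.unimodular.swap p.2 p.1
  rw [lllRound, he]
  refine ⟨hU'.matReduce _, (matReduce_size hM hU').1, ?_⟩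
  rw [(matReduce_size hM hU').2, pow_succ']
  have hli : LinearIndependent ℝ (column (M * U)) := linearIndependent_column
    (by rw [Matrix.det_mul]; exact mul_ne_zero hM h.unimodular.det_ne_zero)
  rw [lovasz_iff, not_le] at hL
  have h1 := potential_swap_le hli hp' hL
  have h2 : column (M * U.submatrix id (Equiv.swap p.2 p.1)) =
      fun k => column (M * U) (Equiv.swap p.2 p.1 k) := by
    funext k; ext r; simp [column, Matrix.mul_apply]
  rw [h2]
  linarith [h.potential_le]

theorem LLLInvariant.isLLLReduced {k : ℕ} {U : Matrix (Fin n) (Fin n) ℝ}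
    (h : LLLInvariant M k U) (hv : ¬ 1 ≤ violations (M.transpose * M) U) :
    IsLLLReduced (M * U) := by
  refine ⟨h.size, fun i j hij => ?_⟩
  have := violations_eq_zero hv (p := (i, j)) (by simpa [consecutive] using hij)
  rwa [lovasz_iff] at this

/-- The lattice of `M` is not integral, but the coordinate matrix `U` is, so its columns have
potential at least `1`, and `M` shrinks this by at most `ε ^ n²`. Together with the initial bound `K
^ n²` this limits the number `k` of rounds. -/
theorem LLLInvariant.le_pow {k : ℕ} {U : Matrix (Fin n) (Fin n) ℝ} (h : LLLInvariant M k U)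
    {ε K : ℝ} (hε : 0 ≤ ε) (hε1 : ε ≤ 1) (hK : 1 ≤ K)
    (hlow : ∀ v, ε * ‖v‖ ^ 2 ≤ ‖Matrix.toEuclideanLin M v‖ ^ 2)
    (hup : ∀ i, ‖column M i‖ ^ 2 ≤ K) : ε ^ (n ^ 2) ≤ (3 / 4) ^ k * K ^ (n ^ 2) := by
  have h1 := pow_mul_potential_le (Matrix.toEuclideanLin M) hε hε1 hlow (column U)
  have h2 : (fun k => Matrix.toEuclideanLin M (column U k)) = column (M * U) := by
    funext k; ext r; simp [column, Matrix.mul_apply, Matrix.mulVec, dotProduct]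
  have h3 : 1 ≤ potential (column U) := by
    refine one_le_potential (linearIndependent_column h.unimodular.det_ne_zero) fun i j => ?_
    obtain ⟨Z, -, hZ⟩ := h.unimodular
    refine ⟨(Z.transpose * Z) i j, ?_⟩
    rw [← gram_columns, hZ]
    simp [Matrix.mul_apply]
  rw [h2] at h1
  calc ε ^ (n ^ 2) ≤ ε ^ (n ^ 2) * potential (column U) :=
        le_mul_of_one_le_right (by positivity) h3
    _ ≤ _ := h1
    _ ≤ _ := h.potential_le
    _ ≤ _ := mul_le_mul_of_nonneg_left (LatticeDMT.potential_le hK hup) (by positivity)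

end LLL

/-! ### Quadratic forms -/

section QuadraticForms

open scoped RealInnerProductSpace

variable {m n : ℕ}

theorem sqNorm_eq {ι : Type*} [Fintype ι] (v : ι → ℝ) : sqNorm v = dotProduct v v := by
  simp [sqNorm, dotProduct, sq]

theorem sqNorm_nonneg {ι : Type*} [Fintype ι] (v : ι → ℝ) : 0 ≤ sqNorm v :=
  Finset.sum_nonneg fun i _ => sq_nonneg (v i)

theorem sqNorm_toLp {ι : Type*} [Fintype ι] (v : ι → ℝ) : sqNorm v = ‖WithLp.toLp 2 v‖ ^ 2 := by
  rw [EuclideanSpace.norm_sq_eq]; simp [sqNorm]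

theorem sqNorm_smul {ι : Type*} [Fintype ι] (a : ℝ) (v : ι → ℝ) :
    sqNorm (a • v) = a ^ 2 * sqNorm v := by
  simp [sqNorm, mul_pow, Finset.mul_sum]

theorem sqNorm_mulVec {ι κ : Type*} [Fintype ι] [Fintype κ] (B : Matrix ι κ ℝ) (v : κ → ℝ) :
    sqNorm (B.mulVec v) = dotProduct v ((B.transpose * B).mulVec v) := by
  rw [sqNorm_eq, ← Matrix.mulVec_mulVec, Matrix.dotProduct_mulVec v, Matrix.vecMul_transpose]

theorem sqNorm_mulVec_le {ι κ : Type*} [Fintype ι] [Fintype κ] (B : Matrix ι κ ℝ) (v : κ → ℝ) :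
    sqNorm (B.mulVec v) ≤ (∑ i, ∑ j, B i j ^ 2) * sqNorm v := by
  rw [sqNorm, Finset.sum_mul]
  exact Finset.sum_le_sum fun i _ => Finset.sum_mul_sq_le_sq_mul_sq _ _ _

-- The factor comes from positivity in the C⋆-algebra of matrices. It serves the analysis only and
-- is never computed by the program.
open scoped MatrixOrder in
theorem exists_transpose_mul_self {C : Matrix (Fin n) (Fin n) ℝ} (hC : C.PosDef) :
    ∃ B : Matrix (Fin n) (Fin n) ℝ, B.transpose * B = C ∧ B.det ≠ 0 := by
  obtain ⟨B, hB⟩ := CStarAlgebra.nonneg_iff_eq_star_mul_self.mp hC.posSemidef.nonneg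
  rw [Matrix.star_eq_conjTranspose, Matrix.conjTranspose_eq_transpose_of_trivial] at hB
  refine ⟨B, hB.symm, fun h => ?_⟩
  have := hC.det_pos
  rw [hB, Matrix.det_mul, h, mul_zero] at this
  exact lt_irrefl _ this

/-- With `C = Bᵀ B`, the vector `v = B⁻¹ (B v)` is bounded through the Frobenius norm of `B⁻¹`; the
summand `1` keeps the constant finite when `n = 0`. -/
theorem PosDef.exists_lower_bound {C : Matrix (Fin n) (Fin n) ℝ} (hC : C.PosDef) :
    ∃ ε > 0, ∀ v, ε * sqNorm v ≤ dotProduct v (C.mulVec v) := by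
  obtain ⟨B, hB, hdet⟩ := exists_transpose_mul_self hC
  set κ := ∑ i, ∑ j, B⁻¹ i j ^ 2 with hκ
  have hκ0 : 0 ≤ κ := Finset.sum_nonneg fun i _ => Finset.sum_nonneg fun j _ => sq_nonneg _
  refine ⟨(κ + 1)⁻¹, by positivity, fun v => ?_⟩
  rw [← hB, ← sqNorm_mulVec, inv_mul_le_iff₀ (by positivity)]
  have := sqNorm_mulVec_le B⁻¹ (B.mulVec v)
  rw [Matrix.mulVec_mulVec, Matrix.nonsing_inv_mul _ (isUnit_iff_ne_zero.2 hdet),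
    Matrix.one_mulVec] at this
  nlinarith [sqNorm_nonneg (B.mulVec v)]

theorem posDef_filter (H : Matrix (Fin m) (Fin n) ℝ) {W : Matrix (Fin n) (Fin n) ℝ}
    (hW : W.PosDef) : (H.transpose * H + W).PosDef := by
  have := Matrix.posSemidef_conjTranspose_mul_self H
  rw [Matrix.conjTranspose_eq_transpose_of_trivial] at this
  exact Matrix.PosDef.posSemidef_add this hW

theorem dotProduct_gram (H : Matrix (Fin m) (Fin n) ℝ) (W : Matrix (Fin n) (Fin n) ℝ)
    (v : Fin n → ℝ) : dotProduct v ((H.transpose * H + W).mulVec v) =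
      sqNorm (H.mulVec v) + dotProduct v (W.mulVec v) := by
  rw [Matrix.add_mulVec, dotProduct_add, sqNorm_mulVec]

theorem dotProduct_conj (C G : Matrix (Fin n) (Fin n) ℝ) (v : Fin n → ℝ) :
    dotProduct v ((G.transpose * C * G).mulVec v) =
      dotProduct (G.mulVec v) (C.mulVec (G.mulVec v)) := by
  rw [← Matrix.mulVec_mulVec, ← Matrix.mulVec_mulVec, Matrix.dotProduct_mulVec v,
    Matrix.vecMul_transpose]

end QuadraticForms

/-! ### The program -/

section Machine

variable {m n : ℕ}

/-- The Gram matrix of the filtered lattice basis. -/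
def latticeGram (G W : Matrix (Fin n) (Fin n) ℝ) (H : Matrix (Fin m) (Fin n) ℝ) :
    Matrix (Fin n) (Fin n) ℝ := G.transpose * (H.transpose * H + W) * G

/-- The output of the decoder, given the transformation found by the LLL algorithm. -/
def linearOutput (G W : Matrix (Fin n) (Fin n) ℝ) (φ : ℝ) (H : Matrix (Fin m) (Fin n) ℝ)
    (y : Fin m → ℝ) (U : Matrix (Fin n) (Fin n) ℝ) : Fin n → ℝ :=
  φ • (G * U).mulVec fun i => ((round ((φ⁻¹ • (U.transpose * latticeGram G W H * U)⁻¹.mulVec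
    ((G * U).transpose.mulVec (H.transpose.mulVec y))) i) : ℤ) : ℝ)

/-- The filter cancels: with `K = G U`, `(B K)⁻¹ B⁻ᵀ = ((B K)ᵀ (B K))⁻¹ Kᵀ`, and the right side
involves `B` only through `Bᵀ B = HᵀH + W`. -/
theorem isLLLLinearDecision_linearOutput {G W B : Matrix (Fin n) (Fin n) ℝ} {φ : ℝ}
    {p : Observation m n} (hG : G.det ≠ 0) (hφ : 0 < φ) (hB : B.det ≠ 0)
    (hBW : B.transpose * B = (Matrix.of p.1).transpose * Matrix.of p.1 + W)
    {U : Matrix (Fin n) (Fin n) ℝ} (hU : IsUnimodular U) (hred : IsLLLReduced (B * G * U)) :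
    IsLLLLinearDecision G W φ p (linearOutput G W φ (Matrix.of p.1) p.2 U) := by
  obtain ⟨Z, hZ, rfl⟩ := id hU
  have hUdet := hU.det_ne_zero
  set U := Z.map (Int.cast : ℤ → ℝ) with hUdef
  refine ⟨B, Z, hBW, hZ, hred, ?_⟩
  rw [linearOutput]
  congr 3
  funext i
  congr 3
  set K := G * U with hK
  have hKdet : IsUnit K.det := by
    rw [hK, Matrix.det_mul]; exact isUnit_iff_ne_zero.2 (mul_ne_zero hG hUdet)
  have h1 : U.transpose * latticeGram G W (Matrix.of p.1) * U =
      (B * K).transpose * (B * K) := by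
    rw [latticeGram, ← hBW, hK]
    simp only [Matrix.transpose_mul, Matrix.mul_assoc]
  have h2 : (φ • (B * G * U))⁻¹ = φ⁻¹ • (B * K)⁻¹ := by
    rw [Matrix.mul_assoc, ← hK]
    have : IsUnit (B * K).det := by
      rw [Matrix.det_mul]; exact (isUnit_iff_ne_zero.2 hB).mul hKdet
    exact Matrix.inv_smul' (B * K) (Units.mk0 φ hφ.ne') this
  have h3 : ((B * K).transpose)⁻¹ * K.transpose = B.transpose⁻¹ := by
    rw [Matrix.transpose_mul, Matrix.mul_inv_rev, Matrix.mul_assoc, Matrix.nonsing_inv_mul _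
      (by rwa [Matrix.det_transpose]), Matrix.mul_one]
  rw [h1, h2, Matrix.mul_inv_rev, Matrix.smul_mulVec, Matrix.mulVec_mulVec, Matrix.mulVec_mulVec,
    Matrix.mulVec_mulVec, Matrix.mul_assoc, Matrix.mul_assoc, ← Matrix.mul_assoc _ K.transpose,
    h3]

/-- The temporary registers. -/
def tmpReg (m n k : ℕ) : Reg m n := .work (n * n + 2 + k)

theorem tmpReg_injective (m n : ℕ) : (tmpReg m n).Injective := fun a b h => by
  simp only [tmpReg, Reg.work.injEq] at h; omega

/-- The registers that are not temporary. -/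
abbrev mainRegs (m n : ℕ) : Set (Reg m n) := (Set.range (tmpReg m n))ᶜ

/-- The register of an entry of the transformation matrix. -/
def transReg (m n : ℕ) (i j : Fin n) : Reg m n := .work (finProdFinEquiv (i, j))

theorem work_mem_mainRegs {k : ℕ} (h : k < n * n + 2) : Reg.work k ∈ mainRegs m n := by
  rintro ⟨j, hj⟩
  simp only [tmpReg, Reg.work.injEq] at hj
  omega

theorem mem_mainRegs {v : Reg m n} (h : ∀ k, v ≠ .work k) : v ∈ mainRegs m n := by
  rintro ⟨j, rfl⟩
  exact h _ rfl

/-- The transformation matrix stored in the registers. -/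
def stTrans (s : Reg m n → ℝ) : Matrix (Fin n) (Fin n) ℝ := fun i j => s (transReg m n i j)

/-- The channel matrix stored in the registers. -/
def stChan (s : Reg m n → ℝ) : Matrix (Fin m) (Fin n) ℝ := fun i j => s (.chan i j)

/-- The generator matrix stored in the registers. -/
def stGen (s : Reg m n → ℝ) : Matrix (Fin n) (Fin n) ℝ := fun i j => s (.gen i j)

/-- The regularization matrix stored in the registers. -/
def stRegu (s : Reg m n → ℝ) : Matrix (Fin n) (Fin n) ℝ := fun i j => s (.regu i j)

/-- The Gram matrix computed from the registers. -/
def stGram (s : Reg m n → ℝ) : Matrix (Fin n) (Fin n) ℝ :=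
  latticeGram (stGen s) (stRegu s) (stChan s)

theorem compMat_stTrans : CompMat (mainRegs m n) stTrans := fun i j =>
  .reg _ (work_mem_mainRegs ((finProdFinEquiv (i, j)).2.trans (by omega)))

theorem compMat_stChan : CompMat (mainRegs m n) stChan := fun _ _ =>
  .reg _ (mem_mainRegs (by simp))

theorem compMat_stGen : CompMat (mainRegs m n) stGen := fun _ _ =>
  .reg _ (mem_mainRegs (by simp))

theorem compMat_stRegu : CompMat (mainRegs m n) stRegu := fun _ _ =>
  .reg _ (mem_mainRegs (by simp))

theorem compMat_stGram : CompMat (mainRegs m n) stGram :=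
  (compMat_stGen.transpose.mul ((compMat_stChan.transpose.mul compMat_stChan).add
    compMat_stRegu)).mul compMat_stGen

/-- Assign a new transformation matrix, and count the violations of the Lovász condition. -/
theorem exists_trans_program {f : (Reg m n → ℝ) → Matrix (Fin n) (Fin n) ℝ}
    (hf : CompMat (mainRegs m n) f) :
    ∃ (P : Program (Reg m n)) (c : ℕ), ∀ s, ∃ t ≤ c, ∃ s', Exec P s s' t ∧ stTrans s' = f s ∧
      s' (.work (n * n)) = violations (stGram s) (f s) ∧ s' (.work (n * n + 1)) = 1 ∧
      ∀ v, (∀ k, v ≠ .work k) → s' v = s v := by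
  -- Layout of the work registers: the first `n * n` hold the transformation, the next the number of
  -- violations, the next the constant `1` it is compared with; temporaries follow.
  set F : (Reg m n → ℝ) → Reg m n → ℝ := fun s v => match v with
    | .work k => if h : k < n * n then f s (finProdFinEquiv.symm ⟨k, h⟩).1
        (finProdFinEquiv.symm ⟨k, h⟩).2
        else if k = n * n then violations (stGram s) (f s) else 1
    | v => s v with hF
  obtain ⟨P, c, hP⟩ := exists_update_program (tmpReg_injective m n) F
    ((List.range (n * n + 2)).map .work) (by
      simp only [List.mem_map, List.mem_range]
      rintro _ ⟨k, hk, rfl⟩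
      simp only [hF]
      by_cases h1 : k < n * n
      · simp only [h1, dif_pos]; exact hf _ _
      · simp only [h1, dif_neg, not_false_eq_true]
        by_cases h2 : k = n * n
        · simp only [h2, if_pos]; exact compMat_stGram.violations hf
        · simp only [h2, if_neg, not_false_eq_true]; exact Comp.one) (by
      simp only [List.mem_map, List.mem_range]
      rintro _ ⟨k, hk, rfl⟩
      exact work_mem_mainRegs hk)
  refine ⟨P, c, fun s => ?_⟩
  obtain ⟨t, ht, s', he, h1, h2⟩ := hP s
  have h3 : ∀ k < n * n + 2, s' (.work k) = F s (.work k) := fun k hk =>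
    h1 _ (by simpa using hk)
  refine ⟨t, ht, s', he, ?_, ?_, ?_, fun v hv => h2 v (mem_mainRegs hv) ?_⟩
  · ext i j
    have := (finProdFinEquiv (i, j)).2
    rw [stTrans, transReg, h3 _ (by omega)]
    simp only [hF, dif_pos this, Fin.eta, Equiv.symm_apply_apply]
  · rw [h3 _ (by omega)]; simp [hF]
  · rw [h3 _ (by omega)]; simp [hF]
  · simp only [List.mem_map, List.mem_range, not_exists, not_and]
    exact fun k _ h => hv k h.symm

theorem exists_output_program (m n : ℕ) :
    ∃ (P : Program (Reg m n)) (c : ℕ), ∀ s, ∃ t ≤ c, ∃ s', Exec P s s' t ∧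
      ∀ i, s' (.out i) = linearOutput (stGen s) (stRegu s) (s .scale) (stChan s)
        (fun i => s (.recv i)) (stTrans s) i := by
  set F : (Reg m n → ℝ) → Reg m n → ℝ := fun s v => match v with
    | .out i => linearOutput (stGen s) (stRegu s) (s .scale) (stChan s)
        (fun i => s (.recv i)) (stTrans s) i
    | v => s v with hF
  obtain ⟨P, c, hP⟩ := exists_update_program (tmpReg_injective m n) F
    ((List.finRange n).map .out) (by
      simp only [List.mem_map]
      rintro _ ⟨i, -, rfl⟩
      simp only [hF, linearOutput]
      have hφ : Comp (mainRegs m n) fun s => s .scale := .reg _ (mem_mainRegs (by simp))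
      have hy : CompVec (mainRegs m n) fun s i => s (.recv i) := fun i =>
        .reg _ (mem_mainRegs (by simp))
      refine hφ.mul ((compMat_stGen.mul compMat_stTrans).mulVec (fun j => Comp.rnd ?_) i)
      refine hφ.inv.mul (((compMat_stTrans.transpose.mul compMat_stGram).mul
        compMat_stTrans).inv.mulVec ((compMat_stGen.mul compMat_stTrans).transpose.mulVec
          (compMat_stChan.transpose.mulVec hy)) j)) (by
      simp only [List.mem_map]
      rintro _ ⟨i, -, rfl⟩
      exact mem_mainRegs (by simp))
  refine ⟨P, c, fun s => ?_⟩
  obtain ⟨t, ht, s', he, h1, h2⟩ := hP s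
  exact ⟨t, ht, s', he, fun i => h1 _ (by simp)⟩

/-- The registers hold the input of the decoder. -/
structure Holds (G W : Matrix (Fin n) (Fin n) ℝ) (φ : ℝ) (p : Observation m n)
    (s : Reg m n → ℝ) : Prop where
  gen : stGen s = G
  regu : stRegu s = W
  scale : s .scale = φ
  chan : stChan s = Matrix.of p.1
  recv : (fun i => s (.recv i)) = p.2

theorem Holds.gram {G W : Matrix (Fin n) (Fin n) ℝ} {φ : ℝ} {p : Observation m n}
    {s : Reg m n → ℝ} (h : Holds G W φ p s) : stGram s = latticeGram G W (Matrix.of p.1) := by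
  rw [stGram, h.gen, h.regu, h.chan]

theorem Holds.congr {G W : Matrix (Fin n) (Fin n) ℝ} {φ : ℝ} {p : Observation m n}
    {s s' : Reg m n → ℝ} (h : Holds G W φ p s) (hs : ∀ v, (∀ k, v ≠ .work k) → s' v = s v) :
    Holds G W φ p s' where
  gen := by rw [← h.gen]; ext i j; exact hs _ (by simp)
  regu := by rw [← h.regu]; ext i j; exact hs _ (by simp)
  scale := by rw [← h.scale]; exact hs _ (by simp)
  chan := by rw [← h.chan]; ext i j; exact hs _ (by simp)
  recv := by rw [← h.recv]; ext i; exact hs _ (by simp)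

theorem initial_holds (G W : Matrix (Fin n) (Fin n) ℝ) (φ : ℝ) (p : Observation m n) :
    Holds G W φ p (initial G W φ p) := ⟨rfl, rfl, rfl, rfl, rfl⟩

/-- Taking logarithms of `(4/3) ^ k ≤ (K / ε) ^ d`. -/
theorem lt_of_pow_le {k d : ℕ} {ε K : ℝ} (hε : 0 < ε)
    (h : ε ^ d ≤ (3 / 4) ^ k * K ^ d) :
    k < ⌊(d : ℝ) / Real.log (4 / 3) * Real.log (K / ε)⌋₊ + 1 := by
  rw [Nat.lt_succ_iff]
  refine Nat.le_floor ?_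
  have h0 : 0 < Real.log (4 / 3) := Real.log_pos (by norm_num)
  rw [div_mul_eq_mul_div, le_div_iff₀ h0]
  have h1 : (4 / 3 : ℝ) ^ k ≤ (K / ε) ^ d := by
    rw [div_pow K, le_div_iff₀ (by positivity)]
    calc (4 / 3 : ℝ) ^ k * ε ^ d ≤ (4 / 3) ^ k * ((3 / 4) ^ k * K ^ d) := by gcongr
      _ = K ^ d := by rw [← mul_assoc, ← mul_pow]; norm_num
  have h2 := Real.log_le_log (by positivity) h1
  rwa [Real.log_pow, Real.log_pow] at h2

/-- There is a program for the LLL-aided linear decoder, the running time of which is at most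
logarithmic in the quotient of bounds for the lattice basis. -/
theorem exists_program (m n : ℕ) :
    ∃ (P : Program (Reg m n)) (c : ℝ), 0 < c ∧
      ∀ (G W : Matrix (Fin n) (Fin n) ℝ) (φ : ℝ) (p : Observation m n) (ε K : ℝ),
        G.det ≠ 0 → W.PosDef → 0 < φ → 0 < ε → ε ≤ 1 → 1 ≤ K →
        (∀ v, ε * sqNorm v ≤ dotProduct v ((latticeGram G W (Matrix.of p.1)).mulVec v)) →
        (∀ i, latticeGram G W (Matrix.of p.1) i i ≤ K) →
        ∃ (x : Fin n → ℝ) (t : ℕ), Outputs P G W φ p x t ∧ IsLLLLinearDecision G W φ p x ∧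
          (t : ℝ) ≤ c * (Real.log (K / ε) + 1) := by
  obtain ⟨P₁, c₁, h₁⟩ := exists_trans_program (m := m) (n := n)
    (f := fun s => matReduce (stGram s) 1)
    (compMat_stGram.matReduce fun i j => by
      by_cases h : i = j
      · subst h; simpa only [Matrix.one_apply_eq] using Comp.one
      · simpa only [Matrix.one_apply_ne h] using Comp.zero)
  obtain ⟨P₂, c₂, h₂⟩ := exists_trans_program (m := m) (n := n)
    (f := fun s => lllRound (stGram s) (stTrans s)) (compMat_stGram.lllRound compMat_stTrans)
  obtain ⟨P₃, c₃, h₃⟩ := exists_output_program m n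
  have h0 : 0 < Real.log (4 / 3) := Real.log_pos (by norm_num)
  set a : ℝ := ((n ^ 2 : ℕ) : ℝ) / Real.log (4 / 3) with ha
  -- `P₁` size-reduces the given basis, the loop runs LLL rounds as long as `1 ≤` the number of
  -- violations, and `P₃` rounds and writes the output.
  refine ⟨.seq P₁ (.seq (.loop (.work (n * n + 1)) (.work (n * n)) P₂) P₃),
    c₁ + (a + 1) * (c₂ + 1) + 1 + c₃, by positivity, ?_⟩
  intro G W φ p ε K hG hW hφ hε hε1 hK hlow hup
  obtain ⟨B, hBW, hB⟩ := exists_transpose_mul_self (posDef_filter (Matrix.of p.1) hW)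
  set M := B * G with hMdef
  have hM : M.det ≠ 0 := by rw [hMdef, Matrix.det_mul]; exact mul_ne_zero hB hG
  have hgram : latticeGram G W (Matrix.of p.1) = M.transpose * M := by
    rw [latticeGram, ← hBW, hMdef]
    simp only [Matrix.transpose_mul, Matrix.mul_assoc]
  set N := ⌊a * Real.log (K / ε)⌋₊ + 1 with hN
  obtain ⟨t₁, ht₁, s₁, he₁, hU₁, hv₁, ho₁, hs₁⟩ := h₁ (initial G W φ p)
  have hH₀ := initial_holds G W φ p
  -- The invariant alone bounds the number of rounds, so the input's `ε` and `K` enter the running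
  -- time but not the program.
  have hbound : ∀ {k U}, LLLInvariant M k U → k < N := fun {k U} h => by
    refine lt_of_pow_le hε (h.le_pow hε.le hε1 hK (fun v => ?_) fun i => ?_)
    · have := hlow (WithLp.ofLp v)
      rw [hgram, ← sqNorm_mulVec, sqNorm_toLp, sqNorm_toLp] at this
      exact this
    · have := hup i
      rwa [hgram, gram_columns, real_inner_self_eq_norm_sq] at this
  obtain ⟨t₂, ht₂, s₂, he₂, hx₂, k, hI₂⟩ := exec_loop (P := P₂)
    (a := Reg.work (n * n + 1)) (b := Reg.work (n * n)) (c := c₂) (N := N)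
    (I := fun k s => Holds G W φ p s ∧ LLLInvariant M k (stTrans s) ∧
      s (.work (n * n)) = violations (M.transpose * M) (stTrans s) ∧
      s (.work (n * n + 1)) = 1)
    (fun k s hI _ => hbound hI.2.1)
    (fun k s hI hle => by
      obtain ⟨hH, hL, hv, ho⟩ := hI
      obtain ⟨t, ht, s', he, hU, hv', ho', hs'⟩ := h₂ s
      rw [hH.gram, hgram] at hU hv'
      rw [ho, hv] at hle
      exact ⟨t, ht, s', he, hH.congr hs', by rw [hU]; exact hL.step hM hle, by rw [hv', hU], ho'⟩)
    (s := s₁) (by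
      rw [hH₀.gram, hgram] at hU₁ hv₁
      exact ⟨hH₀.congr hs₁, by rw [hU₁]; exact .init hM, by rw [hv₁, hU₁], ho₁⟩)
  obtain ⟨hH, hL, hv, ho⟩ := hI₂
  rw [ho, hv] at hx₂
  obtain ⟨t₃, ht₃, s₃, he₃, hx₃⟩ := h₃ s₂
  refine ⟨linearOutput G W φ (Matrix.of p.1) p.2 (stTrans s₂), _,
    ⟨s₃, .seq he₁ (.seq he₂ he₃), fun i => ?_⟩,
    isLLLLinearDecision_linearOutput hG hφ hB hBW hL.unimodular (hL.isLLLReduced hx₂), ?_⟩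
  · rw [hx₃, hH.gen, hH.regu, hH.scale, hH.chan, hH.recv]
  · have hlog : 0 ≤ Real.log (K / ε) := Real.log_nonneg (by rw [le_div_iff₀ hε]; linarith)
    have hN' : (N : ℝ) ≤ a * Real.log (K / ε) + 1 := by
      rw [hN]; push_cast
      linarith [Nat.floor_le (a := a * Real.log (K / ε)) (by positivity)]
    have e1 : (t₁ : ℝ) ≤ c₁ := by exact_mod_cast ht₁
    have e2 : (t₂ : ℝ) ≤ N * (c₂ + 1) + 1 := by exact_mod_cast ht₂
    have e3 : (t₃ : ℝ) ≤ c₃ := by exact_mod_cast ht₃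
    have e4 : (N : ℝ) * (c₂ + 1) ≤ (a * Real.log (K / ε) + 1) * (c₂ + 1) := by gcongr
    have ha0 : 0 ≤ a := by positivity
    have e5 : a * Real.log (K / ε) + 1 ≤ (a + 1) * (Real.log (K / ε) + 1) := by nlinarith
    have e6 : (a * Real.log (K / ε) + 1) * (c₂ + 1) ≤
        (a + 1) * (Real.log (K / ε) + 1) * (c₂ + 1) := by gcongr
    have e7 : (0 : ℝ) ≤ c₁ * Real.log (K / ε) := by positivity
    have e8 : (0 : ℝ) ≤ c₃ * Real.log (K / ε) := by positivity
    push_cast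
    nlinarith

end Machine

/-! ### Correctness of the LLL-aided linear decoder -/

section Decoding

variable {m n : ℕ}

/-- Write the error as `e = B u`. From `Bᵀ e = Hᵀ w - W x` one gets `‖e‖² = ⟨H u, w⟩ - uᵀ W x`, and
also `‖e‖² = ‖H u‖² + uᵀ W u`. Completing the squares `‖H u - w‖² ≥ 0` and `(u + x)ᵀ W (u + x) ≥ 0`
gives the claim, uniformly in `H`. -/
theorem sqNorm_filtered_noise_le {B W : Matrix (Fin n) (Fin n) ℝ} {H : Matrix (Fin m) (Fin n) ℝ}
    (hW : W.PosDef) (hB : B.det ≠ 0) (hBW : B.transpose * B = H.transpose * H + W)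
    (x : Fin n → ℝ) (w : Fin m → ℝ) :
    sqNorm ((B.transpose⁻¹ * H.transpose).mulVec (H.mulVec x + w) - B.mulVec x) ≤
      sqNorm w + dotProduct x (W.mulVec x) := by
  set e := (B.transpose⁻¹ * H.transpose).mulVec (H.mulVec x + w) - B.mulVec x with he
  have hBT : IsUnit B.transpose.det := by rw [Matrix.det_transpose]; exact isUnit_iff_ne_zero.2 hB
  have h1 : B.transpose.mulVec e = H.transpose.mulVec w - W.mulVec x := by
    rw [he, Matrix.mulVec_sub, Matrix.mulVec_mulVec, Matrix.mulVec_mulVec, hBW, ← Matrix.mul_assoc,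
      Matrix.mul_nonsing_inv _ hBT, Matrix.one_mul, Matrix.mulVec_add, Matrix.mulVec_mulVec,
      Matrix.add_mulVec]
    abel
  set u := B⁻¹.mulVec e with hu
  have hBu : B.mulVec u = e := by
    rw [hu, Matrix.mulVec_mulVec, Matrix.mul_nonsing_inv _ (isUnit_iff_ne_zero.2 hB),
      Matrix.one_mulVec]
  have h2 : sqNorm e = dotProduct (H.mulVec u) w - dotProduct u (W.mulVec x) := by
    rw [sqNorm_eq]
    nth_rewrite 1 [← hBu]
    rw [← Matrix.vecMul_transpose, ← Matrix.dotProduct_mulVec, h1, dotProduct_sub,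
      Matrix.dotProduct_mulVec, Matrix.vecMul_transpose]
  have h3 : sqNorm e = sqNorm (H.mulVec u) + dotProduct u (W.mulVec u) := by
    rw [← hBu, sqNorm_mulVec, hBW, dotProduct_gram]
  have h4 : 0 ≤ sqNorm (H.mulVec u - w) := sqNorm_nonneg _
  have h5 : 0 ≤ dotProduct (u + x) (W.mulVec (u + x)) := by
    simpa using hW.posSemidef.dotProduct_mulVec_nonneg (u + x)
  have hsymm : dotProduct x (W.mulVec u) = dotProduct u (W.mulVec x) := by
    have hWT : W.transpose = W := by
      simpa [Matrix.conjTranspose_eq_transpose_of_trivial] using hW.isHermitian.eq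
    rw [Matrix.dotProduct_mulVec, dotProduct_comm, ← Matrix.mulVec_transpose, hWT]
  rw [sqNorm_eq, sub_dotProduct, dotProduct_sub, dotProduct_sub, ← sqNorm_eq, ← sqNorm_eq,
    dotProduct_comm w] at h4
  rw [Matrix.mulVec_add, add_dotProduct, dotProduct_add, dotProduct_add, hsymm] at h5
  linarith

theorem intCast_mulVec (Z : Matrix (Fin n) (Fin n) ℤ) (z : Fin n → ℤ) :
    (Z.map (Int.cast : ℤ → ℝ)).mulVec (fun i => (z i : ℝ)) = fun i => ((Z.mulVec z i : ℤ) : ℝ) := by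
  ext i; simp [Matrix.mulVec, dotProduct]

/-- The decoder is correct if the noise is small in comparison with the minimum distance. -/
theorem eq_of_isLLLLinearDecision (hn : 0 < n) {G W : Matrix (Fin n) (Fin n) ℝ} {φ : ℝ}
    {H : Fin m → Fin n → ℝ} {w : Fin m → ℝ} {x x' : Fin n → ℝ} (hG : G.det ≠ 0) (hW : W.PosDef)
    (hφ : 0 < φ) {lam : ℝ} (z₀ : Fin n → ℤ) (hx : x = φ • G.mulVec fun i => (z₀ i : ℝ))
    (hdist : ∀ z : Fin n → ℤ, z ≠ 0 → lam ≤
      sqNorm ((Matrix.of H).mulVec (φ • G.mulVec fun i => (z i : ℝ))) +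
      dotProduct (φ • G.mulVec fun i => (z i : ℝ)) (W.mulVec (φ • G.mulVec fun i => (z i : ℝ))))
    (hsmall : 4 * 16 ^ n * (sqNorm w + dotProduct x (W.mulVec x)) < lam)
    (hdec : IsLLLLinearDecision G W φ (H, (Matrix.of H).mulVec x + w) x') : x' = x := by
  obtain ⟨B, Z, hBW, hZ, hred, hx'⟩ := hdec
  simp only at hBW hx'
  have hB : B.det ≠ 0 := fun h => by
    have := (posDef_filter (Matrix.of H) hW).det_pos
    rw [← hBW, Matrix.det_mul, h, mul_zero] at this
    exact lt_irrefl _ this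
  set U := Z.map (Int.cast : ℤ → ℝ) with hU
  have hUdet : U.det ≠ 0 := IsUnimodular.det_ne_zero ⟨Z, hZ, rfl⟩
  set M := B * G * U with hM
  have hMdet : M.det ≠ 0 := by
    rw [hM, Matrix.det_mul, Matrix.det_mul]; exact mul_ne_zero (mul_ne_zero hB hG) hUdet
  -- The integer coordinates of `x` in the reduced basis; `v` below is the error in these
  -- coordinates.
  set z₁ := Z⁻¹.mulVec z₀ with hz₁
  have hUz : U.mulVec (fun i => (z₁ i : ℝ)) = fun i => (z₀ i : ℝ) := by
    rw [hU, intCast_mulVec, hz₁, Matrix.mulVec_mulVec, Matrix.mul_nonsing_inv _ hZ,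
      Matrix.one_mulVec]
  set y := (Matrix.of H).mulVec x + w with hy
  set e := (B.transpose⁻¹ * (Matrix.of H).transpose).mulVec y - B.mulVec x with he
  have hele := sqNorm_filtered_noise_le hW hB hBW x w
  rw [← hy, ← he] at hele
  set v := φ⁻¹ • M⁻¹.mulVec e with hv
  have hMv : M.mulVec v = φ⁻¹ • e := by
    rw [hv, Matrix.mulVec_smul, Matrix.mulVec_mulVec, Matrix.mul_nonsing_inv _
      (isUnit_iff_ne_zero.2 hMdet), Matrix.one_mulVec]
  have hBx : B.mulVec x = φ • M.mulVec fun i => (z₁ i : ℝ) := by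
    rw [hx, hM, ← Matrix.mulVec_mulVec, hUz, ← Matrix.mulVec_mulVec, Matrix.mulVec_smul]
  have hcoord : (φ • M)⁻¹.mulVec ((B.transpose⁻¹ * (Matrix.of H).transpose).mulVec y) =
      fun i => (z₁ i : ℝ) + v i := by
    have h1 : (φ • M)⁻¹ = φ⁻¹ • M⁻¹ :=
      Matrix.inv_smul' M (Units.mk0 φ hφ.ne') (isUnit_iff_ne_zero.2 hMdet)
    have h2 : (B.transpose⁻¹ * (Matrix.of H).transpose).mulVec y = B.mulVec x + e := by
      rw [he]; abel
    rw [h1, h2, hBx, Matrix.smul_mulVec, Matrix.mulVec_add, Matrix.mulVec_smul,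
      Matrix.mulVec_mulVec, Matrix.nonsing_inv_mul _ (isUnit_iff_ne_zero.2 hMdet),
      Matrix.one_mulVec, smul_add, smul_smul, inv_mul_cancel₀ hφ.ne', one_smul, ← hv]
    rfl
  -- The first reduced basis vector is a nonzero lattice vector, so the minimum distance bounds it
  -- from below.
  have hlam : lam ≤ φ ^ 2 * ‖column M ⟨0, hn⟩‖ ^ 2 := by
    have hne : Z.mulVec (Pi.single ⟨0, hn⟩ 1) ≠ 0 := fun h => by
      have h1 : Z⁻¹.mulVec (Z.mulVec (Pi.single ⟨0, hn⟩ 1)) = 0 := by rw [h, Matrix.mulVec_zero]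
      rw [Matrix.mulVec_mulVec, Matrix.nonsing_inv_mul _ hZ, Matrix.one_mulVec] at h1
      have := congrFun h1 ⟨0, hn⟩
      simp at this
    have h1 := hdist _ hne
    rw [← dotProduct_gram, ← hBW, ← sqNorm_mulVec, ← intCast_mulVec, Matrix.mulVec_smul, sqNorm_smul,
      Matrix.mulVec_mulVec, Matrix.mulVec_mulVec, ← hU, ← hM] at h1
    refine h1.trans_eq ?_
    rw [column, ← sqNorm_toLp]
    congr 2
    ext i
    simp [Matrix.mulVec, dotProduct, Pi.single_apply]
  -- Squaring the coordinate bound produces `16 ^ n = (4 ^ n)²`; the further factor `4` in the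
  -- smallness hypothesis gives `|v j|² < 1/4`.
  have hvle : ∀ j, |v j| < 1 / 2 := by
    intro j
    have h1 := abs_coord_le_of_reduced (linearIndependent_column hMdet) hred.1 hred.2 hn v j
    have h2 : ∑ i, v i • column M i = WithLp.toLp 2 (φ⁻¹ • e) := by
      rw [← hMv]
      ext r
      simp [column, Matrix.mulVec, dotProduct, mul_comm]
    rw [h2] at h1
    have h3 : |v j| ^ 2 * ‖column M ⟨0, hn⟩‖ ^ 2 ≤ 16 ^ n * (φ⁻¹ ^ 2 * sqNorm e) := by
      have := pow_le_pow_left₀ (by positivity) h1 2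
      rw [mul_pow, mul_pow, ← sqNorm_toLp (φ⁻¹ • e), sqNorm_smul, ← pow_mul, mul_comm n, pow_mul] at this
      norm_num at this ⊢
      exact this
    have h4 : |v j| ^ 2 * lam ≤ 16 ^ n * sqNorm e := by
      calc |v j| ^ 2 * lam ≤ |v j| ^ 2 * (φ ^ 2 * ‖column M ⟨0, hn⟩‖ ^ 2) := by gcongr
        _ = φ ^ 2 * (|v j| ^ 2 * ‖column M ⟨0, hn⟩‖ ^ 2) := by ring
        _ ≤ φ ^ 2 * (16 ^ n * (φ⁻¹ ^ 2 * sqNorm e)) := by gcongr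
        _ = 16 ^ n * sqNorm e := by field_simp
    have hlam0 : 0 < lam := lt_of_le_of_lt (by
      have := (sqNorm_nonneg e).trans hele
      positivity) hsmall
    have h5 : |v j| ^ 2 * lam < (1 / 2) ^ 2 * lam := by
      have : (16 : ℝ) ^ n * sqNorm e ≤ 16 ^ n * (sqNorm w + dotProduct x (W.mulVec x)) := by gcongr
      linarith
    exact lt_of_pow_lt_pow_left₀ 2 (by norm_num) (lt_of_mul_lt_mul_right h5 hlam0.le)
  rw [hx', hcoord]
  have hround : (fun i => ((round ((z₁ i : ℝ) + v i) : ℤ) : ℝ)) = fun i => (z₁ i : ℝ) := by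
    funext i
    have : round (v i) = 0 := by
      rw [round_eq_zero_iff]
      have := abs_lt.1 (hvle i)
      exact ⟨by linarith, this.2⟩
    rw [round_intCast_add, this, add_zero]
  rw [hround, ← Matrix.mulVec_mulVec, hUz, hx]

/-- Determinism of the machine makes the choice in the definition of the decoder immaterial. -/
theorem timeoutDecoder_eq {P : Program (Reg m n)} {G W : Matrix (Fin n) (Fin n) ℝ} {φ N : ℝ}
    {p : Observation m n} {x : Fin n → ℝ} {t : ℕ} (h : Outputs P G W φ p x t) (ht : (t : ℝ) ≤ N) :
    timeoutDecoder P G W φ N p = some x := by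
  have hex : ∃ x : Fin n → ℝ, ∃ t : ℕ, (t : ℝ) ≤ N ∧ Outputs P G W φ p x t := ⟨x, t, ht, h⟩
  rw [timeoutDecoder, dif_pos hex]
  obtain ⟨t', -, s', he', hs'⟩ := hex.choose_spec
  obtain ⟨s, he, hs⟩ := h
  obtain ⟨rfl, -⟩ := he.det he'
  congr 1
  funext i
  rw [← hs', hs]

end Decoding

/-! ### The noise -/

section Noise

variable {m : ℕ}

/-- The density of the noise. -/
def noiseDensity (w : Fin m → ℝ) : ℝ≥0∞ := ∏ i, gaussianPDF 0 1 (w i)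

theorem measurable_noiseDensity : Measurable (noiseDensity (m := m)) :=
  Finset.measurable_prod _ fun i _ => (measurable_gaussianPDF 0 1).comp (measurable_pi_apply i)

theorem noiseDensity_eq (w : Fin m → ℝ) : noiseDensity w =
    ENNReal.ofReal ((√(2 * Real.pi))⁻¹ ^ m * Real.exp (-(sqNorm w / 2))) := by
  simp only [noiseDensity, gaussianPDF]
  rw [← ENNReal.ofReal_prod_of_nonneg fun i _ => gaussianPDFReal_nonneg _ _ _]
  congr 1
  simp only [gaussianPDFReal, NNReal.coe_one, mul_one, sub_zero, Finset.prod_mul_distrib,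
    Finset.prod_const, Finset.card_univ, Fintype.card_fin, ← Real.exp_sum, ← Finset.sum_div,
    Finset.sum_neg_distrib, sqNorm, neg_div]

theorem noiseDensity_anti {v w : Fin m → ℝ} (h : sqNorm v ≤ sqNorm w) :
    noiseDensity w ≤ noiseDensity v := by
  rw [noiseDensity_eq, noiseDensity_eq]
  refine ENNReal.ofReal_le_ofReal (mul_le_mul_of_nonneg_left (Real.exp_le_exp.2 ?_) (by positivity))
  linarith

theorem noise_eq_withDensity : noise m = volume.withDensity noiseDensity := by
  refine Measure.pi_eq fun s hs => ?_
  rw [withDensity_apply _ (MeasurableSet.univ_pi hs), ← lintegral_indicator (MeasurableSet.univ_pi hs)]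
  have h1 : ∀ w : Fin m → ℝ, (Set.univ.pi s).indicator noiseDensity w =
      ENNReal.ofReal (∏ i, (s i).indicator (gaussianPDFReal 0 1) (w i)) := by
    intro w
    by_cases hw : w ∈ Set.univ.pi s
    · rw [Set.indicator_of_mem hw, noiseDensity,
        ENNReal.ofReal_prod_of_nonneg fun i _ => Set.indicator_nonneg
          (fun x _ => gaussianPDFReal_nonneg _ _ _) _]
      refine Finset.prod_congr rfl fun i _ => ?_
      rw [Set.indicator_of_mem (hw i trivial), gaussianPDF]
    · rw [Set.indicator_of_notMem hw]
      simp only [Set.mem_pi, Set.mem_univ, true_imp_iff, not_forall] at hw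
      obtain ⟨i, hi⟩ := hw
      rw [Finset.prod_eq_zero (Finset.mem_univ i) (Set.indicator_of_notMem hi _),
        ENNReal.ofReal_zero]
  simp only [h1]
  rw [← ofReal_integral_eq_lintegral_ofReal, integral_fintype_prod_volume_eq_prod
    (f := fun i => (s i).indicator (gaussianPDFReal 0 1)), ENNReal.ofReal_prod_of_nonneg]
  · refine Finset.prod_congr rfl fun i _ => ?_
    rw [integral_indicator (hs i), gaussianReal_apply_eq_integral _ one_ne_zero]
  · exact fun i _ => integral_nonneg fun x => Set.indicator_nonneg
      (fun x _ => gaussianPDFReal_nonneg _ _ _) _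
  · exact Integrable.fintype_prod (f := fun i => (s i).indicator (gaussianPDFReal 0 1))
      fun i => (integrable_gaussianPDFReal 0 1).indicator (hs i)
  · exact ae_of_all _ fun w => Finset.prod_nonneg fun i _ => Set.indicator_nonneg
      (fun x _ => gaussianPDFReal_nonneg _ _ _) _

instance : IsProbabilityMeasure (noise m) := by unfold noise; infer_instance

/-- The noise law of a translated set. -/
theorem noise_preimage_add {A : Set (Fin m → ℝ)} (hA : MeasurableSet A) (a : Fin m → ℝ) :
    noise m {w | a + w ∈ A} = ∫⁻ y, A.indicator (fun y => noiseDensity (y - a)) y := by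
  have hA' : MeasurableSet {w | a + w ∈ A} := hA.preimage (measurable_const_add a)
  rw [noise_eq_withDensity, withDensity_apply _ hA', ← lintegral_indicator hA',
    
    ← lintegral_add_left_eq_self (fun y => A.indicator (fun y => noiseDensity (y - a)) y) a]
  refine lintegral_congr fun w => ?_
  by_cases h : a + w ∈ A
  · rw [Set.indicator_of_mem h, Set.indicator_of_mem (by exact h), add_sub_cancel_left]
  · rw [Set.indicator_of_notMem h, Set.indicator_of_notMem (by exact h)]

/-- A lower bound for the density of the noise on a cube. -/
def cubeDensity (m : ℕ) : ℝ≥0∞ := noiseDensity (fun _ : Fin m => 2)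

theorem cubeDensity_le {w : Fin m → ℝ} (hw : w ∈ Set.Icc (fun _ => -2) (fun _ => (2 : ℝ))) :
    cubeDensity m ≤ noiseDensity w := by
  refine noiseDensity_anti (Finset.sum_le_sum fun i _ => ?_)
  have h1 := hw.1 i
  have h2 := hw.2 i
  simp only at h1 h2
  nlinarith

theorem cubeDensity_mul_le {A : Set (Fin m → ℝ)} (hA : MeasurableSet A) :
    cubeDensity m * volume (A ∩ Set.Icc (fun _ => -2) (fun _ => (2 : ℝ))) ≤ noise m A := by
  rw [noise_eq_withDensity, withDensity_apply _ hA, ← setLIntegral_const]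
  refine le_trans (setLIntegral_mono' (hA.inter measurableSet_Icc) fun w hw => ?_)
    (lintegral_mono_set Set.inter_subset_left)
  exact cubeDensity_le hw.2

/-- The constant in the lower bound for the error probability of a binary test. -/
def testConst (m : ℕ) : ℝ≥0∞ :=
  cubeDensity m * volume (Set.Icc (fun _ => -1) (fun _ : Fin m => (1 : ℝ)))

theorem testConst_ne_zero (m : ℕ) : testConst m ≠ 0 := by
  refine mul_ne_zero ?_ ?_
  · rw [cubeDensity, noiseDensity_eq, Ne, ENNReal.ofReal_eq_zero, not_le]
    positivity
  · rw [Real.volume_Icc_pi, Finset.prod_ne_zero_iff]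
    intro i _
    rw [Ne, ENNReal.ofReal_eq_zero]
    norm_num

/-- Two close signals cannot both be distinguished reliably. -/
theorem testConst_le {A B : Set (Fin m → ℝ)} (hA : MeasurableSet A) (hB : MeasurableSet B)
    {v : Fin m → ℝ} (hv : sqNorm v ≤ 1) (h : ∀ w, w ∈ A ∨ w + v ∈ B) :
    testConst m ≤ noise m A + noise m B := by
  have hvi : ∀ i, |v i| ≤ 1 := fun i => by
    rw [← sq_le_one_iff_abs_le_one]
    exact (Finset.single_le_sum (f := fun i => v i ^ 2) (fun i _ => sq_nonneg _)
      (Finset.mem_univ i)).trans hv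
  refine le_trans ?_ (add_le_add (cubeDensity_mul_le hA) (cubeDensity_mul_le hB))
  rw [testConst, ← mul_add]
  refine mul_le_mul_right ?_ _
  -- For `w` in the cube of half-width `1` both `w` and `w + v` lie in that of half-width `2`, where
  -- the density is at least `cubeDensity`; translation preserves volume.
  rw [← measure_preimage_add_right volume v (B ∩ _)]
  refine le_trans (measure_mono fun w hw => ?_) (measure_union_le _ _)
  rcases h w with hwA | hwB
  · refine Or.inl ⟨hwA, fun i => ?_, fun i => ?_⟩
    · exact le_trans (by norm_num) (hw.1 i)
    · exact le_trans (hw.2 i) (by norm_num)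
  · refine Or.inr ⟨hwB, fun i => ?_, fun i => ?_⟩
    · have h1 := hw.1 i
      have := abs_le.1 (hvi i)
      simp only [Pi.add_apply] at h1 ⊢
      linarith
    · have h1 := hw.2 i
      have := abs_le.1 (hvi i)
      simp only [Pi.add_apply] at h1 ⊢
      linarith

theorem testConst_ne_top (m : ℕ) : testConst m ≠ ∞ := by
  refine ne_top_of_le_ne_top (b := 1 + 1) (by simp) ?_
  have := testConst_le (m := m) (v := 0) MeasurableSet.univ MeasurableSet.univ
    (by simp [sqNorm]) (by simp)
  simpa using this

/-- Markov's inequality for the `q`-th absolute moment and a union bound. Polynomial decay of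
arbitrary order is enough, since `u` will be a power of `ρ`. -/
theorem noise_tail (m q : ℕ) : ∃ C : ℝ, 0 ≤ C ∧ ∀ u : ℝ, 0 < u →
    noise m {w | ∃ i, u ≤ |w i|} ≤ ENNReal.ofReal (C / u ^ q) := by
  set I : ℝ := ∫ x, ‖x‖ ^ q ∂(gaussianReal 0 1) with hI
  have hI0 : 0 ≤ I := integral_nonneg fun x => by positivity
  have hint : Integrable (fun x : ℝ => ‖x‖ ^ q) (gaussianReal 0 1) :=
    (memLp_id_gaussianReal (q : NNReal)).integrable_norm_pow'
  refine ⟨m * I, by positivity, fun u hu => ?_⟩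
  have h1 : ∀ i : Fin m, noise m {w | u ≤ |w i|} ≤ ENNReal.ofReal (I / u ^ q) := fun i => by
    have h2 : noise m {w | u ≤ |w i|} = gaussianReal 0 1 {x | u ≤ |x|} := by
      have hs : MeasurableSet {x : ℝ | u ≤ |x|} := measurableSet_le measurable_const measurable_abs
      exact (measurePreserving_eval (fun _ : Fin m => gaussianReal 0 1) i).measure_preimage
        hs.nullMeasurableSet
    rw [h2, ENNReal.ofReal_div_of_pos (by positivity), ENNReal.le_div_iff_mul_le
      (Or.inl (by simpa using pow_pos hu q)) (Or.inl ENNReal.ofReal_ne_top), mul_comm, hI,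
      ofReal_integral_eq_lintegral_ofReal hint (ae_of_all _ fun x => by positivity)]
    refine le_trans ?_ (mul_meas_ge_le_lintegral₀ (hint.1.aemeasurable.ennreal_ofReal)
      (ENNReal.ofReal (u ^ q)))
    refine mul_le_mul_right (measure_mono fun x hx => ?_) _
    exact ENNReal.ofReal_le_ofReal (pow_le_pow_left₀ hu.le hx q)
  calc noise m {w | ∃ i, u ≤ |w i|} = noise m (⋃ i, {w | u ≤ |w i|}) := by
        congr 1; ext w; simp
    _ ≤ ∑ i, noise m {w | u ≤ |w i|} := measure_iUnion_fintype_le _ _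
    _ ≤ ∑ _i : Fin m, ENNReal.ofReal (I / u ^ q) := Finset.sum_le_sum fun i _ => h1 i
    _ = ENNReal.ofReal (m * I / u ^ q) := by
        rw [Finset.sum_const, Finset.card_univ, Fintype.card_fin, nsmul_eq_mul, mul_div_assoc,
          ENNReal.ofReal_mul (by positivity), ENNReal.ofReal_natCast]

end Noise

/-! ### Error probabilities -/

section Error

variable {m n : ℕ} {X : Finset (Fin n → ℝ)}

theorem errorProb_coe (X : Finset (Fin n → ℝ)) (ν : Measure (Fin m → Fin n → ℝ))
    (dec : Decoder m n) : errorProb (X : Set (Fin n → ℝ)) ν dec =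
      (∑ x ∈ X, (ν.prod (noise m))
        {p | dec (p.1, (Matrix.of p.1).mulVec x + p.2) ≠ some x}) / (X.card : ℝ≥0∞) := by
  rw [errorProb, Set.ncard_coe_finset]
  congr 1
  exact Finset.tsum_subtype X fun x => (ν.prod (noise m))
    {p | dec (p.1, (Matrix.of p.1).mulVec x + p.2) ≠ some x}

/-- The maximum likelihood rule is optimal for a fixed channel. -/
theorem sum_noise_ml_le (a : (Fin n → ℝ) → (Fin m → ℝ)) {f : (Fin m → ℝ) → (Fin n → ℝ)}
    (hf : Measurable f) (hfX : ∀ y, f y ∈ X)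
    (hmin : ∀ y, ∀ x ∈ X, sqNorm (y - a (f y)) ≤ sqNorm (y - a x))
    {A : (Fin n → ℝ) → Set (Fin m → ℝ)} (hA : ∀ x, MeasurableSet (A x))
    (hdisj : ∀ y, ∀ x ∈ X, ∀ x' ∈ X, y - a x ∉ A x → y - a x' ∉ A x' → x = x') :
    ∑ x ∈ X, noise m {w | f (a x + w) ≠ x} ≤ ∑ x ∈ X, noise m (A x) := by
  have hfm : ∀ x, MeasurableSet {w | f (a x + w) = x} := fun x =>
    (hf.comp (measurable_const_add (a x))) (measurableSet_singleton x)
  -- In terms of the received `y`, at most one `x` counts as correct, and its likelihood at `y` is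
  -- at most that of the ML decision.
  have hgood : ∑ x ∈ X, noise m (A x)ᶜ ≤ ∑ x ∈ X, noise m {w | f (a x + w) = x} := by
    have e1 : ∀ x, noise m (A x)ᶜ = ∫⁻ y, ({y | y - a x ∉ A x}).indicator
        (fun y => noiseDensity (y - a x)) y := fun x => by
      rw [← noise_preimage_add]
      · congr 1; ext w; simp
      · exact (hA x).compl.preimage (measurable_sub_const (a x))
    have e2 : ∀ x, noise m {w | f (a x + w) = x} = ∫⁻ y, ({y | f y = x}).indicator
        (fun y => noiseDensity (y - a x)) y := fun x => by
      rw [← noise_preimage_add]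
      · rfl
      · exact hf (measurableSet_singleton x)
    have hd : ∀ x, Measurable fun y : Fin m → ℝ => noiseDensity (y - a x) := fun x =>
      measurable_noiseDensity.comp (measurable_sub_const (a x))
    simp only [e1, e2]
    rw [← lintegral_finsetSum, ← lintegral_finsetSum]
    · refine lintegral_mono fun y => ?_
      have hR : noiseDensity (y - a (f y)) ≤
          ∑ x ∈ X, ({y | f y = x}).indicator (fun y => noiseDensity (y - a x)) y := by
        refine le_trans (le_of_eq ?_) (Finset.single_le_sum (fun _ _ => zero_le) (hfX y))
        rw [Set.indicator_of_mem (by simp)]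
      refine le_trans ?_ hR
      by_cases hex : ∃ x ∈ X, y - a x ∉ A x
      · obtain ⟨x, hx, hxA⟩ := hex
        rw [Finset.sum_eq_single_of_mem x hx fun x' hx' hne => Set.indicator_of_notMem
          (fun h => hne (hdisj y x' hx' x hx h hxA)) _]
        exact (Set.indicator_le_self _ _ _).trans (noiseDensity_anti (hmin y x hx))
      · push Not at hex
        rw [Finset.sum_eq_zero fun x hx => Set.indicator_of_notMem
          (fun h => (show y - a x ∉ A x from h) (hex x hx)) _]
        exact zero_le
    · exact fun x _ => (hd x).indicator (hf (measurableSet_singleton x))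
    · exact fun x _ => (hd x).indicator ((hA x).compl.preimage (measurable_sub_const (a x)))
  have t1 : ∑ x ∈ X, noise m (A x) + ∑ x ∈ X, noise m (A x)ᶜ = X.card := by
    rw [← Finset.sum_add_distrib]
    simp [measure_add_measure_compl (hA _)]
  have t2 : ∑ x ∈ X, noise m {w | f (a x + w) ≠ x} + ∑ x ∈ X, noise m {w | f (a x + w) = x} =
      X.card := by
    rw [← Finset.sum_add_distrib]
    have : ∀ x, noise m {w | f (a x + w) ≠ x} + noise m {w | f (a x + w) = x} = 1 := fun x => by
      rw [add_comm]
      exact (measure_add_measure_compl (hfm x)).trans measure_univ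
    simp [this]
  have hfin : ∑ x ∈ X, noise m (A x)ᶜ ≠ ∞ :=
    ne_top_of_le_ne_top (ENNReal.natCast_ne_top X.card) (t1 ▸ le_add_self)
  rw [← ENNReal.add_le_add_iff_right hfin, t1, ← t2]
  gcongr

theorem measurable_channel (x : Fin n → ℝ) : Measurable
    fun p : (Fin m → Fin n → ℝ) × (Fin m → ℝ) => (p.1, (Matrix.of p.1).mulVec x + p.2) := by
  refine measurable_fst.prodMk (measurable_pi_iff.2 fun i => ?_)
  simp only [Pi.add_apply, Matrix.mulVec, dotProduct, Matrix.of_apply]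
  fun_prop

/-- Fix the channel and integrate. The competing decoder need not be measurable, so its error events
are replaced by measurable hulls: these have the same probability, and outside them the decision is
still correct, so at most one codeword is right for each observation. -/
theorem errorProb_ml_le {ν : Measure (Fin m → Fin n → ℝ)} [IsProbabilityMeasure ν]
    {f : Observation m n → (Fin n → ℝ)} (hf : IsMLDecoder (X : Set (Fin n → ℝ)) f)
    (dec : Decoder m n) :
    errorProb (X : Set (Fin n → ℝ)) ν (fun p => some (f p)) ≤
      errorProb (X : Set (Fin n → ℝ)) ν dec := by
  rw [errorProb_coe, errorProb_coe]
  refine ENNReal.div_le_div_right ?_ _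
  set M : (Fin n → ℝ) → Set ((Fin m → Fin n → ℝ) × (Fin m → ℝ)) := fun x =>
    toMeasurable (ν.prod (noise m)) {p | dec (p.1, (Matrix.of p.1).mulVec x + p.2) ≠ some x}
  have hM : ∀ x, MeasurableSet (M x) := fun x => measurableSet_toMeasurable _ _
  have hMsub : ∀ x, {p | dec (p.1, (Matrix.of p.1).mulVec x + p.2) ≠ some x} ⊆ M x :=
    fun x => subset_toMeasurable _ _
  have hfm : ∀ x, MeasurableSet {p : (Fin m → Fin n → ℝ) × (Fin m → ℝ) |
      some (f (p.1, (Matrix.of p.1).mulVec x + p.2)) ≠ some x} := fun x => by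
    simp only [ne_eq, Option.some.injEq]
    exact ((hf.1.comp (measurable_channel x)) (measurableSet_singleton x)).compl
  have e : ∀ x, (ν.prod (noise m)) {p | dec (p.1, (Matrix.of p.1).mulVec x + p.2) ≠ some x} =
      ∫⁻ H, noise m (Prod.mk H ⁻¹' M x) ∂ν := fun x => by
    rw [← Measure.prod_apply (hM x), measure_toMeasurable]
  simp only [e, Measure.prod_apply (hfm _)]
  rw [← lintegral_finsetSum _ fun x _ => measurable_measure_prodMk_left (hfm x),
    ← lintegral_finsetSum _ fun x _ => measurable_measure_prodMk_left (hM x)]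
  refine lintegral_mono fun H => ?_
  have := sum_noise_ml_le (X := X) (fun x => (Matrix.of H).mulVec x) (f := fun y => f (H, y))
    (hf.1.comp (measurable_const.prodMk measurable_id)) (fun y => (hf.2 (H, y)).1)
    (fun y x hx => (hf.2 (H, y)).2 x hx) (A := fun x => Prod.mk H ⁻¹' M x)
    (fun x => (hM x).preimage measurable_prodMk_left) (fun y x _ x' _ h1 h2 => by
      have k1 := not_not.1 fun h => h1 (hMsub x h)
      have k2 := not_not.1 fun h => h2 (hMsub x' h)
      simp only [add_sub_cancel] at k1 k2
      exact Option.some.inj (k1.symm.trans k2))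
  simpa using this

/-- The set of channels for which some short nonzero lattice vector is received with small norm. -/
def outage (m : ℕ) (G : Matrix (Fin n) (Fin n) ℝ) (φ ε : ℝ) : Set (Fin m → Fin n → ℝ) :=
  {H | ∃ z : Fin n → ℤ, z ≠ 0 ∧ ‖φ • G.mulVec fun i => (z i : ℝ)‖ ≤ ε ∧
    sqNorm ((Matrix.of H).mulVec (φ • G.mulVec fun i => (z i : ℝ))) ≤ 1}

theorem measurableSet_outage (G : Matrix (Fin n) (Fin n) ℝ) (φ ε : ℝ) :
    MeasurableSet (outage m G φ ε) := by
  simp only [outage, Set.ofPred_exists]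
  refine MeasurableSet.iUnion fun z => ?_
  refine (MeasurableSet.const _).inter ((MeasurableSet.const _).inter ?_)
  refine measurableSet_le (g := fun _ : Fin m → Fin n → ℝ => (1 : ℝ)) ?_ measurable_const
  simp only [sqNorm, Matrix.mulVec, dotProduct, Matrix.of_apply]
  fun_prop

/-- In an outage no decoder is reliable. -/
theorem testConst_mul_outage_le {ν : Measure (Fin m → Fin n → ℝ)} {f : Observation m n → (Fin n → ℝ)}
    (hf : Measurable f) {G : Matrix (Fin n) (Fin n) ℝ} {φ ε : ℝ} (hG : G.det ≠ 0) (hφ : 0 < φ)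
    {S : Finset (Fin n → ℝ)} (hSX : S ⊆ X) (hS : ∀ x ∈ S, ∀ z : Fin n → ℤ,
      ‖φ • G.mulVec fun i => (z i : ℝ)‖ ≤ ε → x + (φ • G.mulVec fun i => (z i : ℝ)) ∈ X)
    {K : ℕ} (hX : X.Nonempty) (hK : X.card ≤ K * S.card) :
    testConst m * ν (outage m G φ ε) ≤
      2 * K * errorProb (X : Set (Fin n → ℝ)) ν (fun p => some (f p)) := by
  have hfm : ∀ x, MeasurableSet {p : (Fin m → Fin n → ℝ) × (Fin m → ℝ) |
      f (p.1, (Matrix.of p.1).mulVec x + p.2) ≠ x} := fun x =>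
    ((hf.comp (measurable_channel x)) (measurableSet_singleton x)).compl
  have hO : ∀ H ∈ outage m G φ ε, testConst m * S.card ≤
      2 * ∑ x ∈ X, noise m {w | f (H, (Matrix.of H).mulVec x + w) ≠ x} := by
    rintro H ⟨z, hz, hzε, hz1⟩
    set d := φ • G.mulVec fun i => (z i : ℝ) with hd
    have hd0 : d ≠ 0 := fun h => by
      rcases smul_eq_zero.1 h with h | h
      · exact hφ.ne' h
      · have := Matrix.eq_zero_of_mulVec_eq_zero hG h
        exact hz (funext fun i => by simpa using congrFun this i)
    have hfmH : ∀ x, MeasurableSet {w : Fin m → ℝ | f (H, (Matrix.of H).mulVec x + w) ≠ x} :=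
      fun x => (hfm x).preimage (measurable_prodMk_left (x := H))
    set Nx : (Fin n → ℝ) → ℝ≥0∞ := fun x =>
      noise m {w | f (H, (Matrix.of H).mulVec x + w) ≠ x} with hNx
    -- Sending `x + d` with noise `w` and sending `x` with noise `w + H d` give the same
    -- observation, so one of the two is decoded wrongly.
    have h1 : ∀ x ∈ S, testConst m ≤ Nx x + Nx (x + d) := fun x _ => by
      refine (testConst_le (hfmH (x + d)) (hfmH x) hz1 fun w => ?_).trans_eq (add_comm _ _)
      by_contra! h
      simp only [Set.mem_ofPred_eq, not_not] at h
      have h2 : (Matrix.of H).mulVec x + (w + (Matrix.of H).mulVec d) =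
          (Matrix.of H).mulVec (x + d) + w := by rw [Matrix.mulVec_add]; abel
      rw [h2, h.1] at h
      exact hd0 (by simpa using h.2)
    calc testConst m * S.card = ∑ _x ∈ S, testConst m := by
          rw [Finset.sum_const, nsmul_eq_mul, mul_comm]
      _ ≤ ∑ x ∈ S, (Nx x + Nx (x + d)) := Finset.sum_le_sum h1
      _ = ∑ x ∈ S, Nx x + ∑ x ∈ S.map (addRightEmbedding d), Nx x := by
          rw [Finset.sum_add_distrib, Finset.sum_map]; rfl
      _ ≤ ∑ x ∈ X, Nx x + ∑ x ∈ X, Nx x := by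
          refine add_le_add (Finset.sum_le_sum_of_subset hSX) (Finset.sum_le_sum_of_subset ?_)
          intro x hx
          obtain ⟨x', hx', rfl⟩ := Finset.mem_map.1 hx
          exact hS x' hx' z hzε
      _ = _ := (two_mul _).symm
  have h2 : testConst m * S.card * ν (outage m G φ ε) ≤
      2 * ∑ x ∈ X, (ν.prod (noise m)) {p | f (p.1, (Matrix.of p.1).mulVec x + p.2) ≠ x} := by
    simp only [Measure.prod_apply (hfm _)]
    rw [← lintegral_finsetSum _ fun x _ => measurable_measure_prodMk_left (hfm x),
      ← lintegral_const_mul' _ _ (by simp), ← setLIntegral_const]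
    exact (setLIntegral_mono' (measurableSet_outage G φ ε) hO).trans
      (setLIntegral_le_lintegral _ _)
  have hX0 : (X.card : ℝ≥0∞) ≠ 0 := by simpa using hX.ne_empty
  rw [errorProb_coe, ← mul_div_assoc, ENNReal.le_div_iff_mul_le (Or.inl hX0)
    (Or.inl (ENNReal.natCast_ne_top _))]
  simp only [ne_eq, Option.some.injEq] at h2 ⊢
  calc testConst m * ν (outage m G φ ε) * X.card
      ≤ testConst m * ν (outage m G φ ε) * ((K : ℝ≥0∞) * S.card) := by
        gcongr; exact_mod_cast hK
    _ = K * (testConst m * S.card * ν (outage m G φ ε)) := by ring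
    _ ≤ K * (2 * ∑ x ∈ X, (ν.prod (noise m))
        {p | ¬ f (p.1, (Matrix.of p.1).mulVec x + p.2) = x}) := by gcongr
    _ = _ := by ring

/-- A decoder that is correct outside of exceptional sets of channels and noise vectors. -/
theorem errorProb_le {ν : Measure (Fin m → Fin n → ℝ)} [IsProbabilityMeasure ν] {dec : Decoder m n}
    {O : Set (Fin m → Fin n → ℝ)} {E : Set (Fin m → ℝ)}
    (h : ∀ x ∈ X, ∀ H w, H ∉ O → w ∉ E → dec (H, (Matrix.of H).mulVec x + w) = some x) :
    errorProb (X : Set (Fin n → ℝ)) ν dec ≤ ν O + noise m E := by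
  rw [errorProb_coe]
  refine ENNReal.div_le_of_le_mul' ?_
  rw [← nsmul_eq_mul, ← Finset.sum_const]
  refine Finset.sum_le_sum fun x hx => ?_
  calc (ν.prod (noise m)) {p | dec (p.1, (Matrix.of p.1).mulVec x + p.2) ≠ some x}
      ≤ (ν.prod (noise m)) (O ×ˢ Set.univ ∪ Set.univ ×ˢ E) := by
        refine measure_mono fun p hp => ?_
        by_contra hc
        simp only [Set.mem_union, Set.mem_prod, Set.mem_univ, and_true, true_and, not_or] at hc
        exact hp (h x hx p.1 p.2 hc.1 hc.2)
    _ ≤ _ := measure_union_le _ _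
    _ = ν O + noise m E := by simp [Measure.prod_prod]

end Error

/-! ### Exponents -/

section Exponents

theorem expOrder_le_iff {f : ℝ → ℝ≥0∞} {ρ : ℝ} (hρ : 1 < ρ) (y : ℝ) :
    expOrder f ρ ≤ (y : EReal) ↔ f ρ ≤ ENNReal.ofReal (ρ ^ y) := by
  have hlog : 0 < Real.log ρ := Real.log_pos hρ
  have hpos : 0 < ρ ^ y := Real.rpow_pos_of_pos (by linarith) y
  rw [expOrder, EReal.div_le_iff_le_mul (by exact_mod_cast hlog) (EReal.coe_ne_top _),
    ← EReal.coe_mul, mul_comm, ← Real.log_rpow (by linarith), ← ENNReal.log_ofReal_of_pos hpos,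
    ENNReal.log_le_log_iff]

theorem expOrder_mono {f g : ℝ → ℝ≥0∞} {ρ : ℝ} (hρ : 1 < ρ) (h : f ρ ≤ g ρ) :
    expOrder f ρ ≤ expOrder g ρ :=
  EReal.div_le_div_right_of_nonneg (by exact_mod_cast (Real.log_pos hρ).le)
    (ENNReal.log_le_log_iff.2 h)

theorem DotEq.eventually_le {f : ℝ → ℝ≥0∞} {x y : ℝ} (h : DotEq f x) (hxy : x < y) :
    ∀ᶠ ρ in atTop, f ρ ≤ ENNReal.ofReal (ρ ^ y) := by
  filter_upwards [(tendsto_order.1 h).2 y (by exact_mod_cast hxy), eventually_gt_atTop 1]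
    with ρ h1 h2
  exact (expOrder_le_iff h2 y).1 h1.le

theorem DotLE.eventually_le {f : ℝ → ℝ≥0∞} {x y : ℝ} (h : DotLE f x) (hxy : x < y) :
    ∀ᶠ ρ in atTop, f ρ ≤ ENNReal.ofReal (ρ ^ y) := by
  have h1 : limsup (expOrder f) atTop < (y : EReal) := lt_of_le_of_lt h (by exact_mod_cast hxy)
  filter_upwards [eventually_lt_of_limsup_lt h1, eventually_gt_atTop 1] with ρ h1 h2
  exact (expOrder_le_iff h2 y).1 h1.le

/-- The lower half of the limit is inherited from `g`; the upper half needs only bounds with every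
exponent strictly above `x`. -/
theorem DotEq.of_le {f g : ℝ → ℝ≥0∞} {x : ℝ} (hg : DotEq g x) (hgf : ∀ ρ, 1 < ρ → g ρ ≤ f ρ)
    (hf : ∀ y, x < y → ∀ᶠ ρ in atTop, f ρ ≤ ENNReal.ofReal (ρ ^ y)) : DotEq f x := by
  refine tendsto_order.2 ⟨fun a ha => ?_, fun a ha => ?_⟩
  · filter_upwards [(tendsto_order.1 hg).1 a ha, eventually_gt_atTop 1] with ρ h1 h2
    exact h1.trans_le (expOrder_mono h2 (hgf ρ h2))
  · obtain ⟨y, hy, hya⟩ := EReal.lt_iff_exists_real_btwn.1 ha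
    filter_upwards [hf y (by exact_mod_cast hy), eventually_gt_atTop 1] with ρ h1 h2
    exact lt_of_le_of_lt ((expOrder_le_iff h2 y).2 h1) hya

end Exponents

/-! ### Codebooks -/

section Codebook

variable {n : ℕ} (L : LatticeDesign n)

theorem scaling_pos {ρ : ℝ} (hρ : 0 < ρ) (n T : ℕ) (r : ℝ) : 0 < scaling n T ρ r :=
  Real.rpow_pos_of_pos hρ _

/-- The lattice coordinates are continuous functions of the codeword, hence bounded integers on the
compact region. -/
theorem LatticeDesign.codebook_finite (T : ℕ) {ρ : ℝ} (hρ : 0 < ρ) (r : ℝ) :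
    (L.codebook T ρ r).Finite := by
  set φ := scaling n T ρ r with hφ
  have hφ0 : 0 < φ := scaling_pos hρ n T r
  have hcont : Continuous fun x : Fin n → ℝ => φ⁻¹ • L.G⁻¹.mulVec x := by
    have h : Continuous fun x : Fin n → ℝ => L.G⁻¹.mulVec x :=
      Continuous.matrix_mulVec continuous_const continuous_id
    exact Continuous.const_smul (M := ℝ) h φ⁻¹
  obtain ⟨C, hC⟩ := (L.isCompact.image hcont).isBounded.exists_norm_le
  have hfin : (Set.Icc (fun _ => -⌈C⌉) (fun _ : Fin n => ⌈C⌉)).Finite := Set.finite_Icc _ _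
  refine (hfin.image fun z => φ • L.G.mulVec fun i => (z i : ℝ)).subset ?_
  rintro x ⟨hxR, z, hz⟩
  refine ⟨z, ?_, hz.symm⟩
  have h1 := hC _ ⟨x, hxR, rfl⟩
  simp only at h1
  rw [hz, Matrix.mulVec_smul, Matrix.mulVec_mulVec,
    Matrix.nonsing_inv_mul _ (isUnit_iff_ne_zero.2 L.det_ne_zero), Matrix.one_mulVec, smul_smul,
    inv_mul_cancel₀ hφ0.ne', one_smul] at h1
  have h2 : ∀ i, |(z i : ℝ)| ≤ ⌈C⌉ := fun i =>
    ((norm_le_pi_norm (fun i => (z i : ℝ)) i).trans h1).trans (Int.le_ceil C)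
  exact ⟨fun i => by exact_mod_cast (abs_le.1 (h2 i)).1, fun i => by exact_mod_cast (abs_le.1 (h2 i)).2⟩

theorem LatticeDesign.zero_mem_codebook (T : ℕ) (ρ r : ℝ) : 0 ∈ L.codebook T ρ r :=
  ⟨interior_subset L.zero_mem, 0, by
    have : (fun i => (((0 : Fin n → ℤ) i : ℤ) : ℝ)) = 0 := by ext i; simp
    rw [this, Matrix.mulVec_zero, smul_zero]⟩

/-- A positive fraction of the codebook lies in a small ball, around which there is room in the
shaping region. -/
theorem LatticeDesign.exists_core : ∃ ε > 0, (∀ x, ‖x‖ ≤ 2 * ε → x ∈ L.R) ∧ ∃ K : ℕ,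
    ∀ (T : ℕ) (ρ r : ℝ) (X : Finset (Fin n → ℝ)), (X : Set (Fin n → ℝ)) = L.codebook T ρ r →
      X.card ≤ K * (X.filter fun x => ‖x‖ ≤ ε).card := by
  classical
  obtain ⟨δ, hδ, hball⟩ := Metric.isOpen_iff.1 isOpen_interior 0 L.zero_mem
  have hR : ∀ x, ‖x‖ ≤ 2 * (δ / 4) → x ∈ L.R := fun x hx =>
    interior_subset (hball (mem_ball_zero_iff.2 (by linarith)))
  -- The number of balls in a cover of the shaping region is the constant `K`, so it does not depend
  -- on `ρ`, `T` or `r`.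
  obtain ⟨t, -, htfin, hcover⟩ := L.isCompact.finite_cover_balls (e := δ / 8) (by positivity)
  lift t to Finset (Fin n → ℝ) using htfin
  refine ⟨δ / 4, by positivity, hR, t.card, fun T ρ r X hX => ?_⟩
  have hmem : ∀ x, x ∈ X ↔ x ∈ L.codebook T ρ r := fun x => by rw [← hX, Finset.mem_coe]
  have hsub : X ⊆ t.biUnion fun v => X.filter fun x => x ∈ Metric.ball v (δ / 8) := fun x hx => by
    have := hcover ((hmem x).1 hx).1
    simp only [Set.mem_iUnion, Finset.mem_coe, exists_prop] at this
    obtain ⟨v, hv, hxv⟩ := this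
    exact Finset.mem_biUnion.2 ⟨v, hv, Finset.mem_filter.2 ⟨hx, hxv⟩⟩
  refine (Finset.card_le_card hsub).trans (Finset.card_biUnion_le_card_mul _ _ _ fun v _ => ?_)
  rcases (X.filter fun x => x ∈ Metric.ball v (δ / 8)).eq_empty_or_nonempty with h0 | ⟨p, hp⟩
  · rw [h0, Finset.card_empty]; exact Nat.zero_le _
  -- Subtracting one codeword `p` of a small ball maps all codewords of that ball injectively to
  -- short lattice vectors, which are again codewords.
  refine Finset.card_le_card_of_injOn (fun x => x - p) (fun x hx => ?_)
    (fun x _ y _ h => sub_left_injective h)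
  rw [Finset.mem_coe, Finset.mem_filter] at hx
  rw [Finset.mem_filter] at hp
  have hdist : ‖x - p‖ ≤ δ / 4 := by
    rw [← dist_eq_norm]
    have := dist_triangle_right x p v
    linarith [Metric.mem_ball.1 hx.2, Metric.mem_ball.1 hp.2]
  rw [Finset.mem_coe, Finset.mem_filter, hmem]
  refine ⟨⟨hR _ (by linarith), ?_⟩, hdist⟩
  obtain ⟨-, z, hz⟩ := (hmem x).1 hx.1
  obtain ⟨-, z', hz'⟩ := (hmem p).1 hp.1
  refine ⟨z - z', ?_⟩
  simp only
  rw [hz, hz', ← smul_sub, ← Matrix.mulVec_sub]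
  congr 2
  ext i; simp

/-- The probability of an outage is at most of the order of any error probability. -/
theorem LatticeDesign.exists_outage_le (m : ℕ) : ∃ ε > 0, ∃ C : ℝ, 0 ≤ C ∧
    ∀ (T : ℕ) (ρ r : ℝ), 0 < ρ → ∀ (ν : Measure (Fin m → Fin n → ℝ))
      (f : Observation m n → (Fin n → ℝ)), Measurable f →
      ν (outage m L.G (scaling n T ρ r) ε) ≤
        ENNReal.ofReal C * errorProb (L.codebook T ρ r) ν (fun p => some (f p)) := by
  obtain ⟨ε, hε, hR, K, hK⟩ := L.exists_core
  refine ⟨ε, hε, (2 * K / testConst m).toReal, ENNReal.toReal_nonneg, ?_⟩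
  intro T ρ r hρ ν f hf
  obtain ⟨X, hX⟩ := (L.codebook_finite T hρ r).exists_finset_coe
  have hmem : ∀ x, x ∈ X ↔ x ∈ L.codebook T ρ r := fun x => by rw [← hX, Finset.mem_coe]
  rw [ENNReal.ofReal_toReal (ENNReal.div_ne_top
    (ENNReal.mul_ne_top (by simp) (ENNReal.natCast_ne_top K)) (testConst_ne_zero m)), ← hX,
    ← ENNReal.mul_div_right_comm, ENNReal.le_div_iff_mul_le (Or.inl (testConst_ne_zero m))
    (Or.inl (testConst_ne_top m)), mul_comm]
  refine testConst_mul_outage_le hf L.det_ne_zero (scaling_pos hρ n T r)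
    (Finset.filter_subset _ _) (fun x hx z hz => ?_)
    ⟨0, (hmem 0).2 (L.zero_mem_codebook T ρ r)⟩ (hK T ρ r X hX)
  rw [Finset.mem_filter] at hx
  rw [hmem]
  refine ⟨hR _ ((norm_add_le _ _).trans (by linarith)), ?_⟩
  obtain ⟨-, z', hz'⟩ := (hmem x).1 hx.1
  refine ⟨z' + z, ?_⟩
  rw [hz', ← smul_add, ← Matrix.mulVec_add]
  congr 2
  ext i; simp

end Codebook

/-! ### Optimality -/

section Main

variable {m n : ℕ}

theorem norm_sq_le_sqNorm (v : Fin n → ℝ) : ‖v‖ ^ 2 ≤ sqNorm v := by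
  have h : ‖v‖ ≤ √(sqNorm v) := (pi_norm_le_iff_of_nonneg (Real.sqrt_nonneg _)).2 fun i =>
    Real.abs_le_sqrt (Finset.single_le_sum (f := fun i => v i ^ 2) (fun i _ => sq_nonneg _)
      (Finset.mem_univ i))
  exact (pow_le_pow_left₀ (norm_nonneg v) h 2).trans_eq (Real.sq_sqrt (sqNorm_nonneg v))

/-- Bounds for the Gram matrix of the filtered lattice basis. -/
theorem exists_latticeGram_bounds (m : ℕ) {G W : Matrix (Fin n) (Fin n) ℝ} (hG : G.det ≠ 0)
    (hW : W.PosDef) : ∃ ε > 0, ε ≤ 1 ∧ ∃ K ≥ (1 : ℝ), ∀ H : Fin m → Fin n → ℝ,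
      (∀ v, ε * sqNorm v ≤ dotProduct v ((latticeGram G W (Matrix.of H)).mulVec v)) ∧
      ∀ i, latticeGram G W (Matrix.of H) i i ≤ K * (1 + ∑ i, ∑ j, H i j ^ 2) := by
  have hGW : (G.transpose * W * G).PosDef := by
    have := hW.conjTranspose_mul_mul_same (B := G)
      (Matrix.mulVec_injective_of_isUnit ((Matrix.isUnit_iff_isUnit_det G).2
        (isUnit_iff_ne_zero.2 hG)))
    rwa [Matrix.conjTranspose_eq_transpose_of_trivial] at this
  obtain ⟨ε, hε, hlow⟩ := PosDef.exists_lower_bound hGW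
  set K : ℝ := 1 + ∑ i, (sqNorm (G.mulVec (Pi.single i 1)) + |(G.transpose * W * G) i i|) with hK
  have hterm : ∀ i, 0 ≤ sqNorm (G.mulVec (Pi.single i 1)) + |(G.transpose * W * G) i i| :=
    fun i => add_nonneg (sqNorm_nonneg _) (abs_nonneg _)
  have hK1 : 1 ≤ K := by
    have := Finset.sum_nonneg fun i (_ : i ∈ Finset.univ) => hterm i
    linarith
  -- The lower bound comes from `W` alone and is therefore uniform in `H`; only the upper bound sees
  -- the channel gain.
  refine ⟨min ε 1, lt_min hε one_pos, min_le_right _ _, K, hK1, fun H => ⟨fun v => ?_, fun i => ?_⟩⟩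
  · have h1 := hlow v
    rw [dotProduct_conj] at h1
    rw [latticeGram, dotProduct_conj, dotProduct_gram]
    have h2 := sqNorm_nonneg ((Matrix.of H).mulVec (G.mulVec v))
    have h3 : min ε 1 * sqNorm v ≤ ε * sqNorm v :=
      mul_le_mul_of_nonneg_right (min_le_left _ _) (sqNorm_nonneg v)
    linarith
  · have hdiag : ∀ A : Matrix (Fin n) (Fin n) ℝ,
        A i i = dotProduct (Pi.single i 1) (A.mulVec (Pi.single i 1)) := fun A => by simp
    have h1 : latticeGram G W (Matrix.of H) i i =
        sqNorm ((Matrix.of H).mulVec (G.mulVec (Pi.single i 1))) + (G.transpose * W * G) i i := by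
      rw [hdiag (latticeGram G W (Matrix.of H)), hdiag (G.transpose * W * G), latticeGram, dotProduct_conj, dotProduct_gram,
        dotProduct_conj]
    have h2 := sqNorm_mulVec_le (Matrix.of H) (G.mulVec (Pi.single i 1))
    simp only [Matrix.of_apply] at h2
    have h3 := Finset.single_le_sum (fun i _ => hterm i) (Finset.mem_univ i)
    have h4 := le_abs_self ((G.transpose * W * G) i i)
    have h5 : 0 ≤ ∑ i, ∑ j, H i j ^ 2 :=
      Finset.sum_nonneg fun i _ => Finset.sum_nonneg fun j _ => sq_nonneg _
    have h6 := sqNorm_nonneg (G.mulVec (Pi.single i 1))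
    have h7 := abs_nonneg ((G.transpose * W * G) i i)
    rw [h1]
    nlinarith

/-- If there is no outage at a higher rate, then all lattice vectors are received with a large
regularized norm. -/
theorem le_regularized_norm {G W : Matrix (Fin n) (Fin n) ℝ} {H : Fin m → Fin n → ℝ}
    {φ τ ε w₀ : ℝ} (hε : 0 < ε) (hw₀ : 0 < w₀) (hW : W.PosDef)
    (hlow : ∀ v, w₀ * sqNorm v ≤ dotProduct v (W.mulVec v)) (hH : H ∉ outage m G φ ε)
    {z : Fin n → ℤ} (hz : z ≠ 0) : τ ^ 2 * min 1 (w₀ * ε ^ 2) ≤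
      sqNorm ((Matrix.of H).mulVec ((φ * τ) • G.mulVec fun i => (z i : ℝ))) +
      dotProduct ((φ * τ) • G.mulVec fun i => (z i : ℝ))
        (W.mulVec ((φ * τ) • G.mulVec fun i => (z i : ℝ))) := by
  set d := φ • G.mulVec fun i => (z i : ℝ) with hd
  have hd' : ((φ * τ) • G.mulVec fun i => (z i : ℝ)) = τ • d := by
    rw [hd, smul_smul, mul_comm]
  have h0 : 0 ≤ dotProduct d (W.mulVec d) := by
    simpa using hW.posSemidef.dotProduct_mulVec_nonneg d
  have h1 := sqNorm_nonneg ((Matrix.of H).mulVec d)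
  rw [hd', Matrix.mulVec_smul _ τ d, Matrix.mulVec_smul _ τ d, sqNorm_smul, smul_dotProduct, dotProduct_smul,
    smul_eq_mul, smul_eq_mul, ← mul_assoc, ← sq, ← mul_add]
  refine mul_le_mul_of_nonneg_left ?_ (sq_nonneg τ)
  by_cases hdε : ‖d‖ ≤ ε
  · have h2 : 1 < sqNorm ((Matrix.of H).mulVec d) := by
      by_contra h
      exact hH ⟨z, hz, hdε, not_lt.1 h⟩
    linarith [min_le_left 1 (w₀ * ε ^ 2)]
  · have h2 : ε ^ 2 ≤ sqNorm d :=
      (pow_le_pow_left₀ hε.le (not_le.1 hdε).le 2).trans (norm_sq_le_sqNorm d)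
    have h3 : w₀ * ε ^ 2 ≤ w₀ * sqNorm d := by gcongr
    linarith [min_le_right 1 (w₀ * ε ^ 2), hlow d]

theorem sqNorm_le_of_abs_le {w : Fin m → ℝ} {u : ℝ} (h : ∀ i, |w i| ≤ u) :
    sqNorm w ≤ m * u ^ 2 := by
  refine (Finset.sum_le_sum fun i _ => ?_).trans_eq (by simp : ∑ _i : Fin m, u ^ 2 = m * u ^ 2)
  rw [← sq_abs]
  exact pow_le_pow_left₀ (abs_nonneg _) (h i) 2

/-- For large SNR the timed-out decoder is correct, unless there is an outage at a higher rate, or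
the channel gain is large, or the noise is large. -/
theorem eventually_timeoutDecoder_eq (hn : 0 < n) {P : Program (Reg m n)} {cP a : ℝ} (hcP : 0 < cP)
    (ha : 0 ≤ a)
    (hP : ∀ (G W : Matrix (Fin n) (Fin n) ℝ) (φ : ℝ) (p : Observation m n) (ε K : ℝ),
      G.det ≠ 0 → W.PosDef → 0 < φ → 0 < ε → ε ≤ 1 → 1 ≤ K →
      (∀ v, ε * sqNorm v ≤ dotProduct v ((latticeGram G W (Matrix.of p.1)).mulVec v)) →
      (∀ i, latticeGram G W (Matrix.of p.1) i i ≤ K) →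
      ∃ (x : Fin n → ℝ) (t : ℕ), Outputs P G W φ p x t ∧ IsLLLLinearDecision G W φ p x ∧
        (t : ℝ) ≤ cP * (Real.log (K / ε) + 1))
    (L : LatticeDesign n) {W : Matrix (Fin n) (Fin n) ℝ} (hW : W.PosDef) {T : ℕ} (hT : 0 < T)
    {ε : ℝ} (hε : 0 < ε) {r r' : ℝ} (hr : r < r') :
    ∀ᶠ ρ : ℝ in atTop, ∀ x ∈ L.codebook T ρ r, ∀ (H : Fin m → Fin n → ℝ) (w : Fin m → ℝ),
      H ∉ outage m L.G (scaling n T ρ r') ε ∪ {H | ρ ^ a ≤ ∑ i, ∑ j, H i j ^ 2} →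
      w ∉ {w : Fin m → ℝ | ∃ i, ρ ^ ((r' - r) * T / n / 2) ≤ |w i|} →
      timeoutDecoder P L.G W (scaling n T ρ r) (cP * (a + 1) * Real.log ρ)
        (H, (Matrix.of H).mulVec x + w) = some x := by
  obtain ⟨ε₁, hε₁, hε₁1, K₀, hK₀, hbounds⟩ := exists_latticeGram_bounds m L.det_ne_zero hW
  obtain ⟨w₀, hw₀, hlow⟩ := PosDef.exists_lower_bound hW
  have hcont : Continuous fun x : Fin n → ℝ => dotProduct x (W.mulVec x) :=
    continuous_id.dotProduct (Continuous.matrix_mulVec continuous_const continuous_id)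
  obtain ⟨CR, hCR⟩ := (L.isCompact.image hcont).isBounded.exists_norm_le
  -- The exponent for which the scaling at `r` is `ρ ^ κ` times the scaling at `r'`.
  set κ : ℝ := (r' - r) * T / n with hκ
  have hκ0 : 0 < κ := by
    have : (0 : ℝ) < T := by exact_mod_cast hT
    have : (0 : ℝ) < n := by exact_mod_cast hn
    have := sub_pos.2 hr
    positivity
  set lam := min 1 (w₀ * ε ^ 2) with hlam
  have hlam0 : 0 < lam := lt_min one_pos (by positivity)
  have hlim := tendsto_rpow_atTop hκ0
  filter_upwards [eventually_gt_atTop 1, hlim.eventually_ge_atTop 1,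
    hlim.eventually_gt_atTop (4 * 16 ^ n * (m + |CR|) / lam),
    -- For large `ρ` one extra `log ρ` absorbs all constants that depend on the design and on `W`.
    Real.tendsto_log_atTop.eventually_ge_atTop (Real.log (2 * K₀ / ε₁) + 1)]
    with ρ hρ hτ1 hτ2 hlogρ x hx H w hH hw
  have hρ0 : 0 < ρ := by linarith
  set τ := ρ ^ κ with hτ
  simp only [Set.mem_union, Set.mem_ofPred_eq, not_or, not_le, not_exists] at hH hw
  obtain ⟨hHO, hHF⟩ := hH
  have hscale : scaling n T ρ r = scaling n T ρ r' * τ := by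
    rw [scaling, scaling, hτ, ← Real.rpow_add hρ0, hκ]
    congr 1
    ring
  have hS0 : 0 ≤ ∑ i, ∑ j, H i j ^ 2 :=
    Finset.sum_nonneg fun i _ => Finset.sum_nonneg fun j _ => sq_nonneg _
  have hρa : 1 ≤ ρ ^ a := Real.one_le_rpow hρ.le ha
  obtain ⟨x', t, hout, hdec, ht⟩ := hP L.G W (scaling n T ρ r) (H, (Matrix.of H).mulVec x + w)
    ε₁ (2 * K₀ * ρ ^ a) L.det_ne_zero hW (scaling_pos hρ0 n T r) hε₁ hε₁1 (by nlinarith)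
    (hbounds H).1 (fun i => ((hbounds H).2 i).trans (by nlinarith))
  have hx' : x' = x := by
    obtain ⟨hxR, z₀, hz₀⟩ := hx
    refine eq_of_isLLLLinearDecision hn (lam := τ ^ 2 * lam) L.det_ne_zero hW
      (scaling_pos hρ0 n T r) z₀ hz₀ (fun z hz => ?_) ?_ hdec
    · rw [hscale]
      exact le_regularized_norm hε hw₀ hW hlow hHO hz
    -- The noise threshold is `τ ^ (1/2)`, so the error energy is of order `τ`, while the squared
    -- distance is of order `τ²`.
    · have h1 : sqNorm w ≤ m * τ := by
        refine (sqNorm_le_of_abs_le fun i => (hw i).le).trans_eq ?_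
        rw [← Real.rpow_natCast, ← Real.rpow_mul hρ0.le, hτ]
        congr 2
        push_cast; ring
      have h2 : dotProduct x (W.mulVec x) ≤ |CR| := by
        have := hCR _ ⟨x, hxR, rfl⟩
        rw [Real.norm_eq_abs] at this
        exact (le_abs_self _).trans (this.trans (le_abs_self _))
      have h3 := (div_lt_iff₀ hlam0).1 hτ2
      have h4 : sqNorm w + dotProduct x (W.mulVec x) ≤ (m + |CR|) * τ := by
        nlinarith [abs_nonneg CR]
      calc 4 * 16 ^ n * (sqNorm w + dotProduct x (W.mulVec x))
          ≤ 4 * 16 ^ n * ((m + |CR|) * τ) := by gcongr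
        _ = 4 * 16 ^ n * (m + |CR|) * τ := by ring
        _ < τ * lam * τ := by gcongr
        _ = τ ^ 2 * lam := by ring
  rw [← hx']
  rw [← hx'] at hout
  refine timeoutDecoder_eq hout (ht.trans ?_)
  have h1 : Real.log (2 * K₀ * ρ ^ a / ε₁) = Real.log (2 * K₀ / ε₁) + a * Real.log ρ := by
    rw [mul_div_right_comm, Real.log_mul (by positivity) (by positivity), Real.log_rpow hρ0]
  rw [h1, mul_assoc]
  refine mul_le_mul_of_nonneg_left ?_ hcP.le
  linarith

end Main

/-! ### Probabilities of the bad events and the diversity exponent -/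

section Final

variable {m n : ℕ}

/-- Large channel gains are unlikely in a power limited channel. -/
theorem PowerLimited.eventually_le {μ : ℝ → Measure (Fin m → Fin n → ℝ)} (h : PowerLimited μ)
    (a : ℝ) : ∀ᶠ ρ : ℝ in atTop,
      μ ρ {H | ρ ^ a ≤ ∑ i, ∑ j, H i j ^ 2} ≤ ENNReal.ofReal (ρ ^ (2 - a)) := by
  filter_upwards [DotLE.eventually_le h one_lt_two, eventually_gt_atTop 0] with ρ h1 hρ
  have hpos : 0 < ρ ^ a := Real.rpow_pos_of_pos hρ a
  rw [Real.rpow_sub hρ, ENNReal.ofReal_div_of_pos hpos, ENNReal.le_div_iff_mul_le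
    (Or.inl (by simpa using hpos)) (Or.inl ENNReal.ofReal_ne_top), mul_comm]
  refine le_trans ?_ h1
  have hmeas : Measurable fun H : Fin m → Fin n → ℝ =>
      ENNReal.ofReal (∑ i, ∑ j, H i j ^ 2) := by fun_prop
  refine le_trans ?_ (mul_meas_ge_le_lintegral₀ hmeas.aemeasurable (ENNReal.ofReal (ρ ^ a)))
  exact mul_le_mul_right (measure_mono fun H hH => ENNReal.ofReal_le_ofReal hH) _

/-- Large noise is unlikely. -/
theorem eventually_noise_le (m : ℕ) {κ : ℝ} (hκ : 0 < κ) (b : ℝ) : ∀ᶠ ρ : ℝ in atTop,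
    noise m {w | ∃ i, ρ ^ κ ≤ |w i|} ≤ ENNReal.ofReal (ρ ^ (-b)) := by
  -- A moment with `q κ > b + 1`: the surplus power of `ρ` absorbs the constant `C`.
  obtain ⟨q, hq⟩ := exists_nat_gt ((b + 1) / κ)
  rw [div_lt_iff₀ hκ] at hq
  obtain ⟨C, -, h⟩ := noise_tail m q
  filter_upwards [eventually_ge_atTop 1, eventually_ge_atTop C] with ρ hρ hρC
  have hρ0 : 0 < ρ := by linarith
  refine (h _ (Real.rpow_pos_of_pos hρ0 κ)).trans (ENNReal.ofReal_le_ofReal ?_)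
  rw [← Real.rpow_natCast, ← Real.rpow_mul hρ0.le, div_le_iff₀ (Real.rpow_pos_of_pos hρ0 _),
    ← Real.rpow_add hρ0]
  calc C ≤ ρ ^ (1 : ℝ) := by rwa [Real.rpow_one]
    _ ≤ _ := Real.rpow_le_rpow_of_exponent_le hρ (by linarith)

/-- The ML error probability at `r` is a lower bound. From above, the error probability is at most
that of an outage at some `r' > r`, of a large channel gain, or of large noise. The last two are at
most `ρ ^ (-|D|)`, and the first is governed by `dML r'`. -/
theorem hasDiversity_timeoutDecoder (hn : 0 < n) {P : Program (Reg m n)} {cP D : ℝ} (hcP : 0 < cP)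
    (hP : ∀ (G W : Matrix (Fin n) (Fin n) ℝ) (φ : ℝ) (p : Observation m n) (ε K : ℝ),
      G.det ≠ 0 → W.PosDef → 0 < φ → 0 < ε → ε ≤ 1 → 1 ≤ K →
      (∀ v, ε * sqNorm v ≤ dotProduct v ((latticeGram G W (Matrix.of p.1)).mulVec v)) →
      (∀ i, latticeGram G W (Matrix.of p.1) i i ≤ K) →
      ∃ (x : Fin n → ℝ) (t : ℕ), Outputs P G W φ p x t ∧ IsLLLLinearDecision G W φ p x ∧
        (t : ℝ) ≤ cP * (Real.log (K / ε) + 1))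
    {T : ℕ} (hT : 0 < T) (L : LatticeDesign n) {W : Matrix (Fin n) (Fin n) ℝ} (hW : W.PosDef)
    {μ : ℝ → Measure (Fin m → Fin n → ℝ)} (hμ : ∀ ρ, IsProbabilityMeasure (μ ρ))
    (hpow : PowerLimited μ) {dML : ℝ → ℝ} {r : ℝ}
    (hML : ∀ᶠ r' in 𝓝[≥] r, HasMLDiversity L T μ r' (dML r'))
    (hcont : ContinuousWithinAt dML (Set.Ici r) r) (hD : dML r ≤ D) :
    HasDiversity L T μ r (fun ρ => timeoutDecoder P L.G W (scaling n T ρ r)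
      (cP * (|D| + 2 + 1) * Real.log ρ)) (dML r) := by
  obtain ⟨f, hf, hfdiv⟩ := hML.self_of_nhdsWithin Set.self_mem_Ici
  refine DotEq.of_le hfdiv (fun ρ hρ => ?_) fun y hy => ?_
  · have hρ0 : 0 < ρ := by linarith
    obtain ⟨X, hX⟩ := (L.codebook_finite T hρ0 r).exists_finset_coe
    have := hμ ρ
    have hfρ := hf ρ hρ0
    rw [← hX] at hfρ ⊢
    exact errorProb_ml_le hfρ _
  -- The slack: `y = -dML r + δ` with `δ > 0`, half of which is spent on the exponents and half on
  -- constants.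
  · set δ := y + dML r with hδ
    have hδ0 : 0 < δ := by linarith
    have hnear : ∀ᶠ r' in 𝓝[≥] r, dML r - δ / 4 < dML r' :=
      hcont.eventually (lt_mem_nhds (by linarith))
    have hright : 𝓝[>] r ≤ 𝓝[≥] r := nhdsWithin_mono r Set.Ioi_subset_Ici_self
    -- Right continuity supplies a strictly larger gain at which the ML diversity has dropped by
    -- less than `δ / 4`.
    obtain ⟨r', ⟨⟨f', hf', hf'div⟩, hr'd⟩, hr'⟩ :=
      (((hML.and hnear).filter_mono hright).and self_mem_nhdsWithin).exists
    have hr' : r < r' := hr'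
    obtain ⟨ε, hε, C, hC, hout⟩ := L.exists_outage_le m
    have hκ : 0 < (r' - r) * T / n / 2 := by
      have : (0 : ℝ) < T := by exact_mod_cast hT
      have : (0 : ℝ) < n := by exact_mod_cast hn
      have := sub_pos.2 hr'
      positivity
    have hdD : dML r ≤ |D| := hD.trans (le_abs_self D)
    filter_upwards [eventually_gt_atTop 1,
      DotEq.eventually_le hf'div (show -dML r' < -dML r + δ / 2 by linarith),
      hpow.eventually_le (|D| + 2), eventually_noise_le m hκ |D|,
      eventually_timeoutDecoder_eq hn hcP (by positivity : 0 ≤ |D| + 2) hP L hW hT hε hr',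
      -- Three terms of order `ρ ^ (-dML r + δ / 2)` with total constant `C + 2` are absorbed by `ρ
      -- ^ (δ / 2)`.
      (tendsto_rpow_atTop (half_pos hδ0)).eventually_ge_atTop (C + 2)]
      with ρ hρ herr hgain hnoise hdec hbig
    have hρ0 : 0 < ρ := by linarith
    obtain ⟨X, hX⟩ := (L.codebook_finite T hρ0 r).exists_finset_coe
    have := hμ ρ
    have hle := errorProb_le (X := X) (ν := μ ρ)
      (E := {w | ∃ i, ρ ^ ((r' - r) * T / n / 2) ≤ |w i|}) (fun x hx H w hH hw =>
      hdec x (by rw [← hX]; exact hx) H w hH hw)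
    rw [hX] at hle
    have hO := (hout T ρ r' hρ0 (μ ρ) (f' ρ) (hf' ρ hρ0).1).trans
      (mul_le_mul_right herr (ENNReal.ofReal C))
    rw [← ENNReal.ofReal_mul hC] at hO
    have hp0 : ∀ s : ℝ, 0 ≤ ρ ^ s := fun s => Real.rpow_nonneg hρ0.le s
    refine hle.trans (le_trans (add_le_add ((measure_union_le _ _).trans
      (add_le_add hO hgain)) hnoise) ?_)
    rw [← ENNReal.ofReal_add (mul_nonneg hC (hp0 _)) (hp0 _),
      ← ENNReal.ofReal_add (add_nonneg (mul_nonneg hC (hp0 _)) (hp0 _)) (hp0 _)]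
    refine ENNReal.ofReal_le_ofReal ?_
    have e1 : ρ ^ (2 - (|D| + 2)) ≤ ρ ^ (-dML r + δ / 2) :=
      Real.rpow_le_rpow_of_exponent_le hρ.le (by linarith)
    have e2 : ρ ^ (-|D|) ≤ ρ ^ (-dML r + δ / 2) :=
      Real.rpow_le_rpow_of_exponent_le hρ.le (by linarith)
    have e3 : ρ ^ y = ρ ^ (δ / 2) * ρ ^ (-dML r + δ / 2) := by
      rw [← Real.rpow_add hρ0]; congr 1; rw [hδ]; ring
    rw [e3]
    calc C * ρ ^ (-dML r + δ / 2) + ρ ^ (2 - (|D| + 2)) + ρ ^ (-|D|)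
        ≤ C * ρ ^ (-dML r + δ / 2) + ρ ^ (-dML r + δ / 2) + ρ ^ (-dML r + δ / 2) := by gcongr
      _ = (C + 2) * ρ ^ (-dML r + δ / 2) := by ring
      _ ≤ _ := mul_le_mul_of_nonneg_right hbig (hp0 _)

end Final

end LatticeDMT

end

theorem theorem3 (m n : ℕ) (hn : 0 < n) :
    -- a single program for the dimensions `m`, `n`
    ∃ P : LatticeDMT.Program (LatticeDMT.Reg m n),
      -- which, without time-out, is the LLL-aided linear regularized lattice decoder
      (∀ (G W : Matrix (Fin n) (Fin n) ℝ) (φ : ℝ) (p : LatticeDMT.Observation m n),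
        G.det ≠ 0 → W.PosDef → 0 < φ →
        ∃ (x : Fin n → ℝ) (t : ℕ), LatticeDMT.Outputs P G W φ p x t ∧
          LatticeDMT.IsLLLLinearDecision G W φ p x) ∧
      -- and which is DMT optimal when stopped after `c * log ρ` operations
      ∀ D : ℝ, ∃ c : ℝ, 0 < c ∧
        ∀ (T : ℕ), 0 < T →
        ∀ (L : LatticeDMT.LatticeDesign n) (W : Matrix (Fin n) (Fin n) ℝ), W.PosDef →
        ∀ (μ : ℝ → MeasureTheory.Measure (Fin m → Fin n → ℝ)),
          (∀ ρ, MeasureTheory.IsProbabilityMeasure (μ ρ)) → LatticeDMT.PowerLimited μ →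
        ∀ (dML : ℝ → ℝ) (r : ℝ), 0 ≤ r →
          (∀ᶠ r' in nhdsWithin r (Set.Ici r), LatticeDMT.HasMLDiversity L T μ r' (dML r')) →
          ContinuousWithinAt dML (Set.Ici r) r →
          dML r ≤ D →
          LatticeDMT.HasDiversity L T μ r
            (fun ρ => LatticeDMT.timeoutDecoder P L.G W (LatticeDMT.scaling n T ρ r)
              (c * Real.log ρ))
            (dML r) := by
  obtain ⟨P, cP, hcP, hP⟩ := LatticeDMT.exists_program m n
  refine ⟨P, fun G W φ p hG hW hφ => ?_, fun D => ⟨cP * (|D| + 2 + 1), by positivity, ?_⟩⟩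
  · obtain ⟨ε, hε, hε1, K, hK, hb⟩ := LatticeDMT.exists_latticeGram_bounds m hG hW
    have hS : 0 ≤ ∑ i, ∑ j, p.1 i j ^ 2 :=
      Finset.sum_nonneg fun i _ => Finset.sum_nonneg fun j _ => sq_nonneg _
    obtain ⟨x, t, h1, h2, -⟩ := hP G W φ p ε (K * (1 + ∑ i, ∑ j, p.1 i j ^ 2)) hG hW hφ hε hε1
      (one_le_mul_of_one_le_of_one_le hK (by linarith)) (hb p.1).1 (hb p.1).2
    exact ⟨x, t, h1, h2⟩
  · intro T hT L W hW μ hμ hpow dML r _ hML hcont hD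
    exact LatticeDMT.hasDiversity_timeoutDecoder hn hcP hP hT L hW hμ hpow hML hcont hD
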